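/- **Setting.** Let $\mathcal S,\mathcal A$ be finite sets, $\mathsf P(s'|s,a)$ a transition kernel, $\zeta$ an initial distribution on $\mathcal S$, $\gamma\in(0,1)$, and $\pi_E$ an expert policy. Policies are directly parameterized: $\pi_\theta(a|s)=\theta_{s,a}$ with $\theta\in\Theta_p=\{\theta:\theta_{s,a}\ge 0,\ \sum_a\theta_{s,a}=1\}$. Rewards $r_\alpha(s,a)$ are parameterized by $\alpha\in\Lambda$, with $\Lambda\subset\mathbb R^q$ nonempty, closed and convex, of diameter at most $C_\alpha$, and $|r_\alpha(s,a)|\le R_{\max}$ on $\Lambda$. Let $V(\pi,r)=\mathbb E\big[\sum_{t\ge0}\gamma^t r(s_t,a_t)\big]$ with $s_0\sim\zeta$, $a_t\sim\pi(\cdot|s_t)$, $s_{t+1}\sim\mathsf P(\cdot|s_t,a_t)$, and $$F(\theta,\alpha)=V(\pi_E,r_\alpha)-V(\pi_\theta,r_\alpha)-\psi(\alpha),\qquad g(\theta)=\max_{\alpha\in\Lambda}F(\theta,\alpha),\qquad \theta^*\in\arg\min_{\theta\in\Theta_p}g(\theta).$$ Put $\tilde{\mathsf P}(\cdot|s,a)=\gamma\mathsf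 P(\cdot|s,a)+(1-\gamma)\zeta(\cdot)$. **Assumptions.** (i) $\psi$ is differentiable with $L_\psi$-Lipschitz gradient on $\Lambda$. (ii) For every $\theta\in\Theta_p$, $F(\theta,\cdot)$ is $\mu$-strongly concave on $\Lambda$, $\mu>0$. (iii) There are $C_M>0$, $\rho\in(0,1)$ such that, for the kernel $\mathsf P$ or for the kernel $\tilde{\mathsf P}$, and for every $\theta\in\Theta_p$, the state chain under $\pi_\theta$ has a stationary distribution $\chi_\theta$ with $\sup_s d_{TV}(\mathbb P(s_t\in\cdot|s_0=s),\chi_\theta)\le C_M\rho^t$ for all $t\ge0$. (iv) $r_\alpha(s,a)$ is differentiable in $\alpha$ at the points of $\Lambda$, with $\big(\sum_{i=1}^q\|\partial r_\alpha/\partial\alpha_i\|_\infty^2\big)^{1/2}\le C_r$ and $\|\nabla_\alpha r_{\alpha_1}(s,a)-\nabla_\alpha r_{\alpha_2}(s,a)\|_2\le L_r\|\alpha_1-\alpha_2\|_2$. (v) $\min_s\zeta(s)\ge\zeta_{\min}>0$. **Algorithm (FWPG-GAIL).** Start from any $\theta_0\in\Theta_p$. For $t=0,\dots,T-1$: pick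 $\alpha^t_0\in\Lambda$ (arbitrarily, possibly at random); for $k=0,\dots,K-1$ draw the next $B$ state-action pairs $(s^E_i,a^E_i)$ of the chain $(\tilde{\mathsf P},\pi_E)$ and the next $B$ pairs $(s_i,a_i)$ of the chain $(\tilde{\mathsf P},\pi_{\theta_t})$, and set $$\alpha^t_{k+1}=P_\Lambda\Big(\alpha^t_k+\beta\Big[\tfrac{1}{(1-\gamma)B}\sum_{i=0}^{B-1}\big(\nabla_\alpha r_{\alpha^t_k}(s^E_i,a^E_i)-\nabla_\alpha r_{\alpha^t_k}(s_i,a_i)\big)-\nabla\psi(\alpha^t_k)\Big]\Big),\qquad \beta=\frac{\mu}{4L_{22}^2},\quad L_{22}=\frac{2\sqrt q\,L_r}{1-\gamma}+L_\psi .$$ Put $\alpha_t=\alpha^t_K$, draw the next $b$ pairs $(s_i,a_i)$ of the chain $(\tilde{\mathsf P},\pi_{\theta_t})$, let $$\widehat\nabla_\theta F(\theta_t,\alpha_t)_{s,a}=-\frac{1}{b(1-\gamma)}\sum_{i=0}^{b-1}\hat Q_i(s,a)\mathbf 1\{s_i=s\},$$ and update $\theta_{t+1}=\theta_t+\eta(\hat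 v_t-\theta_t)$ with $\hat v_t\in\arg\max_{\theta\in\Theta_p}\langle\theta,-\widehat\nabla_\theta F(\theta_t,\alpha_t)\rangle$ and $\eta=\frac{1-\gamma}{\sqrt T}$. Here $\hat Q_i(s,a)$ is the output of a fresh run of EstQ: draw $n\in\{0,1,\dots\}$ with probability $(1-\gamma^{1/2})\gamma^{n/2}$, run $(s,a)=(s'_0,a'_0),\dots,(s'_n,a'_n)$ under $\mathsf P$ and $\pi_{\theta_t}$, and return $\sum_{j=0}^n\gamma^{j/2}r_{\alpha_t}(s'_j,a'_j)$. All expert samples form one single trajectory and all learner samples form one single trajectory throughout the execution (with arbitrary first pairs). **Theorem.** There are constants $C,c>0$ depending only on $|\mathcal S|,|\mathcal A|,q,\mu,L_\psi,C_M,\rho,C_r,L_r,C_\alpha,R_{\max},\zeta_{\min}$ (in particular not on $\gamma,T,K,B,b$) such that for all such problems, all $T,K,B,b\ge1$ and every run of FWPG-GAIL, $$\frac1T\sum_{t=0}^{T-1}\mathbb E[g(\theta_t)]-g(\theta^*)\le C\left(\frac{1}{(1-\gamma)^3\sqrt T}+\frac{e^{-c(1-\gamma)^2K}}{(1-\gamma)^2}+\frac{1}{(1-\gamma)^3\sqrt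 B}+\frac{1}{(1-\gamma)^3\sqrt b}\right).$$ Consequently, for every $\gamma$ there is a constant $C'$ (depending only on $\gamma$ and the above quantities) such that for every $\varepsilon\in(0,1)$ one can choose $T,B,b\le C'\varepsilon^{-2}$ and $K\le C'(1+\log\frac1\varepsilon)$ for which $\frac1T\sum_{t<T}\mathbb E[g(\theta_t)]-g(\theta^*)\le\varepsilon$ holds for every such problem and run, with overall sample complexity $T(KB+b)\le C'\varepsilon^{-4}(1+\log\frac1\varepsilon)=\tilde{\mathcal O}(\varepsilon^{-4})$. -/

import Mathlib

open MeasureTheory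

universe u v w

noncomputable section

/-- The set of (directly parameterized) policies: arrays `θ s a ≥ 0` with `∑ a, θ s a = 1`. -/
def policySimplex (S A : Type*) [Fintype A] : Set (S → A → ℝ) :=
  {θ | (∀ s a, 0 ≤ θ s a) ∧ ∀ s, ∑ a, θ s a = 1}

/-- The data of a GAIL problem: a finite MDP with transition probabilities `P s a s'`, initial
distribution `ζ`, discount factor `γ ∈ (0,1)`, an expert policy `πE`, a reward class `r α s a` with
parameter `α` in a nonempty closed set `Λ ⊆ ℝ^q`, and a regularizer `ψ`. -/
structure GAILProblem (S A : Type*) [Fintype S] [Fintype A] (q : ℕ) where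
  P : S → A → S → ℝ
  P_nonneg : ∀ s a s', 0 ≤ P s a s'
  P_sum : ∀ s a, ∑ s', P s a s' = 1
  ζ : S → ℝ
  ζ_nonneg : ∀ s, 0 ≤ ζ s
  ζ_sum : ∑ s, ζ s = 1
  γ : ℝ
  γ_pos : 0 < γ
  γ_lt_one : γ < 1
  πE : S → A → ℝ
  πE_mem : πE ∈ policySimplex S A
  r : EuclideanSpace ℝ (Fin q) → S → A → ℝ
  Λ : Set (EuclideanSpace ℝ (Fin q))
  Λ_nonempty : Λ.Nonempty
  Λ_closed : IsClosed Λ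
  ψ : EuclideanSpace ℝ (Fin q) → ℝ

/-- State-to-state transition matrix of the Markov chain with transition kernel `kern` and
policy `π`. -/
def chainMatrix {S A : Type*} [Fintype A] (kern : S → A → S → ℝ) (π : S → A → ℝ) :
    Matrix S S ℝ :=
  fun s s' => ∑ a, π s a * kern s a s'

/-- `χ` is a stationary probability distribution of the chain with kernel `kern` and policy `π`,
and the chain converges to it in total variation (half the `ℓ¹` distance) at rate `CM * ρ ^ t`,
uniformly over the starting state. -/
def UniformlyErgodicAt {S A : Type*} [Fintype S] [Fintype A] [DecidableEq S]
    (kern : S → A → S → ℝ) (CM ρ : ℝ) (π : S → A → ℝ) : Prop :=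
  ∃ χ : S → ℝ, (∀ s, 0 ≤ χ s) ∧ (∑ s, χ s = 1) ∧
    (∀ s', ∑ s, χ s * chainMatrix kern π s s' = χ s') ∧
    ∀ (t : ℕ) (s : S),
      (1 / 2) * ∑ s', |((chainMatrix kern π) ^ t) s s' - χ s'| ≤ CM * ρ ^ t

namespace GAILProblem

variable {S A : Type*} [Fintype S] [Fintype A] {q : ℕ}

/-- The sampling kernel `P̃(s' | s, a) = γ P(s' | s, a) + (1 - γ) ζ(s')`. -/
def Ptilde (G : GAILProblem S A q) : S → A → S → ℝ :=
  fun s a s' => G.γ * G.P s a s' + (1 - G.γ) * G.ζ s'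

/-- The average value `V(π, ρ) = E[∑ₜ γᵗ ρ(sₜ, aₜ)]` with `s₀ ∼ ζ`, `aₜ ∼ π(· | sₜ)`,
`sₜ₊₁ ∼ P(· | sₜ, aₜ)`. -/
def V [DecidableEq S] (G : GAILProblem S A q) (π : S → A → ℝ) (rew : S → A → ℝ) : ℝ :=
  ∑' t : ℕ, G.γ ^ t *
    ∑ s, (∑ s₀, G.ζ s₀ * ((chainMatrix G.P π) ^ t) s₀ s) * ∑ a, π s a * rew s a

/-- The objective `F(θ, α) = V(π_E, r_α) - V(π_θ, r_α) - ψ(α)`. -/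
def F [DecidableEq S] (G : GAILProblem S A q) (θ : S → A → ℝ)
    (α : EuclideanSpace ℝ (Fin q)) : ℝ :=
  G.V G.πE (G.r α) - G.V θ (G.r α) - G.ψ α

/-- The marginal maximum function `g(θ) = max_{α ∈ Λ} F(θ, α)`. -/
def g [DecidableEq S] (G : GAILProblem S A q) (θ : S → A → ℝ) : ℝ :=
  sSup (G.F θ '' G.Λ)

/-- The gradient `∇_α r_α(s, a)`. -/
def gradReward (G : GAILProblem S A q) (α : EuclideanSpace ℝ (Fin q)) (s : S) (a : A) :
    EuclideanSpace ℝ (Fin q) :=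
  gradient (fun α' => G.r α' s a) α

/-- The standing assumptions, with all constants made explicit. -/
structure Assumptions [DecidableEq S] (G : GAILProblem S A q)
    (μ Lψ CM ρ Cr Lr Cα Rmax ζmin : ℝ) : Prop where
  /-- `Λ` is bounded, with diameter at most `Cα`. -/
  Λ_bounded : ∀ α₁ ∈ G.Λ, ∀ α₂ ∈ G.Λ, ‖α₁ - α₂‖ ≤ Cα
  /-- Rewards are bounded by `Rmax`. -/
  r_bounded : ∀ α ∈ G.Λ, ∀ s a, |G.r α s a| ≤ Rmax
  /-- The initial distribution charges every state. -/
  ζ_lower : ∀ s, ζmin ≤ G.ζ s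
  /-- The regularizer is differentiable with `Lψ`-Lipschitz gradient. -/
  ψ_diff : ∀ α ∈ G.Λ, DifferentiableAt ℝ G.ψ α
  ψ_grad_lip : ∀ α₁ ∈ G.Λ, ∀ α₂ ∈ G.Λ,
    ‖gradient G.ψ α₁ - gradient G.ψ α₂‖ ≤ Lψ * ‖α₁ - α₂‖
  /-- The objective is `μ`-strongly concave in `α ∈ Λ`, for every policy. -/
  F_strongConcave : ∀ θ ∈ policySimplex S A, StrongConcaveOn G.Λ μ (G.F θ)
  /-- Uniform ergodicity for the kernel `P` or for the kernel `P̃`. -/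
  ergodic : (∀ θ ∈ policySimplex S A, UniformlyErgodicAt G.P CM ρ θ) ∨
    (∀ θ ∈ policySimplex S A, UniformlyErgodicAt G.Ptilde CM ρ θ)
  /-- The reward is differentiable in its parameter, and `‖∇_α r_α‖_{∞,2} ≤ Cr`. -/
  r_diff : ∀ α ∈ G.Λ, ∀ s a, DifferentiableAt ℝ (fun α' => G.r α' s a) α
  r_grad_bounded : ∀ α ∈ G.Λ,
    Real.sqrt (∑ i, (⨆ p : S × A, |G.gradReward α p.1 p.2 i|) ^ 2) ≤ Cr
  /-- The reward gradient is `Lr`-Lipschitz in the parameter. -/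
  r_grad_lip : ∀ s a, ∀ α₁ ∈ G.Λ, ∀ α₂ ∈ G.Λ,
    ‖G.gradReward α₁ s a - G.gradReward α₂ s a‖ ≤ Lr * ‖α₁ - α₂‖

/-- Expectation of `f (s', a')` after one step of the chain `P̃^π` from the state-action pair `x`:
`s' ∼ P̃(· | x)`, `a' ∼ π(· | s')`. -/
def stepExp (G : GAILProblem S A q) (π : S → A → ℝ) (x : S × A) (f : S × A → ℝ) : ℝ :=
  ∑ s', G.Ptilde x.1 x.2 s' * ∑ a', π s' a' * f (s', a')

/-- Expectation of `h` of the value returned by a rollout of EstQ that is currently in `(s, a)` at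
time `j`, has accumulated `acc` so far and has `n` further transitions (under `P` and `π`) to go.
At time `j` the reward is collected with weight `γ^(j/2)`. -/
def rolloutExp (G : GAILProblem S A q) (rew : S → A → ℝ) (π : S → A → ℝ) (h : ℝ → ℝ) :
    ℕ → ℕ → ℝ → S → A → ℝ
  | 0, j, acc, s, a => h (acc + Real.sqrt G.γ ^ j * rew s a)
  | n + 1, j, acc, s, a => ∑ s', G.P s a s' * ∑ a', π s' a' *
      rolloutExp G rew π h n (j + 1) (acc + Real.sqrt G.γ ^ j * rew s a) s' a'

/-- Expectation of `h(Q̂)`, where `Q̂` is the output of EstQ with input `(s, a)`, policy `π` and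
reward `rew`: the horizon `n` is geometric, `Prob(n) = (1 - γ^(1/2)) γ^(n/2)` for `n = 0, 1, …`, and
`Q̂ = ∑_{j ≤ n} γ^(j/2) rew(s_j, a_j)` along a rollout under `P` and `π` started at `(s, a)`. -/
def estQExp (G : GAILProblem S A q) (rew : S → A → ℝ) (π : S → A → ℝ) (s : S) (a : A)
    (h : ℝ → ℝ) : ℝ :=
  ∑' n : ℕ, (1 - Real.sqrt G.γ) * Real.sqrt G.γ ^ n * G.rolloutExp rew π h n 0 0 s a

/-- The stochastic gradient of `F` in `α` built from length-`B` expert and learner batches. -/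
def gradAlphaEst (G : GAILProblem S A q) (B : ℕ) (xE x : ℕ → S × A)
    (α : EuclideanSpace ℝ (Fin q)) : EuclideanSpace ℝ (Fin q) :=
  (1 / ((1 - G.γ) * (B : ℝ))) •
    (∑ i ∈ Finset.range B,
      (G.gradReward α (xE i).1 (xE i).2 - G.gradReward α (x i).1 (x i).2))
    - gradient G.ψ α

/-- The stochastic gradient of `F` in `θ` built from a length-`b` batch of learner states and, for
each sample `i` of the batch, EstQ outputs `Q i s a`. -/
def gradThetaEst [DecidableEq S] (G : GAILProblem S A q) (b : ℕ) (x : ℕ → S × A)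
    (Q : ℕ → S → A → ℝ) : S → A → ℝ :=
  fun s a => -(1 / ((b : ℝ) * (1 - G.γ))) *
    ∑ i ∈ Finset.range b, if (x i).1 = s then Q i s a else 0

end GAILProblem

/-- `p` is a Euclidean projection of `y` on the set `Λ`. -/
def IsProjOn {q : ℕ} (Λ : Set (EuclideanSpace ℝ (Fin q))) (y p : EuclideanSpace ℝ (Fin q)) :
    Prop :=
  p ∈ Λ ∧ ∀ z ∈ Λ, ‖y - p‖ ≤ ‖y - z‖

/-- A run of FWPG-GAIL on a probability space: `T` outer iterations, `K` inner iterations,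
batch sizes `B` (reward update) and `b` (policy update), stepsizes `η` (policy) and `β` (reward).

The learner's samples `x 0, x 1, …` form one single trajectory; outer iteration `t` uses the
`K * B + b` samples with indices starting from `t * (K * B + b)`: first `K` batches of length `B`
for the reward updates, then one batch of length `b` for the policy update. The expert's samples
`xE 0, xE 1, …` also form one single trajectory, of which outer iteration `t`, inner
iteration `k` uses the `B` samples starting from `(t * K + k) * B`. The first pair of each
trajectory is arbitrary.

The σ-algebra `before n` is the history just before the `n`-th learner sample is drawn (it contains
the current iterates), and `after n` is the history just after this sample is drawn. -/
structure FWPGRun {S A : Type*} [Fintype S] [Fintype A] [DecidableEq S] {q : ℕ}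
    (G : GAILProblem S A q) (η β : ℝ) (T K B b : ℕ)
    {Ω : Type*} [mΩ : MeasurableSpace Ω] (Pr : Measure Ω) where
  before : ℕ → MeasurableSpace Ω
  after : ℕ → MeasurableSpace Ω
  before_le_after : ∀ n, before n ≤ after n
  after_le_before : ∀ n, after n ≤ before (n + 1)
  after_le : ∀ n, after n ≤ mΩ
  /-- learner and expert trajectories of state-action pairs -/
  x : ℕ → Ω → S × A
  xE : ℕ → Ω → S × A
  /-- `Qhat t i s a` is the output of EstQ at `(s, a)` for the `i`-th policy-gradient sample -/
  Qhat : ℕ → ℕ → S → A → Ω → ℝ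
  /-- reward iterates `α t k`, policy iterates `θ t` and Frank–Wolfe directions `v t` -/
  α : ℕ → ℕ → Ω → EuclideanSpace ℝ (Fin q)
  θ : ℕ → Ω → S → A → ℝ
  v : ℕ → Ω → S → A → ℝ
  /-- Adaptedness. -/
  θ_meas : ∀ t < T, StronglyMeasurable[before (t * (K * B + b))] (θ t)
  α_meas : ∀ t < T, ∀ k ≤ K, StronglyMeasurable[before (t * (K * B + b) + k * B)] (α t k)
  x_meas : ∀ n < T * (K * B + b), ∀ p, MeasurableSet[after n] (x n ⁻¹' {p})
  xE_meas : ∀ t < T, ∀ k < K, ∀ i < B, ∀ p,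
    MeasurableSet[after (t * (K * B + b) + k * B + i)] (xE ((t * K + k) * B + i) ⁻¹' {p})
  Qhat_meas : ∀ t < T, ∀ i < b, ∀ s a,
    StronglyMeasurable[before (t * (K * B + b) + K * B + i + 1)] (Qhat t i s a)
  /-- Learner sampling: given the past, the next pair is one step of the chain `P̃` with the
  policy of the current outer iteration. -/
  x_law : ∀ n, n + 1 < T * (K * B + b) → ∀ f : S × A → ℝ,
    condExp (before (n + 1)) Pr (fun ω => f (x (n + 1) ω)) =ᵐ[Pr]
      fun ω => G.stepExp (θ ((n + 1) / (K * B + b)) ω) (x n ω) f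
  /-- Expert sampling: given the past, the next pair is one step of the chain `P̃` with `π_E`. -/
  xE_law : ∀ t < T, ∀ k < K, ∀ i < B, ∀ m, (t * K + k) * B + i = m + 1 → ∀ f : S × A → ℝ,
    condExp (before (t * (K * B + b) + k * B + i)) Pr (fun ω => f (xE (m + 1) ω)) =ᵐ[Pr]
      fun ω => G.stepExp G.πE (xE m ω) f
  /-- Every `Qhat t i s a` is a fresh run of EstQ with reward `r_{α_t}` and policy `π_{θ_t}`:
  its conditional law given the past (including the `i`-th sample) is the law of EstQ. -/
  Qhat_law : ∀ t < T, ∀ i < b, ∀ s a, ∀ h : ℝ → ℝ, Measurable h → (∃ M, ∀ y, |h y| ≤ M) →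
    condExp (after (t * (K * B + b) + K * B + i)) Pr (fun ω => h (Qhat t i s a ω)) =ᵐ[Pr]
      fun ω => G.estQExp (G.r (α t K ω)) (θ t ω) s a h
  /-- Initializations (the choice of `α t 0 ∈ Λ` may be random). -/
  θ_init : ∀ ω, θ 0 ω ∈ policySimplex S A
  α_init : ∀ t < T, ∀ ω, α t 0 ω ∈ G.Λ
  /-- Projected stochastic gradient ascent for the reward. -/
  α_step : ∀ t < T, ∀ k < K, ∀ ω, IsProjOn G.Λ
    (α t k ω + β • G.gradAlphaEst B (fun i => xE ((t * K + k) * B + i) ω)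
      (fun i => x (t * (K * B + b) + k * B + i) ω) (α t k ω))
    (α t (k + 1) ω)
  /-- `v t ∈ argmax_{θ' ∈ Θ_p} ⟨θ', -∇̂_θ F(θ_t, α_t)⟩`, with arbitrary tie-breaking. -/
  v_mem : ∀ t < T, ∀ ω, v t ω ∈ policySimplex S A
  v_max : ∀ t < T, ∀ ω, IsMaxOn
    (fun θ' : S → A → ℝ => ∑ s, ∑ a, θ' s a *
      (-(G.gradThetaEst b (fun i => x (t * (K * B + b) + K * B + i) ω)
        (fun i s a => Qhat t i s a ω) s a)))
    (policySimplex S A) (v t ω)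
  /-- Frank–Wolfe policy update. -/
  θ_step : ∀ t < T, ∀ ω, θ (t + 1) ω = θ t ω + η • (v t ω - θ t ω)

/-- The Lipschitz constant `L₂₂ = 2 √q L_r / (1 - γ) + L_ψ` of `∇_α F` in `α`. -/
def L22 (q : ℕ) (γ Lr Lψ : ℝ) : ℝ := 2 * Real.sqrt q * Lr / (1 - γ) + Lψ

/-- The averaged expected value `(1/T) ∑_{t<T} E[g(θ_t)]` along a run. -/
def FWPGRun.avgValue {S A : Type*} [Fintype S] [Fintype A] [DecidableEq S] {q : ℕ}
    {G : GAILProblem S A q} {η β : ℝ} {T K B b : ℕ} {Ω : Type*} [MeasurableSpace Ω]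
    {Pr : Measure Ω} (R : FWPGRun G η β T K B b Pr) : ℝ :=
  (1 / (T : ℝ)) * ∑ t ∈ Finset.range T, ∫ ω, G.g (R.θ t ω) ∂Pr

end

/-! The policy update is a Frank–Wolfe step on a nonconvex objective; gradient dominance makes it
converge globally. By the performance difference identity `GAILProblem.V_sub_V`, a change of policy
alters `V` by a sum of advantages weighted with visitation probabilities. These lie between `(1 - γ)
* ζmin` and `1`, so a greedy policy improves the linearized objective by at least `(1 - γ)^2 * ζmin`
times any possible gain in `V` (`exists_policy_improvement`). The same identity, applied to two
consecutive iterates, yields the descent of `g` without any smoothness estimate for `V`. It involves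
the visitation distribution and the best reward of the new policy, and replacing them by those of
the old one costs `O(η / (1 - γ))` (`frankWolfe_step`).

The power of `1 - γ` is governed by the oscillation of the state-action values. Differences of
policies annihilate functions of the state alone, and mixing bounds the oscillation of `qFn` by
`mixConst` times the size of the reward, uniformly in `γ`. Hence `V`, the visitation distribution
and the best reward are Lipschitz in the policy with at most one factor `1 / (1 - γ)`. Both forms of
the ergodicity hypothesis enter only through `Mixes`.

For fixed policy, strong concavity makes projected ascent on the reward parameter a contraction with
factor `1 - (7/32) μ² / L22²`, up to the error of the stochastic gradient (`rewardDist_succ_le`). As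
`L22` is of order `1 / (1 - γ)`, this produces the term `exp (-c (1 - γ)² K)`.

The sampling errors are second moment bounds. The visitation distribution is stationary for the
chain of `P̃`, so centered functions of the samples have geometrically decaying correlations,
whatever the first pair is (`SampleBatch.integral_abs_avg_sub_le`). In the policy gradient, EstQ is
bounded and unbiased, its fluctuations are orthogonal given the history, and what is left is the
error of the state frequencies (`SampleBatch.integral_abs_estQ_sub_le`).

Summing the one-step inequality along the run telescopes `g`; division by `T * (1 - γ)^2 * ζmin`
gives the theorem. -/

noncomputable section

open Matrix Finset

/-! ### Discounted resolvent of a stochastic matrix. -/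

section Resolvent

variable {S : Type*} [Fintype S] [DecidableEq S]

/-- The discounted resolvent `∑ₜ γᵗ Mᵗ`, entrywise. -/
def discResolvent (γ : ℝ) (M : Matrix S S ℝ) : Matrix S S ℝ :=
  fun i j => ∑' t : ℕ, γ ^ t * (M ^ t) i j

variable {γ : ℝ} {M : Matrix S S ℝ}

lemma pow_apply_nonneg (hM : M ∈ rowStochastic ℝ S) (t : ℕ) (i j : S) : 0 ≤ (M ^ t) i j :=
  nonneg_of_mem_rowStochastic (pow_mem hM t)

lemma pow_apply_le_one (hM : M ∈ rowStochastic ℝ S) (t : ℕ) (i j : S) : (M ^ t) i j ≤ 1 :=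
  le_one_of_mem_rowStochastic (pow_mem hM t)

lemma summable_discResolvent (hγ₀ : 0 ≤ γ) (hγ₁ : γ < 1) (hM : M ∈ rowStochastic ℝ S) (i j : S) :
    Summable fun t : ℕ => γ ^ t * (M ^ t) i j :=
  Summable.of_nonneg_of_le
    (fun t => mul_nonneg (pow_nonneg hγ₀ t) (pow_apply_nonneg hM t i j))
    (fun t => mul_le_of_le_one_right (pow_nonneg hγ₀ t) (pow_apply_le_one hM t i j))
    (summable_geometric_of_lt_one hγ₀ hγ₁)

lemma discResolvent_nonneg (hγ₀ : 0 ≤ γ) (hM : M ∈ rowStochastic ℝ S) (i j : S) :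
    0 ≤ discResolvent γ M i j :=
  tsum_nonneg fun t => mul_nonneg (pow_nonneg hγ₀ t) (pow_apply_nonneg hM t i j)

lemma hasSum_discResolvent_mulVec (hγ₀ : 0 ≤ γ) (hγ₁ : γ < 1) (hM : M ∈ rowStochastic ℝ S)
    (f : S → ℝ) (i : S) :
    HasSum (fun t : ℕ => γ ^ t * (M ^ t *ᵥ f) i) ((discResolvent γ M *ᵥ f) i) := by
  have h := hasSum_sum (s := (univ : Finset S)) (f := fun j t => γ ^ t * (M ^ t) i j * f j)
    (a := fun j => discResolvent γ M i j * f j)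
    fun j _ => (summable_discResolvent hγ₀ hγ₁ hM i j).hasSum.mul_right (f j)
  convert h using 1
  · ext t
    simp [mulVec, dotProduct, mul_sum, mul_assoc]
  · rfl

/-- The two orders of the factors serve different ends: with `M` on the right one gets the flow
balance of the visitation distribution, with `M` on the left (the primed version) the Bellman
equation. -/
lemma discResolvent_eq_add_mul (hγ₀ : 0 ≤ γ) (hγ₁ : γ < 1) (hM : M ∈ rowStochastic ℝ S) :
    discResolvent γ M = 1 + γ • (discResolvent γ M * M) := by
  ext i j
  have h1 := (summable_discResolvent hγ₀ hγ₁ hM i j).tsum_eq_zero_add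
  have h2 : HasSum (fun t : ℕ => ∑ k, γ ^ t * (M ^ t) i k * M k j)
      (∑ k, discResolvent γ M i k * M k j) :=
    hasSum_sum fun k _ => (summable_discResolvent hγ₀ hγ₁ hM i k).hasSum.mul_right (M k j)
  have h3 := (h2.mul_left γ).tsum_eq
  rw [discResolvent, h1]
  simp only [pow_zero, one_mul, Matrix.add_apply, Matrix.smul_apply, Matrix.mul_apply, smul_eq_mul]
  rw [← h3]
  congr 1
  refine tsum_congr fun t => ?_
  rw [pow_succ M, Matrix.mul_apply, mul_sum, mul_sum]
  refine sum_congr rfl fun k _ => ?_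
  ring

lemma discResolvent_eq_add_mul' (hγ₀ : 0 ≤ γ) (hγ₁ : γ < 1) (hM : M ∈ rowStochastic ℝ S) :
    discResolvent γ M = 1 + γ • (M * discResolvent γ M) := by
  ext i j
  have h1 := (summable_discResolvent hγ₀ hγ₁ hM i j).tsum_eq_zero_add
  have h2 : HasSum (fun t : ℕ => ∑ k, M i k * (γ ^ t * (M ^ t) k j))
      (∑ k, M i k * discResolvent γ M k j) :=
    hasSum_sum fun k _ => (summable_discResolvent hγ₀ hγ₁ hM k j).hasSum.mul_left (M i k)
  have h3 := (h2.mul_left γ).tsum_eq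
  rw [discResolvent, h1]
  simp only [pow_zero, one_mul, Matrix.add_apply, Matrix.smul_apply, Matrix.mul_apply, smul_eq_mul]
  rw [← h3]
  congr 1
  refine tsum_congr fun t => ?_
  rw [pow_succ' M, Matrix.mul_apply, mul_sum, mul_sum]
  refine sum_congr rfl fun k _ => ?_
  ring

lemma discResolvent_sum_row (hγ₀ : 0 ≤ γ) (hγ₁ : γ < 1) (hM : M ∈ rowStochastic ℝ S) (i : S) :
    ∑ j, discResolvent γ M i j = 1 / (1 - γ) := by
  have h := hasSum_discResolvent_mulVec hγ₀ hγ₁ hM 1 i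
  have h2 : ∀ t : ℕ, (M ^ t *ᵥ 1) i = (1 : ℝ) := fun t => by
    rw [(mem_rowStochastic.1 (pow_mem hM t)).2]; rfl
  simp only [h2, mul_one] at h
  have h3 := h.unique (hasSum_geometric_of_lt_one hγ₀ hγ₁)
  simpa [mulVec, dotProduct] using h3

lemma abs_sum_mul_le {ι : Type*} [Fintype ι] {f : ι → ℝ} {H : ℝ} (hf : ∀ s, |f s| ≤ H) (w : ι → ℝ) :
    |∑ j, w j * f j| ≤ (∑ j, |w j|) * H := by
  rw [sum_mul]
  refine (abs_sum_le_sum_abs _ _).trans (sum_le_sum fun j _ => ?_)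
  rw [abs_mul]
  exact mul_le_mul_of_nonneg_left (hf j) (abs_nonneg _)

lemma abs_avg_le {ι : Type*} [Fintype ι] {w f : ι → ℝ} {H : ℝ} (hw : ∀ i, 0 ≤ w i)
    (hw1 : ∑ i, w i = 1) (hf : ∀ i, |f i| ≤ H) : |∑ i, w i * f i| ≤ H := by
  calc |∑ i, w i * f i| ≤ ∑ i, w i * H := by
        refine (abs_sum_le_sum_abs _ _).trans (sum_le_sum fun j _ => ?_)
        rw [abs_mul, abs_of_nonneg (hw j)]
        exact mul_le_mul_of_nonneg_left (hf j) (hw j)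
    _ = H := by rw [← sum_mul, hw1, one_mul]

end Resolvent

/-! ### Visitation distribution, value functions, performance difference. -/

namespace GAILProblem

variable {S A : Type*} [Fintype S] [Fintype A] {q : ℕ}

lemma sum_Ptilde (G : GAILProblem S A q) (s : S) (a : A) : ∑ s', G.Ptilde s a s' = 1 := by
  simp only [Ptilde, sum_add_distrib, ← mul_sum, G.P_sum, G.ζ_sum]
  ring

lemma Ptilde_nonneg (G : GAILProblem S A q) (s : S) (a : A) (s' : S) : 0 ≤ G.Ptilde s a s' :=
  add_nonneg (mul_nonneg G.γ_pos.le (G.P_nonneg _ _ _))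
    (mul_nonneg (by linarith [G.γ_lt_one]) (G.ζ_nonneg _))

variable [DecidableEq S]

lemma chainMatrix_mem_rowStochastic {kern : S → A → S → ℝ} (h0 : ∀ s a s', 0 ≤ kern s a s')
    (h1 : ∀ s a, ∑ s', kern s a s' = 1) {π : S → A → ℝ} (hπ : π ∈ policySimplex S A) :
    chainMatrix kern π ∈ rowStochastic ℝ S := by
  rw [mem_rowStochastic_iff_sum]
  refine ⟨fun i j => sum_nonneg fun a _ => mul_nonneg (hπ.1 _ _) (h0 _ _ _), fun i => ?_⟩
  simp only [chainMatrix]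
  rw [sum_comm]
  simp only [← mul_sum, h1, mul_one, hπ.2]

lemma chain_mem (G : GAILProblem S A q) {π : S → A → ℝ} (hπ : π ∈ policySimplex S A) :
    chainMatrix G.P π ∈ rowStochastic ℝ S :=
  chainMatrix_mem_rowStochastic G.P_nonneg G.P_sum hπ

/-- The normalized discounted state visitation distribution. -/
def visit (G : GAILProblem S A q) (π : S → A → ℝ) (s : S) : ℝ :=
  (1 - G.γ) * ∑ s₀, G.ζ s₀ * discResolvent G.γ (chainMatrix G.P π) s₀ s

/-- The state value function. -/
def valueFn (G : GAILProblem S A q) (π rew : S → A → ℝ) (s : S) : ℝ :=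
  (discResolvent G.γ (chainMatrix G.P π) *ᵥ fun s => ∑ a, π s a * rew s a) s

/-- The state-action value function. -/
def qFn (G : GAILProblem S A q) (π rew : S → A → ℝ) (s : S) (a : A) : ℝ :=
  rew s a + G.γ * ∑ s', G.P s a s' * G.valueFn π rew s'

lemma V_eq_sum_valueFn (G : GAILProblem S A q) {π : S → A → ℝ} (hπ : π ∈ policySimplex S A)
    (rew : S → A → ℝ) : G.V π rew = ∑ s, G.ζ s * G.valueFn π rew s := by
  have h : HasSum (fun t : ℕ => ∑ s, G.ζ s * (G.γ ^ t * ((chainMatrix G.P π) ^ t *ᵥ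
      fun s => ∑ a, π s a * rew s a) s)) (∑ s, G.ζ s * G.valueFn π rew s) :=
    hasSum_sum fun s _ => (hasSum_discResolvent_mulVec G.γ_pos.le G.γ_lt_one
      (G.chain_mem hπ) _ s).mul_left (G.ζ s)
  rw [← h.tsum_eq, V]
  refine tsum_congr fun t => ?_
  simp only [mulVec, dotProduct, sum_mul]
  simp only [mul_sum]
  rw [sum_comm]
  refine sum_congr rfl fun s _ => sum_congr rfl fun s' _ => sum_congr rfl fun a _ => ?_
  ring

lemma V_eq_visit (G : GAILProblem S A q) {π : S → A → ℝ} (hπ : π ∈ policySimplex S A)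
    (rew : S → A → ℝ) :
    G.V π rew = 1 / (1 - G.γ) * ∑ s, G.visit π s * ∑ a, π s a * rew s a := by
  have h : (1 - G.γ) ≠ 0 := by linarith [G.γ_lt_one]
  rw [V_eq_sum_valueFn G hπ]
  simp only [valueFn, visit, mulVec, dotProduct, mul_assoc]
  rw [← mul_sum, ← mul_assoc, one_div_mul_cancel h, one_mul]
  simp only [sum_mul]
  simp only [mul_sum]
  rw [sum_comm]
  refine sum_congr rfl fun s _ => sum_congr rfl fun s' _ => sum_congr rfl fun a _ => ?_
  ring

/-- Flow balance. The lower bound on visitation probabilities, stationarity under `P̃` and the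
performance difference identity all come from it. -/
lemma visit_eq (G : GAILProblem S A q) {π : S → A → ℝ} (hπ : π ∈ policySimplex S A) (s : S) :
    G.visit π s = (1 - G.γ) * G.ζ s + G.γ * ∑ s', G.visit π s' * chainMatrix G.P π s' s := by
  have h := discResolvent_eq_add_mul G.γ_pos.le G.γ_lt_one (G.chain_mem hπ)
  have h2 : ∀ s₀, discResolvent G.γ (chainMatrix G.P π) s₀ s =
      (1 : Matrix S S ℝ) s₀ s + G.γ * ∑ k, discResolvent G.γ (chainMatrix G.P π) s₀ k *
        chainMatrix G.P π k s := fun s₀ => by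
    conv_lhs => rw [h]
    simp [Matrix.mul_apply]
  rw [visit]
  simp only [h2, mul_add, sum_add_distrib]
  congr 1
  · simp [Matrix.one_apply]
  · simp only [visit, mul_sum, sum_mul]
    rw [sum_comm]
    refine sum_congr rfl fun s _ => sum_congr rfl fun s' _ => ?_
    ring

lemma visit_nonneg (G : GAILProblem S A q) {π : S → A → ℝ} (hπ : π ∈ policySimplex S A) (s : S) :
    0 ≤ G.visit π s :=
  mul_nonneg (by linarith [G.γ_lt_one]) (sum_nonneg fun s₀ _ => mul_nonneg (G.ζ_nonneg _)
    (discResolvent_nonneg G.γ_pos.le (G.chain_mem hπ) _ _))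

lemma visit_sum (G : GAILProblem S A q) {π : S → A → ℝ} (hπ : π ∈ policySimplex S A) :
    ∑ s, G.visit π s = 1 := by
  have h : (1 - G.γ) ≠ 0 := by linarith [G.γ_lt_one]
  simp only [visit]
  rw [← mul_sum, sum_comm]
  simp only [← mul_sum, discResolvent_sum_row G.γ_pos.le G.γ_lt_one (G.chain_mem hπ)]
  rw [← sum_mul, G.ζ_sum]
  field_simp

lemma visit_le_one (G : GAILProblem S A q) {π : S → A → ℝ} (hπ : π ∈ policySimplex S A) (s : S) :
    G.visit π s ≤ 1 := by
  rw [← G.visit_sum hπ]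
  exact single_le_sum (fun i _ => G.visit_nonneg hπ i) (mem_univ s)

lemma le_visit (G : GAILProblem S A q) {π : S → A → ℝ} (hπ : π ∈ policySimplex S A) (s : S) :
    (1 - G.γ) * G.ζ s ≤ G.visit π s := by
  rw [visit_eq G hπ]
  have := mul_nonneg G.γ_pos.le (sum_nonneg fun s' (_ : s' ∈ univ) =>
    mul_nonneg (G.visit_nonneg hπ s') (nonneg_of_mem_rowStochastic (G.chain_mem hπ) (i := s') (j := s)))
  linarith

omit [DecidableEq S] in
lemma chainTilde_apply (G : GAILProblem S A q) {π : S → A → ℝ} (hπ : π ∈ policySimplex S A)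
    (s s' : S) :
    chainMatrix G.Ptilde π s s' = G.γ * chainMatrix G.P π s s' + (1 - G.γ) * G.ζ s' := by
  simp only [chainMatrix, Ptilde, mul_add, sum_add_distrib]
  congr 1
  · rw [mul_sum]; exact sum_congr rfl fun a _ => by ring
  · rw [← sum_mul, hπ.2, one_mul]

/-- The chain of `P̃` restarts from `ζ` with probability `1 - γ` at each step, so its stationarity
equation is the flow balance. Sampling from `P̃` therefore estimates discounted visitation averages.
-/
lemma visit_stationary (G : GAILProblem S A q) {π : S → A → ℝ} (hπ : π ∈ policySimplex S A) :
    G.visit π ᵥ* chainMatrix G.Ptilde π = G.visit π := by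
  ext s
  rw [visit_eq G hπ s]
  simp only [vecMul, dotProduct, chainTilde_apply G hπ, mul_add, sum_add_distrib]
  rw [← sum_mul, visit_sum G hπ, one_mul, add_comm, mul_sum]
  congr 1
  exact sum_congr rfl fun a _ => by ring

lemma visit_stationary_pow (G : GAILProblem S A q) {π : S → A → ℝ} (hπ : π ∈ policySimplex S A)
    (t : ℕ) : G.visit π ᵥ* (chainMatrix G.Ptilde π) ^ t = G.visit π := by
  induction t with
  | zero => simp
  | succ t ih => rw [pow_succ, ← vecMul_vecMul, ih, visit_stationary G hπ]

lemma valueFn_eq (G : GAILProblem S A q) {π : S → A → ℝ} (hπ : π ∈ policySimplex S A)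
    (rew : S → A → ℝ) (s : S) :
    G.valueFn π rew s = ∑ a, π s a * G.qFn π rew s a := by
  have h := discResolvent_eq_add_mul' G.γ_pos.le G.γ_lt_one (G.chain_mem hπ)
  have h2 : G.valueFn π rew s = (∑ a, π s a * rew s a) +
      G.γ * (chainMatrix G.P π *ᵥ G.valueFn π rew) s := by
    have : G.valueFn π rew = discResolvent G.γ (chainMatrix G.P π) *ᵥ
      fun s => ∑ a, π s a * rew s a := rfl
    conv_lhs => rw [this, h]
    rw [this, add_mulVec, smul_mulVec, ← mulVec_mulVec]
    simp
  rw [h2]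
  simp only [qFn, mul_add, sum_add_distrib, mulVec, dotProduct, chainMatrix, sum_mul, mul_sum]
  congr 1
  rw [sum_comm]
  refine sum_congr rfl fun s _ => sum_congr rfl fun s' _ => ?_
  ring

/-- The performance difference identity. -/
lemma V_sub_V (G : GAILProblem S A q) {π π' : S → A → ℝ} (hπ : π ∈ policySimplex S A)
    (hπ' : π' ∈ policySimplex S A) (rew : S → A → ℝ) :
    G.V π' rew - G.V π rew =
      1 / (1 - G.γ) * ∑ s, G.visit π' s * ∑ a, (π' s a - π s a) * G.qFn π rew s a := by
  have h : (1 - G.γ) ≠ 0 := by linarith [G.γ_lt_one]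
  -- Testing the flow balance of `π'` against the value function of `π` writes `V π` as an average
  -- over the visitation distribution of `π'`, which can then be compared with `V π'` state by
  -- state.
  have hV : G.V π rew = 1 / (1 - G.γ) * ∑ s, G.visit π' s *
      (G.valueFn π rew s - G.γ * ∑ s', chainMatrix G.P π' s s' * G.valueFn π rew s') := by
    rw [V_eq_sum_valueFn G hπ]
    have h1 : ∑ s, G.visit π' s * G.valueFn π rew s = (1 - G.γ) * ∑ s, G.ζ s * G.valueFn π rew s
        + G.γ * ∑ s, G.visit π' s * ∑ s', chainMatrix G.P π' s s' * G.valueFn π rew s' := by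
      simp only [mul_sum]
      conv_lhs => enter [2, s]; rw [visit_eq G hπ' s]
      simp only [add_mul, sum_add_distrib, mul_sum, sum_mul]
      congr 1
      · exact sum_congr rfl fun a _ => by ring
      · rw [sum_comm]
        refine sum_congr rfl fun s _ => sum_congr rfl fun s' _ => ?_
        ring
    simp only [mul_sub, sum_sub_distrib]
    rw [h1]
    have h2 : ∑ s, G.visit π' s * (G.γ * ∑ s', chainMatrix G.P π' s s' * G.valueFn π rew s') =
        G.γ * ∑ s, G.visit π' s * ∑ s', chainMatrix G.P π' s s' * G.valueFn π rew s' := by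
      rw [mul_sum]; exact sum_congr rfl fun a _ => by ring
    rw [h2]
    field_simp
    ring
  rw [V_eq_visit G hπ', hV, ← mul_sub, ← sum_sub_distrib]
  congr 1
  refine sum_congr rfl fun s _ => ?_
  rw [← mul_sub]
  congr 1
  simp only [sub_mul, sum_sub_distrib]
  rw [valueFn_eq G hπ]
  have h3 : ∑ a, π' s a * G.qFn π rew s a = ∑ a, π' s a * rew s a +
      G.γ * ∑ s', chainMatrix G.P π' s s' * G.valueFn π rew s' := by
    simp only [qFn, mul_add, sum_add_distrib, chainMatrix, sum_mul, mul_sum]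
    congr 1
    rw [sum_comm]
    refine sum_congr rfl fun s _ => sum_congr rfl fun s' _ => ?_
    ring
  rw [h3]
  ring

end GAILProblem

/-! ### Mixing, and perturbation bounds in the policy. -/

namespace GAILProblem

variable {S A : Type*} [Fintype S] [Fintype A] [DecidableEq S] {q : ℕ}

/-- Rows of the discounted powers of the chain of `P` and `π` merge geometrically fast. -/
def Mixes (G : GAILProblem S A q) (CM ρ : ℝ) (π : S → A → ℝ) : Prop :=
  ∀ (t : ℕ) (s s' : S), G.γ ^ t * ∑ j, |(chainMatrix G.P π ^ t) s j - (chainMatrix G.P π ^ t) s' j|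
    ≤ 4 * CM * ρ ^ t

/-- The restart part of `P̃` has the same law from every state, so it cancels in differences of
rows. Ergodicity of either kernel thus controls the same discounted quantity. -/
lemma chainTilde_pow_sub (G : GAILProblem S A q) {π : S → A → ℝ} (hπ : π ∈ policySimplex S A)
    (t : ℕ) (s s' j : S) :
    (chainMatrix G.Ptilde π ^ t) s j - (chainMatrix G.Ptilde π ^ t) s' j =
      G.γ ^ t * ((chainMatrix G.P π ^ t) s j - (chainMatrix G.P π ^ t) s' j) := by
  induction t generalizing j with
  | zero => simp
  | succ t ih =>
    simp only [pow_succ (chainMatrix _ π), Matrix.mul_apply, ← sum_sub_distrib, ← sub_mul]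
    simp only [ih, chainTilde_apply G hπ, mul_add, sum_add_distrib]
    have h0 : ∑ k, G.γ ^ t * ((chainMatrix G.P π ^ t) s k - (chainMatrix G.P π ^ t) s' k) *
        ((1 - G.γ) * G.ζ j) = 0 := by
      rw [← sum_mul, ← mul_sum, sum_sub_distrib,
        sum_row_of_mem_rowStochastic (pow_mem (G.chain_mem hπ) t),
        sum_row_of_mem_rowStochastic (pow_mem (G.chain_mem hπ) t)]
      ring
    rw [h0, add_zero, mul_sum]
    exact sum_congr rfl fun k _ => by ring

/-- The constant `4` is a factor `2` from the half in total variation times a factor `2` from the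
triangle inequality through `χ`. -/
lemma sum_abs_sub_le_of_ergodic {kern : S → A → S → ℝ} {CM ρ : ℝ} {π : S → A → ℝ}
    (h : UniformlyErgodicAt kern CM ρ π) (t : ℕ) (s s' : S) :
    ∑ j, |(chainMatrix kern π ^ t) s j - (chainMatrix kern π ^ t) s' j| ≤ 4 * CM * ρ ^ t := by
  obtain ⟨χ, -, -, -, h⟩ := h
  have h1 := h t s
  have h2 := h t s'
  have h3 : ∑ j, |(chainMatrix kern π ^ t) s j - (chainMatrix kern π ^ t) s' j| ≤
      ∑ j, |(chainMatrix kern π ^ t) s j - χ j| + ∑ j, |(chainMatrix kern π ^ t) s' j - χ j| := by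
    rw [← sum_add_distrib]
    refine sum_le_sum fun j _ => ?_
    rw [abs_sub_comm ((chainMatrix kern π ^ t) s' j)]
    exact abs_sub_le _ _ _
  linarith

lemma Assumptions.mixes {G : GAILProblem S A q} {μ Lψ CM ρ Cr Lr Cα Rmax ζmin : ℝ}
    (hG : G.Assumptions μ Lψ CM ρ Cr Lr Cα Rmax ζmin)
    {π : S → A → ℝ} (hπ : π ∈ policySimplex S A) : G.Mixes CM ρ π := by
  intro t s s'
  rcases hG.ergodic with h | h
  · exact (mul_le_of_le_one_left (sum_nonneg fun _ _ => abs_nonneg _)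
      (pow_le_one₀ G.γ_pos.le G.γ_lt_one.le)).trans (sum_abs_sub_le_of_ergodic (h π hπ) t s s')
  · refine le_trans (le_of_eq ?_) (sum_abs_sub_le_of_ergodic (h π hπ) t s s')
    rw [mul_sum]
    refine sum_congr rfl fun j _ => ?_
    rw [chainTilde_pow_sub G hπ, abs_mul, abs_of_nonneg (pow_nonneg G.γ_pos.le t)]

variable {G : GAILProblem S A q} {CM ρ : ℝ} {π π' : S → A → ℝ}

lemma Mixes.osc_pow (h : G.Mixes CM ρ π) {f : S → ℝ} {H : ℝ} (hH : 0 ≤ H) (hf : ∀ s, |f s| ≤ H)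
    (t : ℕ) (s s' : S) :
    |G.γ ^ t * ((chainMatrix G.P π ^ t) *ᵥ f) s - G.γ ^ t * ((chainMatrix G.P π ^ t) *ᵥ f) s'|
      ≤ 4 * CM * ρ ^ t * H := by
  rw [← mul_sub, abs_mul, abs_of_nonneg (pow_nonneg G.γ_pos.le t)]
  have h1 := abs_sum_mul_le hf
    fun j => (chainMatrix G.P π ^ t) s j - (chainMatrix G.P π ^ t) s' j
  have h2 : ((chainMatrix G.P π ^ t) *ᵥ f) s - ((chainMatrix G.P π ^ t) *ᵥ f) s' =
      ∑ j, ((chainMatrix G.P π ^ t) s j - (chainMatrix G.P π ^ t) s' j) * f j := by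
    simp only [mulVec, dotProduct, sub_mul, sum_sub_distrib]
  rw [h2]
  calc _ ≤ G.γ ^ t * (_ * H) := mul_le_mul_of_nonneg_left h1 (pow_nonneg G.γ_pos.le t)
    _ = _ * H := by rw [← mul_assoc]
    _ ≤ _ := mul_le_mul_of_nonneg_right (h t s s') hH

omit [Fintype S] [DecidableEq S] in
lemma abs_policy_avg_le (hπ : π ∈ policySimplex S A) {rew : S → A → ℝ} {H : ℝ}
    (hr : ∀ s a, |rew s a| ≤ H) (s : S) : |∑ a, π s a * rew s a| ≤ H :=
  abs_avg_le (hπ.1 s) (hπ.2 s) (hr s)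

/-- The terms of the two value series differ by a geometric sequence in `ρ`, so summation costs `1 /
(1 - ρ)` instead of `1 / (1 - γ)`. -/
lemma Mixes.valueFn_osc (h : G.Mixes CM ρ π) (hπ : π ∈ policySimplex S A) (hρ₀ : 0 < ρ)
    (hρ₁ : ρ < 1) {rew : S → A → ℝ} {H : ℝ} (hH : 0 ≤ H) (hr : ∀ s a, |rew s a| ≤ H) (s s' : S) :
    |G.valueFn π rew s - G.valueFn π rew s'| ≤ 4 * CM / (1 - ρ) * H := by
  have hs := fun s => hasSum_discResolvent_mulVec G.γ_pos.le G.γ_lt_one (G.chain_mem hπ)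
    (fun s => ∑ a, π s a * rew s a) s
  have h1 := (hs s).sub (hs s')
  have h2 : HasSum (fun t : ℕ => 4 * CM * ρ ^ t * H) (4 * CM / (1 - ρ) * H) := by
    have := ((hasSum_geometric_of_lt_one hρ₀.le hρ₁).mul_left (4 * CM)).mul_right H
    simpa [div_eq_mul_inv] using this
  have h3 := fun t => h.osc_pow hH (abs_policy_avg_le hπ hr) t s s'
  exact tsum_of_norm_bounded h2 h3 |>.trans' (by rw [h1.tsum_eq]; exact le_rfl)

/-- The bound on the oscillation of state-action values relative to the size of the reward. -/
def _root_.mixConst (CM ρ : ℝ) : ℝ := 1 + 4 * CM / (1 - ρ)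

lemma _root_.one_le_mixConst (hCM : 0 < CM) (hρ₁ : ρ < 1) : 1 ≤ mixConst CM ρ := by
  have : 0 < 4 * CM / (1 - ρ) := div_pos (by linarith) (by linarith)
  unfold mixConst; linarith

lemma Mixes.qFn_osc [Nonempty S] (h : G.Mixes CM ρ π) (hπ : π ∈ policySimplex S A) (hρ₀ : 0 < ρ)
    (hρ₁ : ρ < 1) {rew : S → A → ℝ} {H : ℝ} (hH : 0 ≤ H) (hr : ∀ s a, |rew s a| ≤ H) :
    ∃ c, ∀ s a, |G.qFn π rew s a - c| ≤ mixConst CM ρ * H := by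
  obtain ⟨s₀⟩ := ‹Nonempty S›
  refine ⟨G.γ * G.valueFn π rew s₀, fun s a => ?_⟩
  have h1 : G.qFn π rew s a - G.γ * G.valueFn π rew s₀ = rew s a +
      G.γ * ∑ s', G.P s a s' * (G.valueFn π rew s' - G.valueFn π rew s₀) := by
    simp only [mul_sub, sum_sub_distrib, ← sum_mul, G.P_sum, qFn]
    ring
  have h2 := abs_avg_le (G.P_nonneg s a) (G.P_sum s a) fun s' => h.valueFn_osc hπ hρ₀ hρ₁ hH hr s' s₀
  rw [h1, mixConst, add_mul, one_mul]
  refine (abs_add_le _ _).trans (add_le_add (hr s a) ?_)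
  rw [abs_mul, abs_of_pos G.γ_pos]
  exact (mul_le_of_le_one_left (abs_nonneg _) G.γ_lt_one.le).trans h2

/-- The `ℓ¹` distance of two policies. -/
def _root_.policyDist {S A : Type*} [Fintype S] [Fintype A] (π π' : S → A → ℝ) : ℝ :=
  ∑ s, ∑ a, |π' s a - π s a|

lemma _root_.policyDist_nonneg {S A : Type*} [Fintype S] [Fintype A] (π π' : S → A → ℝ) :
    0 ≤ policyDist π π' := sum_nonneg fun _ _ => sum_nonneg fun _ _ => abs_nonneg _

-- Both policies have row sums one, so a constant may be subtracted from `Q`; only the oscillation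
-- of `Q` will matter.
omit [Fintype S] [DecidableEq S] in
lemma sum_sub_mul_eq (hπ : π ∈ policySimplex S A) (hπ' : π' ∈ policySimplex S A) (Q : S → A → ℝ)
    (c : ℝ) (s : S) :
    ∑ a, (π' s a - π s a) * Q s a = ∑ a, (π' s a - π s a) * (Q s a - c) := by
  simp only [mul_sub, sum_sub_distrib, ← sum_mul, hπ.2, hπ'.2]
  ring

lemma abs_sum_weighted_le (hπ : π ∈ policySimplex S A) (hπ' : π' ∈ policySimplex S A)
    {Q : S → A → ℝ} {c K : ℝ} (hQ : ∀ s a, |Q s a - c| ≤ K) {w : S → ℝ}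
    (hw : ∀ s, |w s| ≤ 1) :
    |∑ s, w s * ∑ a, (π' s a - π s a) * Q s a| ≤ policyDist π π' * K := by
  rw [policyDist, sum_mul]
  refine (abs_sum_le_sum_abs _ _).trans (sum_le_sum fun s _ => ?_)
  rw [abs_mul, sum_sub_mul_eq hπ hπ' Q c]
  exact (mul_le_of_le_one_left (abs_nonneg _) (hw s)).trans (abs_sum_mul_le (hQ s) _)

lemma abs_sum_policy_sub_le (hπ : π ∈ policySimplex S A) (hπ' : π' ∈ policySimplex S A)
    {Q : S → A → ℝ} {c K : ℝ} (hQ : ∀ s a, |Q s a - c| ≤ K) (s : S) :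
    |∑ a, (π' s a - π s a) * Q s a| ≤ 2 * K := by
  rw [sum_sub_mul_eq hπ hπ' Q c]
  simp only [sub_mul, sum_sub_distrib]
  have h1 := abs_avg_le (hπ.1 s) (hπ.2 s) (hQ s)
  have h2 := abs_avg_le (hπ'.1 s) (hπ'.2 s) (hQ s)
  have := abs_sub (∑ a, π' s a * (Q s a - c)) (∑ a, π s a * (Q s a - c))
  linarith

omit [DecidableEq S] in
lemma nonempty_state (G : GAILProblem S A q) : Nonempty S := by
  by_contra h
  rw [not_nonempty_iff] at h
  simpa using G.ζ_sum

lemma abs_visit_le_one (hπ : π ∈ policySimplex S A) (s : S) : |G.visit π s| ≤ 1 := by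
  rw [abs_of_nonneg (G.visit_nonneg hπ s)]; exact G.visit_le_one hπ s

/-- In the performance difference identity the values may be recentred as in `qFn_osc`. Bounding
them by their supremum would cost a second factor `1 / (1 - γ)`. -/
lemma abs_V_sub_V_le (h : G.Mixes CM ρ π) (hπ : π ∈ policySimplex S A)
    (hπ' : π' ∈ policySimplex S A) (hρ₀ : 0 < ρ) (hρ₁ : ρ < 1) {rew : S → A → ℝ} {H : ℝ}
    (hH : 0 ≤ H) (hr : ∀ s a, |rew s a| ≤ H) :
    |G.V π' rew - G.V π rew| ≤ 1 / (1 - G.γ) * (policyDist π π' * (mixConst CM ρ * H)) := by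
  have := G.nonempty_state
  obtain ⟨c, hc⟩ := h.qFn_osc hπ hρ₀ hρ₁ hH hr
  have hγ : 0 ≤ 1 / (1 - G.γ) := one_div_nonneg.2 (by linarith [G.γ_lt_one])
  rw [V_sub_V G hπ hπ', abs_mul, abs_of_nonneg hγ]
  exact mul_le_mul_of_nonneg_left (abs_sum_weighted_le hπ hπ' hc (abs_visit_le_one hπ')) hγ

/-- For a reward that depends on the state only, `(1 - γ) * V` is the visitation average, so the
bound on `V` applies and its factor `1 / (1 - γ)` cancels. -/
lemma abs_sum_visit_sub_le (h : G.Mixes CM ρ π) (hπ : π ∈ policySimplex S A)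
    (hπ' : π' ∈ policySimplex S A) (hρ₀ : 0 < ρ) (hρ₁ : ρ < 1) {f : S → ℝ} {H : ℝ}
    (hH : 0 ≤ H) (hf : ∀ s, |f s| ≤ H) :
    |∑ s, (G.visit π' s - G.visit π s) * f s| ≤ policyDist π π' * (mixConst CM ρ * H) := by
  have h1 := abs_V_sub_V_le h hπ hπ' hρ₀ hρ₁ (rew := fun s _ => f s) hH fun s _ => hf s
  have hγ : 0 < 1 / (1 - G.γ) := one_div_pos.2 (by linarith [G.γ_lt_one])
  rw [V_eq_visit G hπ, V_eq_visit G hπ', ← mul_sub, abs_mul, abs_of_pos hγ,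
    mul_le_mul_iff_right₀ hγ] at h1
  simpa only [← sum_mul, hπ.2, hπ'.2, one_mul, ← sum_sub_distrib, ← sub_mul] using h1

/-- One step of the chain of `P̃` and `π` on functions of state-action pairs. -/
def stepOp (G : GAILProblem S A q) (π : S → A → ℝ) (f : S × A → ℝ) (x : S × A) : ℝ :=
  G.stepExp π x f

/-- After one step from a pair only the new state matters, so the remaining steps are powers of the
state matrix. This is why the decay below is `ρ ^ m` after `m + 1` steps. -/
lemma stepOp_iterate (G : GAILProblem S A q) (π : S → A → ℝ) (f : S × A → ℝ) (m : ℕ) (x : S × A) :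
    (G.stepOp π)^[m + 1] f x = ∑ s', G.Ptilde x.1 x.2 s' *
      ((chainMatrix G.Ptilde π ^ m) *ᵥ fun s => ∑ a, π s a * f (s, a)) s' := by
  induction m generalizing x with
  | zero => simp [stepOp, stepExp]
  | succ m ih =>
    rw [Function.iterate_succ_apply', stepOp, stepExp]
    refine sum_congr rfl fun s' _ => ?_
    congr 1
    simp only [ih]
    rw [pow_succ', ← mulVec_mulVec]
    conv_rhs => rw [mulVec, dotProduct]
    simp only [chainMatrix, sum_mul, mul_sum]
    rw [sum_comm]
    exact sum_congr rfl fun k _ => sum_congr rfl fun k _ => by ring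

/-- Expectation of a function of a state-action pair under the visitation distribution. -/
def visitExp (G : GAILProblem S A q) (π : S → A → ℝ) (f : S × A → ℝ) : ℝ :=
  ∑ s, G.visit π s * ∑ a, π s a * f (s, a)

/-- A function centered under the visitation distribution stays centered along the chain by
stationarity. Its value at a state is then an average of differences between states, and these are
small by mixing. -/
lemma abs_stepOp_iterate_le (h : G.Mixes CM ρ π) (hπ : π ∈ policySimplex S A) {f : S × A → ℝ}
    {H : ℝ} (hH : 0 ≤ H) (hf : ∀ x, |f x| ≤ H) (hc : G.visitExp π f = 0) (m : ℕ) (x : S × A) :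
    |(G.stepOp π)^[m + 1] f x| ≤ 4 * CM * ρ ^ m * H := by
  rw [stepOp_iterate]
  refine abs_avg_le (G.Ptilde_nonneg _ _) (G.sum_Ptilde _ _) fun s' => ?_
  set φ : S → ℝ := fun s => ∑ a, π s a * f (s, a) with hφ
  have hφH : ∀ s, |φ s| ≤ H := abs_policy_avg_le hπ fun s a => hf (s, a)
  have h0 : ∑ s, G.visit π s * ((chainMatrix G.Ptilde π ^ m) *ᵥ φ) s = 0 := by
    have : G.visit π ⬝ᵥ ((chainMatrix G.Ptilde π ^ m) *ᵥ φ) = G.visit π ⬝ᵥ φ := by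
      rw [dotProduct_mulVec, visit_stationary_pow G hπ]
    exact this.trans hc
  have h1 : ((chainMatrix G.Ptilde π ^ m) *ᵥ φ) s' = ∑ s, G.visit π s *
      (((chainMatrix G.Ptilde π ^ m) *ᵥ φ) s' - ((chainMatrix G.Ptilde π ^ m) *ᵥ φ) s) := by
    simp only [mul_sub, sum_sub_distrib, h0, ← sum_mul, G.visit_sum hπ]
    ring
  rw [h1]
  refine abs_avg_le (G.visit_nonneg hπ) (G.visit_sum hπ) fun s => ?_
  have h2 := h.osc_pow hH hφH m s' s
  refine le_trans (le_of_eq ?_) h2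
  congr 1
  simp only [mulVec, dotProduct, mul_sum, ← sum_sub_distrib, ← sub_mul, ← mul_assoc, ← mul_sub]
  exact sum_congr rfl fun j _ => by rw [chainTilde_pow_sub G hπ]

lemma abs_visitExp_le (hπ : π ∈ policySimplex S A) {f : S × A → ℝ} {H : ℝ}
    (hf : ∀ x, |f x| ≤ H) : |G.visitExp π f| ≤ H :=
  abs_avg_le (G.visit_nonneg hπ) (G.visit_sum hπ) (abs_policy_avg_le hπ fun s a => hf (s, a))

lemma visitExp_sub_const (hπ : π ∈ policySimplex S A) (f : S × A → ℝ) (c : ℝ) :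
    G.visitExp π (fun x => f x - c) = G.visitExp π f - c := by
  simp only [visitExp, mul_sub, sum_sub_distrib, ← sum_mul, hπ.2, one_mul, G.visit_sum hπ]

lemma V_eq_visitExp (hπ : π ∈ policySimplex S A) (rew : S → A → ℝ) :
    G.V π rew = 1 / (1 - G.γ) * G.visitExp π fun x => rew x.1 x.2 :=
  V_eq_visit G hπ rew

lemma valueFn_sub (rew rew' : S → A → ℝ) (s : S) :
    G.valueFn π (fun s a => rew s a - rew' s a) s = G.valueFn π rew s - G.valueFn π rew' s := by
  simp only [valueFn, mulVec, dotProduct, mul_sub, sum_sub_distrib]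

lemma qFn_sub (rew rew' : S → A → ℝ) (s : S) (a : A) :
    G.qFn π (fun s a => rew s a - rew' s a) s a = G.qFn π rew s a - G.qFn π rew' s a := by
  simp only [qFn, valueFn_sub, mul_sub, sum_sub_distrib]
  ring

lemma V_sub (hπ : π ∈ policySimplex S A) (rew rew' : S → A → ℝ) :
    G.V π (fun s a => rew s a - rew' s a) = G.V π rew - G.V π rew' := by
  simp only [V_eq_visit G hπ, mul_sub, sum_sub_distrib]

lemma abs_V_le (hπ : π ∈ policySimplex S A) {rew : S → A → ℝ} {H : ℝ}
    (hr : ∀ s a, |rew s a| ≤ H) : |G.V π rew| ≤ 1 / (1 - G.γ) * H := by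
  have hγ : 0 ≤ 1 / (1 - G.γ) := one_div_nonneg.2 (by linarith [G.γ_lt_one])
  rw [V_eq_visitExp hπ, abs_mul, abs_of_nonneg hγ]
  exact mul_le_mul_of_nonneg_left (abs_visitExp_le hπ fun x => hr x.1 x.2) hγ

lemma abs_valueFn_le (hπ : π ∈ policySimplex S A) {rew : S → A → ℝ} {H : ℝ}
    (hr : ∀ s a, |rew s a| ≤ H) (s : S) : |G.valueFn π rew s| ≤ 1 / (1 - G.γ) * H := by
  rw [valueFn, mulVec, dotProduct]
  refine (abs_sum_mul_le (abs_policy_avg_le hπ hr) _).trans (le_of_eq ?_)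
  simp only [abs_of_nonneg (discResolvent_nonneg G.γ_pos.le (G.chain_mem hπ) _ _),
    discResolvent_sum_row G.γ_pos.le G.γ_lt_one (G.chain_mem hπ)]

lemma abs_qFn_le (hπ : π ∈ policySimplex S A) {rew : S → A → ℝ} {H : ℝ}
    (hr : ∀ s a, |rew s a| ≤ H) (s : S) (a : A) : |G.qFn π rew s a| ≤ 1 / (1 - G.γ) * H := by
  have h1 := abs_avg_le (G.P_nonneg s a) (G.P_sum s a) (abs_valueFn_le (G := G) hπ hr)
  rw [qFn]
  refine (abs_add_le _ _).trans ?_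
  rw [abs_mul, abs_of_pos G.γ_pos]
  have h2 := mul_le_mul_of_nonneg_left h1 G.γ_pos.le
  have h3 : (1 - G.γ) ≠ 0 := by linarith [G.γ_lt_one]
  have h4 : H + G.γ * (1 / (1 - G.γ) * H) = 1 / (1 - G.γ) * H := by field_simp; ring
  linarith [hr s a]

end GAILProblem

/-! ### Contraction of a projected gradient step. -/

section Hilbert

open scoped RealInnerProductSpace

variable {E : Type*} [NormedAddCommGroup E] [InnerProductSpace ℝ E]

/-- With `x = μ² / L²` and step `μ / (4 L²)`, expanding the square gives the factor `1 - x/2 + x/16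
= 1 - 7x/16`, which is at most `(1 - 7x/32)²`. The inequality `μ ≤ L` follows from Cauchy–Schwarz
when `Δ ≠ 0`. -/
lemma norm_add_smul_le_of_inner_le {Δ d : E} {μ L : ℝ} (hμ : 0 < μ)
    (h1 : ⟪d, Δ⟫ ≤ -μ * ‖Δ‖ ^ 2) (h2 : ‖d‖ ≤ L * ‖Δ‖) :
    ‖Δ + (μ / (4 * L ^ 2)) • d‖ ≤ (1 - 7 / 32 * (μ ^ 2 / L ^ 2)) * ‖Δ‖ := by
  rcases eq_or_ne Δ 0 with rfl | hΔ
  · have : d = 0 := by simpa using h2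
    simp [this]
  have hn : 0 < ‖Δ‖ := norm_pos_iff.2 hΔ
  have hμL : μ ≤ L := by
    have h3 := abs_real_inner_le_norm d Δ
    have h4 := neg_abs_le ⟪d, Δ⟫
    have h5 : μ * ‖Δ‖ ^ 2 ≤ L * ‖Δ‖ ^ 2 := by nlinarith
    exact le_of_mul_le_mul_right h5 (by positivity)
  have hL0 : 0 < L := hμ.trans_le hμL
  have hx : μ ^ 2 / L ^ 2 ≤ 1 := (div_le_one (by positivity)).2 (by gcongr)
  refine abs_le_of_sq_le_sq' ?_ (mul_nonneg (by linarith) hn.le) |>.2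
  rw [← real_inner_self_eq_norm_sq, inner_add_left, inner_add_right, inner_add_right,
    real_inner_smul_left, real_inner_smul_right, real_inner_smul_left, real_inner_smul_right,
    real_inner_comm d Δ, real_inner_self_eq_norm_sq, real_inner_self_eq_norm_sq]
  have h3 : ‖d‖ ^ 2 ≤ L ^ 2 * ‖Δ‖ ^ 2 := by rw [← mul_pow]; gcongr
  set β := μ / (4 * L ^ 2) with hβ
  have hβ0 : 0 ≤ β := by positivity
  have hβμ : β * μ = μ ^ 2 / L ^ 2 / 4 := by rw [hβ]; field_simp
  have hβL : β * β * L ^ 2 = μ ^ 2 / L ^ 2 / 16 := by rw [hβ]; field_simp; norm_num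
  set x := μ ^ 2 / L ^ 2
  have h4 : β * β * ‖d‖ ^ 2 ≤ x / 16 * ‖Δ‖ ^ 2 := by
    rw [← hβL, mul_assoc (β * β)]
    exact mul_le_mul_of_nonneg_left h3 (by positivity)
  have h5 : β * ⟪d, Δ⟫ ≤ -(x / 4) * ‖Δ‖ ^ 2 := by
    rw [← hβμ]
    have := mul_le_mul_of_nonneg_left h1 hβ0
    linarith
  have h6 : 0 ≤ x ^ 2 * ‖Δ‖ ^ 2 := by positivity
  nlinarith

end Hilbert

section Projection

open scoped RealInnerProductSpace

variable {q : ℕ} {Λ : Set (EuclideanSpace ℝ (Fin q))} {y p a w : EuclideanSpace ℝ (Fin q)}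

lemma IsProjOn.inner_le_zero (hΛ : Convex ℝ Λ) (h : IsProjOn Λ y p) {z : EuclideanSpace ℝ (Fin q)}
    (hz : z ∈ Λ) : ⟪y - p, z - p⟫ ≤ 0 := by
  refine (norm_eq_iInf_iff_real_inner_le_zero hΛ h.1).1 ?_ z hz
  have : Nonempty Λ := ⟨⟨p, h.1⟩⟩
  exact le_antisymm (le_ciInf fun z => h.2 z z.2)
    (ciInf_le ⟨0, Set.forall_mem_range.2 fun _ => norm_nonneg _⟩ (⟨p, h.1⟩ : Λ))

/-- The condition on `w` says that it is normal to `Λ` at `a`, so `a` is the projection of `a + w`;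
the claim is nonexpansiveness of the projection. It will be used with `w` a multiple of the gradient
at a constrained maximizer, which need not vanish. -/
lemma IsProjOn.norm_sub_le (hΛ : Convex ℝ Λ) (h : IsProjOn Λ y p) (ha : a ∈ Λ)
    (hw : ∀ z ∈ Λ, ⟪w, z - a⟫ ≤ 0) : ‖p - a‖ ≤ ‖y - a - w‖ := by
  rcases eq_or_ne (p - a) 0 with h0 | h0
  · rw [h0, norm_zero]; exact norm_nonneg _
  have h1 := h.inner_le_zero hΛ ha
  have h2 := hw p h.1
  have h3 : ‖p - a‖ * ‖p - a‖ ≤ ‖y - a - w‖ * ‖p - a‖ := by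
    refine le_trans ?_ (real_inner_le_norm (y - a - w) (p - a))
    rw [← real_inner_self_eq_norm_mul_norm]
    have e1 : y - p = (y - a) - (p - a) := by abel
    have e2 : a - p = -(p - a) := by abel
    rw [e1, e2, inner_neg_right, inner_sub_left] at h1
    rw [inner_sub_left (y - a)]
    linarith
  exact le_of_mul_le_mul_right h3 (norm_pos_iff.2 h0)

end Projection

/-! ### The inner maximization: gradient in the reward parameter, best reward, regularity of `g`. -/

namespace GAILProblem

open scoped RealInnerProductSpace

variable {S A : Type*} [Fintype S] [Fintype A] [DecidableEq S] {q : ℕ} {G : GAILProblem S A q}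
  {μ Lψ CM ρ Cr Lr Cα Rmax ζmin : ℝ}

/-- The gradient in `α` of the expected reward under the visitation distribution. -/
def visitGrad (G : GAILProblem S A q) (π : S → A → ℝ) (α : EuclideanSpace ℝ (Fin q)) :
    EuclideanSpace ℝ (Fin q) :=
  ∑ s, G.visit π s • ∑ a, π s a • G.gradReward α s a

/-- The gradient in `α` of the objective `F θ`. -/
def gradF (G : GAILProblem S A q) (θ : S → A → ℝ) (α : EuclideanSpace ℝ (Fin q)) :
    EuclideanSpace ℝ (Fin q) :=
  (1 / (1 - G.γ)) • (G.visitGrad G.πE α - G.visitGrad θ α) - gradient G.ψ α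

lemma visitGrad_apply (π : S → A → ℝ) (α : EuclideanSpace ℝ (Fin q)) (i : Fin q) :
    G.visitGrad π α i = G.visitExp π fun x => G.gradReward α x.1 x.2 i := by
  simp [visitGrad, visitExp]

lemma nonempty_action (G : GAILProblem S A q) : Nonempty A := by
  by_contra h
  rw [not_nonempty_iff] at h
  obtain ⟨s⟩ := G.nonempty_state
  simpa using G.πE_mem.2 s

namespace Assumptions

variable (hG : G.Assumptions μ Lψ CM ρ Cr Lr Cα Rmax ζmin)
include hG

lemma convex : Convex ℝ G.Λ := (hG.F_strongConcave G.πE G.πE_mem).1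

lemma Rmax_nonneg : 0 ≤ Rmax := by
  obtain ⟨α, hα⟩ := G.Λ_nonempty
  obtain ⟨s⟩ := G.nonempty_state
  obtain ⟨a⟩ := G.nonempty_action
  exact (abs_nonneg _).trans (hG.r_bounded α hα s a)

lemma Cr_nonneg : 0 ≤ Cr := by
  obtain ⟨α, hα⟩ := G.Λ_nonempty
  exact (Real.sqrt_nonneg _).trans (hG.r_grad_bounded α hα)

lemma Cα_nonneg : 0 ≤ Cα := by
  obtain ⟨α, hα⟩ := G.Λ_nonempty
  exact (norm_nonneg _).trans (hG.Λ_bounded α hα α hα)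

lemma norm_gradReward_le {α : EuclideanSpace ℝ (Fin q)} (hα : α ∈ G.Λ) (s : S) (a : A) :
    ‖G.gradReward α s a‖ ≤ Cr := by
  refine le_trans ?_ (hG.r_grad_bounded α hα)
  rw [EuclideanSpace.norm_eq]
  refine Real.sqrt_le_sqrt (sum_le_sum fun i _ => ?_)
  rw [Real.norm_eq_abs]
  exact pow_le_pow_left₀ (abs_nonneg _)
    (le_ciSup (f := fun p : S × A => |G.gradReward α p.1 p.2 i|) (Set.finite_range _).bddAbove (s, a)) 2

lemma abs_gradReward_apply_le {α : EuclideanSpace ℝ (Fin q)} (hα : α ∈ G.Λ) (s : S) (a : A)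
    (i : Fin q) : |G.gradReward α s a i| ≤ Cr :=
  (PiLp.norm_apply_le (G.gradReward α s a) i).trans (hG.norm_gradReward_le hα s a)

lemma hasGradientAt_reward {α : EuclideanSpace ℝ (Fin q)} (hα : α ∈ G.Λ) (s : S) (a : A) :
    HasGradientAt (fun α' => G.r α' s a) (G.gradReward α s a) α :=
  (hG.r_diff α hα s a).hasGradientAt

lemma abs_reward_sub_le {α α' : EuclideanSpace ℝ (Fin q)} (hα : α ∈ G.Λ) (hα' : α' ∈ G.Λ)
    (s : S) (a : A) : |G.r α' s a - G.r α s a| ≤ Cr * ‖α' - α‖ := by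
  refine Convex.norm_image_sub_le_of_norm_hasFDerivWithin_le (𝕜 := ℝ) (f := fun α => G.r α s a)
    (f' := fun α => InnerProductSpace.toDual ℝ _ (G.gradReward α s a))
    (fun x hx => (hG.hasGradientAt_reward hx s a).hasFDerivAt.hasFDerivWithinAt) (fun x hx => ?_)
    hG.convex hα hα'
  rw [LinearIsometryEquiv.norm_map]
  exact hG.norm_gradReward_le hx s a

/-- By `V_eq_visit`, `V` is a finite combination of rewards with weights independent of `α`, so no
series has to be differentiated. -/
lemma hasGradientAt_F {θ : S → A → ℝ} (hθ : θ ∈ policySimplex S A)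
    {α : EuclideanSpace ℝ (Fin q)} (hα : α ∈ G.Λ) :
    HasGradientAt (G.F θ) (G.gradF θ α) α := by
  have hV : ∀ π ∈ policySimplex S A, HasFDerivAt (fun α => G.V π (G.r α))
      (InnerProductSpace.toDual ℝ _ ((1 / (1 - G.γ)) • G.visitGrad π α)) α := fun π hπ => by
    have h1 : (fun α => G.V π (G.r α)) = fun α => (1 / (1 - G.γ)) * ∑ s, G.visit π s *
        ∑ a, π s a * G.r α s a := funext fun α => V_eq_visit G hπ _
    rw [h1]
    have h2 : HasFDerivAt (fun α => ∑ s, G.visit π s * ∑ a, π s a * G.r α s a)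
        (∑ s, G.visit π s • ∑ a, π s a • InnerProductSpace.toDual ℝ _ (G.gradReward α s a)) α :=
      HasFDerivAt.fun_sum fun s _ => (HasFDerivAt.fun_sum fun a _ =>
        ((hG.hasGradientAt_reward hα s a).hasFDerivAt.const_mul (π s a))).const_mul (G.visit π s)
    refine (h2.const_mul (1 / (1 - G.γ))).congr_fderiv ?_
    ext z
    simp [visitGrad, mul_sum]
  have h := ((hV _ G.πE_mem).sub (hV θ hθ)).sub (hG.ψ_diff α hα).hasGradientAt.hasFDerivAt
  rw [hasGradientAt_iff_hasFDerivAt]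
  refine h.congr_fderiv ?_
  ext z
  simp [gradF, smul_sub]

/-- Slopes from the right suffice: `x + t (y - x)` with `x, y ∈ Λ` is only known to stay in `Λ` for
`0 ≤ t ≤ 1`. -/
lemma tendsto_slope_F {θ : S → A → ℝ} (hθ : θ ∈ policySimplex S A)
    {x : EuclideanSpace ℝ (Fin q)} (hx : x ∈ G.Λ) (y : EuclideanSpace ℝ (Fin q)) :
    Filter.Tendsto (fun t : ℝ => (G.F θ (x + t • (y - x)) - G.F θ x) / t) (nhdsWithin 0 (Set.Ioi 0))
      (nhds ⟪G.gradF θ x, y - x⟫) := by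
  have h1 : HasDerivAt (fun t : ℝ => x + t • (y - x)) (y - x) 0 := by
    simpa using ((hasDerivAt_id (0 : ℝ)).smul_const (y - x)).const_add x
  have h2 : HasFDerivAt (G.F θ) (InnerProductSpace.toDual ℝ _ (G.gradF θ x))
      (x + (0 : ℝ) • (y - x)) := by
    rw [zero_smul, add_zero]
    exact (hG.hasGradientAt_F hθ hx).hasFDerivAt
  have h0 : HasDerivAt (fun t : ℝ => G.F θ (x + t • (y - x))) ⟪G.gradF θ x, y - x⟫ 0 := by
    have h4 := HasFDerivAt.comp_hasDerivAt (0 : ℝ) h2 h1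
    exact h4
  have h3 := (hasDerivWithinAt_iff_tendsto_slope' (s := Set.Ioi 0) (by simp)).1 h0.hasDerivWithinAt
  refine h3.congr fun t => ?_
  rw [slope_def_field, zero_smul, add_zero, sub_zero]

/-- First-order form of strong concavity: divide the defining inequality on the segment by `t` and
let `t` tend to `0`. -/
lemma F_sub_add_le_inner {θ : S → A → ℝ} (hθ : θ ∈ policySimplex S A)
    {x y : EuclideanSpace ℝ (Fin q)} (hx : x ∈ G.Λ) (hy : y ∈ G.Λ) :
    G.F θ y - G.F θ x + μ / 2 * ‖y - x‖ ^ 2 ≤ ⟪G.gradF θ x, y - x⟫ := by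
  have h1 := hG.tendsto_slope_F hθ hx y
  have h2 : Filter.Tendsto (fun t : ℝ => G.F θ y - G.F θ x + (1 - t) * (μ / 2 * ‖y - x‖ ^ 2))
      (nhdsWithin 0 (Set.Ioi 0))
      (nhds (G.F θ y - G.F θ x + (1 - 0) * (μ / 2 * ‖y - x‖ ^ 2))) := by
    refine Filter.Tendsto.mono_left (Continuous.tendsto ?_ 0) nhdsWithin_le_nhds
    fun_prop
  rw [sub_zero, one_mul] at h2
  refine le_of_tendsto_of_tendsto h2 h1 ?_
  filter_upwards [Ioo_mem_nhdsGT (zero_lt_one' ℝ)] with t ht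
  have h0 := (hG.F_strongConcave θ hθ).2
  have h3 := h0 hx hy (a := 1 - t) (b := t) (by linarith [ht.2]) ht.1.le (by ring)
  have h4 : (1 - t) • x + t • y = x + t • (y - x) := by
    rw [sub_smul, one_smul, smul_sub]; abel
  rw [h4, norm_sub_rev x y] at h3
  simp only [smul_eq_mul] at h3
  rw [le_div_iff₀ ht.1]
  nlinarith

lemma inner_gradF_sub_le {θ : S → A → ℝ} (hθ : θ ∈ policySimplex S A)
    {x y : EuclideanSpace ℝ (Fin q)} (hx : x ∈ G.Λ) (hy : y ∈ G.Λ) :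
    ⟪G.gradF θ x - G.gradF θ y, x - y⟫ ≤ -μ * ‖x - y‖ ^ 2 := by
  have h1 := hG.F_sub_add_le_inner hθ hx hy
  have h2 := hG.F_sub_add_le_inner hθ hy hx
  rw [norm_sub_rev y x, ← neg_sub x y, inner_neg_right] at h1
  rw [inner_sub_left]
  linarith

lemma norm_visitGrad_sub_le {π : S → A → ℝ} (hπ : π ∈ policySimplex S A)
    {x y : EuclideanSpace ℝ (Fin q)} (hx : x ∈ G.Λ) (hy : y ∈ G.Λ) :
    ‖G.visitGrad π x - G.visitGrad π y‖ ≤ Lr * ‖x - y‖ := by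
  have h1 : G.visitGrad π x - G.visitGrad π y =
      ∑ s, G.visit π s • ∑ a, π s a • (G.gradReward x s a - G.gradReward y s a) := by
    simp [visitGrad, smul_sub, sum_sub_distrib]
  rw [h1]
  calc _ ≤ ∑ s, G.visit π s * ∑ a, π s a * (Lr * ‖x - y‖) := by
        refine norm_sum_le_of_le _ fun s _ => ?_
        rw [norm_smul, Real.norm_of_nonneg (G.visit_nonneg hπ s)]
        refine mul_le_mul_of_nonneg_left (norm_sum_le_of_le _ fun a _ => ?_) (G.visit_nonneg hπ s)
        rw [norm_smul, Real.norm_of_nonneg (hπ.1 s a)]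
        exact mul_le_mul_of_nonneg_left (hG.r_grad_lip s a x hx y hy) (hπ.1 s a)
    _ = Lr * ‖x - y‖ := by simp only [← sum_mul, hπ.2, one_mul, G.visit_sum hπ]

lemma norm_gradF_sub_le {θ : S → A → ℝ} (hθ : θ ∈ policySimplex S A)
    {x y : EuclideanSpace ℝ (Fin q)} (hx : x ∈ G.Λ) (hy : y ∈ G.Λ) :
    ‖G.gradF θ x - G.gradF θ y‖ ≤ (2 * Lr / (1 - G.γ) + Lψ) * ‖x - y‖ := by
  have hγ : 0 ≤ 1 / (1 - G.γ) := one_div_nonneg.2 (by linarith [G.γ_lt_one])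
  have h1 : G.gradF θ x - G.gradF θ y = (1 / (1 - G.γ)) •
      ((G.visitGrad G.πE x - G.visitGrad G.πE y) - (G.visitGrad θ x - G.visitGrad θ y)) -
      (gradient G.ψ x - gradient G.ψ y) := by
    simp only [gradF, smul_sub]; abel
  rw [h1]
  refine (norm_sub_le _ _).trans ?_
  rw [norm_smul, Real.norm_of_nonneg hγ, add_mul]
  refine add_le_add ?_ (hG.ψ_grad_lip x hx y hy)
  calc _ ≤ 1 / (1 - G.γ) * (Lr * ‖x - y‖ + Lr * ‖x - y‖) :=
        mul_le_mul_of_nonneg_left ((norm_sub_le _ _).trans (add_le_add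
          (hG.norm_visitGrad_sub_le G.πE_mem hx hy) (hG.norm_visitGrad_sub_le hθ hx hy))) hγ
    _ = _ := by ring

lemma Lr_nonneg_of_ne {x y : EuclideanSpace ℝ (Fin q)} (hx : x ∈ G.Λ) (hy : y ∈ G.Λ)
    (hxy : x ≠ y) : 0 ≤ Lr := by
  obtain ⟨s⟩ := G.nonempty_state
  obtain ⟨a⟩ := G.nonempty_action
  have h := (norm_nonneg _).trans (hG.r_grad_lip s a x hx y hy)
  exact nonneg_of_mul_nonneg_left h (norm_pos_iff.2 (sub_ne_zero.2 hxy))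

/-- Two distinct points force `1 ≤ √q` and `0 ≤ Lr`. When `Λ` is a single point neither needs to
hold, and that case is treated apart. -/
lemma le_L22_of_ne {x y : EuclideanSpace ℝ (Fin q)} (hx : x ∈ G.Λ) (hy : y ∈ G.Λ)
    (hxy : x ≠ y) : 2 * Lr / (1 - G.γ) + Lψ ≤ L22 q G.γ Lr Lψ := by
  have hq : 1 ≤ Real.sqrt q := by
    rw [Real.one_le_sqrt, Nat.one_le_cast, Nat.one_le_iff_ne_zero]
    rintro rfl
    exact hxy (Subsingleton.elim x y)
  have hLr := hG.Lr_nonneg_of_ne hx hy hxy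
  have hγ : 0 < 1 - G.γ := by linarith [G.γ_lt_one]
  unfold L22
  gcongr
  linarith

lemma continuousOn_F {θ : S → A → ℝ} (hθ : θ ∈ policySimplex S A) : ContinuousOn (G.F θ) G.Λ :=
  fun _ hα => (hG.hasGradientAt_F hθ hα).continuousAt.continuousWithinAt

lemma isCompact : IsCompact G.Λ :=
  Metric.isCompact_of_isClosed_isBounded G.Λ_closed
    (Metric.isBounded_iff.2 ⟨Cα, fun x hx y hy => by rw [dist_eq_norm]; exact hG.Λ_bounded x hx y hy⟩)

end Assumptions

/-- A maximizer of `F θ` over `Λ`. -/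
def bestReward (G : GAILProblem S A q) (θ : S → A → ℝ) : EuclideanSpace ℝ (Fin q) :=
  Classical.epsilon fun α => α ∈ G.Λ ∧ IsMaxOn (G.F θ) G.Λ α

namespace Assumptions

variable (hG : G.Assumptions μ Lψ CM ρ Cr Lr Cα Rmax ζmin) {θ θ' : S → A → ℝ}
include hG

lemma bestReward_spec (hθ : θ ∈ policySimplex S A) :
    G.bestReward θ ∈ G.Λ ∧ IsMaxOn (G.F θ) G.Λ (G.bestReward θ) := by
  obtain ⟨x, hx⟩ := hG.isCompact.exists_isMaxOn G.Λ_nonempty (hG.continuousOn_F hθ)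
  exact Classical.epsilon_spec (p := fun α => α ∈ G.Λ ∧ IsMaxOn (G.F θ) G.Λ α) ⟨x, hx⟩

lemma g_eq (hθ : θ ∈ policySimplex S A) : G.g θ = G.F θ (G.bestReward θ) := by
  obtain ⟨h1, h2⟩ := hG.bestReward_spec hθ
  exact IsGreatest.csSup_eq ⟨⟨_, h1, rfl⟩, by rintro _ ⟨α, hα, rfl⟩; exact h2 hα⟩

lemma F_le_g (hθ : θ ∈ policySimplex S A) {α : EuclideanSpace ℝ (Fin q)} (hα : α ∈ G.Λ) :
    G.F θ α ≤ G.g θ := by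
  rw [hG.g_eq hθ]; exact (hG.bestReward_spec hθ).2 hα

lemma inner_gradF_bestReward_le (hθ : θ ∈ policySimplex S A) {α : EuclideanSpace ℝ (Fin q)}
    (hα : α ∈ G.Λ) : ⟪G.gradF θ (G.bestReward θ), α - G.bestReward θ⟫ ≤ 0 := by
  obtain ⟨h1, h2⟩ := hG.bestReward_spec hθ
  refine le_of_tendsto (hG.tendsto_slope_F hθ h1 α) ?_
  filter_upwards [Ioo_mem_nhdsGT (zero_lt_one' ℝ)] with t ht
  refine div_nonpos_of_nonpos_of_nonneg (sub_nonpos.2 (h2 ?_)) ht.1.le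
  exact hG.convex.add_smul_sub_mem h1 hα ⟨ht.1.le, ht.2.le⟩

/-- Quadratic growth at the maximizer. It makes the maximizer unique and stable under changes of the
policy. -/
lemma F_add_le_g (hθ : θ ∈ policySimplex S A) {α : EuclideanSpace ℝ (Fin q)} (hα : α ∈ G.Λ) :
    G.F θ α + μ / 2 * ‖α - G.bestReward θ‖ ^ 2 ≤ G.g θ := by
  have h1 := hG.F_sub_add_le_inner hθ (hG.bestReward_spec hθ).1 hα
  have h2 := hG.inner_gradF_bestReward_le hθ hα
  rw [hG.g_eq hθ]
  linarith

/-- Adding quadratic growth for both policies, each tested at the maximizer of the other, cancels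
the expert and `ψ` terms. What remains is a difference of values for the reward `r α' - r α`, of
size `Cr * ‖α' - α‖`; one factor `‖α' - α‖` is then divided out. -/
lemma norm_bestReward_sub_le (hμ : 0 < μ) (hCM : 0 < CM) (hρ₀ : 0 < ρ) (hρ₁ : ρ < 1)
    (hθ : θ ∈ policySimplex S A) (hθ' : θ' ∈ policySimplex S A) :
    ‖G.bestReward θ' - G.bestReward θ‖ ≤
      mixConst CM ρ * Cr / μ * (1 / (1 - G.γ)) * policyDist θ θ' := by
  set α := G.bestReward θ with hα
  set α' := G.bestReward θ' with hα'
  have hαm := (hG.bestReward_spec hθ).1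
  have hαm' := (hG.bestReward_spec hθ').1
  have h1 := hG.F_add_le_g hθ hαm'
  have h2 := hG.F_add_le_g hθ' hαm
  rw [hG.g_eq hθ, ← hα, ← hα'] at h1
  rw [hG.g_eq hθ', ← hα', ← hα, norm_sub_rev] at h2
  have h3 := abs_V_sub_V_le (hG.mixes hθ) hθ hθ' hρ₀ hρ₁
    (mul_nonneg hG.Cr_nonneg (norm_nonneg (α' - α))) (hG.abs_reward_sub_le hαm hαm')
  rw [V_sub hθ, V_sub hθ'] at h3
  have h4 := (abs_le.1 h3).1
  simp only [F] at h1 h2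
  rcases eq_or_ne (α' - α) 0 with h0 | h0
  · rw [h0, norm_zero]
    have := one_le_mixConst hCM hρ₁
    have h5 := hG.Cr_nonneg
    have h6 := policyDist_nonneg θ θ'
    have h7 : 0 < 1 - G.γ := by linarith [G.γ_lt_one]
    positivity
  · have hn : 0 < ‖α' - α‖ := norm_pos_iff.2 h0
    have h5 : μ * ‖α' - α‖ * ‖α' - α‖ ≤
        (1 / (1 - G.γ) * (policyDist θ θ' * (mixConst CM ρ * Cr))) * ‖α' - α‖ := by nlinarith
    have h6 := le_of_mul_le_mul_right h5 hn
    rw [← le_div_iff₀' hμ] at h6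
    refine h6.trans (le_of_eq (by ring))

/-- The maximizer for `θ` is an admissible competitor in `g θ'`. -/
lemma g_sub_g_le (hθ : θ ∈ policySimplex S A) (hθ' : θ' ∈ policySimplex S A) :
    G.g θ - G.g θ' ≤ G.V θ' (G.r (G.bestReward θ)) - G.V θ (G.r (G.bestReward θ)) := by
  have h1 := hG.F_le_g hθ' (hG.bestReward_spec hθ).1
  rw [hG.g_eq hθ]
  simp only [F] at h1 ⊢
  linarith

lemma g_sub_g_le_const (hθ : θ ∈ policySimplex S A) (hθ' : θ' ∈ policySimplex S A) :
    G.g θ - G.g θ' ≤ 2 * Rmax / (1 - G.γ) := by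
  have h0 := hG.r_bounded _ (hG.bestReward_spec hθ).1
  have h1 := abs_le.1 (abs_V_le (G := G) hθ h0)
  have h2 := abs_le.1 (abs_V_le (G := G) hθ' h0)
  refine (hG.g_sub_g_le hθ hθ').trans ?_
  rw [show 2 * Rmax / (1 - G.γ) = 1 / (1 - G.γ) * Rmax + 1 / (1 - G.γ) * Rmax by ring]
  linarith [h1.1, h2.2]

lemma abs_g_sub_g_le (hρ₀ : 0 < ρ) (hρ₁ : ρ < 1)
    (hθ : θ ∈ policySimplex S A) (hθ' : θ' ∈ policySimplex S A) :
    |G.g θ' - G.g θ| ≤ 1 / (1 - G.γ) * (policyDist θ θ' * (mixConst CM ρ * Rmax)) := by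
  have h1 := abs_le.1 (abs_V_sub_V_le (hG.mixes hθ) hθ hθ' hρ₀ hρ₁ hG.Rmax_nonneg
    (hG.r_bounded _ (hG.bestReward_spec hθ).1))
  have h2 := abs_le.1 (abs_V_sub_V_le (hG.mixes hθ) hθ hθ' hρ₀ hρ₁ hG.Rmax_nonneg
    (hG.r_bounded _ (hG.bestReward_spec hθ').1))
  rw [abs_le]
  constructor
  · linarith [hG.g_sub_g_le hθ hθ', h1.2]
  · linarith [hG.g_sub_g_le hθ' hθ, h2.1]

end Assumptions

end GAILProblem

/-! ### Measurability of functions of random policies and rewards. -/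

section Measurability

variable {Ω : Type*} {m : MeasurableSpace Ω}

/-- Value functions, gradients and maximizers are only known to be continuous on the simplex or on
`Λ`. The iterates never leave these sets, so one composes through the subtype. -/
lemma StronglyMeasurable.comp_continuousOn {E : Type*} [TopologicalSpace E]
    [TopologicalSpace.PseudoMetrizableSpace E] [MeasurableSpace E] [BorelSpace E]
    {F : Type*} [TopologicalSpace F] [TopologicalSpace.PseudoMetrizableSpace F]
    [SecondCountableTopology F] [MeasurableSpace F] [BorelSpace F]
    {K : Set E} {Y : Ω → E} (hY : StronglyMeasurable[m] Y) (hK : ∀ ω, Y ω ∈ K) {f : E → F}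
    (hf : ContinuousOn f K) : StronglyMeasurable[m] fun ω => f (Y ω) := by
  have h1 : Measurable fun ω => (⟨Y ω, hK ω⟩ : K) := hY.measurable.subtype_mk
  exact ((continuousOn_iff_continuous_domRestrict.1 hf).measurable.comp h1).stronglyMeasurable

lemma stronglyMeasurable_eval {X : Type*} [Fintype X] {x : Ω → X}
    (hx : ∀ p, MeasurableSet[m] (x ⁻¹' {p})) {h : Ω → X → ℝ}
    (hh : ∀ p, StronglyMeasurable[m] fun ω => h ω p) :
    StronglyMeasurable[m] fun ω => h ω (x ω) := by
  classical
  have : (fun ω => h ω (x ω)) = fun ω => ∑ p, (x ⁻¹' {p}).indicator (fun ω => h ω p) ω := by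
    ext ω
    simp [Set.indicator_apply]
  rw [this]
  exact Finset.stronglyMeasurable_fun_sum _ fun p _ => (hh p).indicator (hx p)

variable {S A : Type*} [Fintype S] [Fintype A] {π : Ω → S → A → ℝ}

omit [Fintype S] [Fintype A] in
lemma stronglyMeasurable_policy_apply (hπ : StronglyMeasurable[m] π) (s : S) (a : A) :
    StronglyMeasurable[m] fun ω => π ω s a :=
  (continuous_apply_apply s a).comp_stronglyMeasurable hπ

variable [DecidableEq S] {q : ℕ} (G : GAILProblem S A q)

lemma continuousOn_discResolvent (i j : S) :
    ContinuousOn (fun π : S → A → ℝ => discResolvent G.γ (chainMatrix G.P π) i j)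
      (policySimplex S A) := by
  refine continuousOn_tsum (u := fun t => G.γ ^ t) (fun t => Continuous.continuousOn ?_)
    (summable_geometric_of_lt_one G.γ_pos.le G.γ_lt_one) fun t π hπ => ?_
  · have h1 : Continuous fun π : S → A → ℝ => chainMatrix G.P π := by
      refine continuous_pi fun s => continuous_pi fun s' => ?_
      unfold chainMatrix
      fun_prop
    exact ((h1.pow t).matrix_elem i j).const_mul _
  · rw [Real.norm_of_nonneg (mul_nonneg (pow_nonneg G.γ_pos.le t)
      (pow_apply_nonneg (G.chain_mem hπ) t i j))]
    exact mul_le_of_le_one_right (pow_nonneg G.γ_pos.le t) (pow_apply_le_one (G.chain_mem hπ) t i j)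

lemma stronglyMeasurable_discResolvent (hπ : StronglyMeasurable[m] π)
    (hπm : ∀ ω, π ω ∈ policySimplex S A) (i j : S) :
    StronglyMeasurable[m] fun ω => discResolvent G.γ (chainMatrix G.P (π ω)) i j :=
  StronglyMeasurable.comp_continuousOn hπ hπm (continuousOn_discResolvent G i j)

lemma stronglyMeasurable_visit (hπ : StronglyMeasurable[m] π)
    (hπm : ∀ ω, π ω ∈ policySimplex S A) (s : S) :
    StronglyMeasurable[m] fun ω => G.visit (π ω) s :=
  (Finset.stronglyMeasurable_fun_sum _ fun s₀ _ =>
    (stronglyMeasurable_discResolvent G hπ hπm s₀ s).const_mul _).const_mul _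

omit [DecidableEq S] in
lemma stronglyMeasurable_policy_avg (hπ : StronglyMeasurable[m] π) {f : Ω → S → A → ℝ}
    (hf : ∀ s a, StronglyMeasurable[m] fun ω => f ω s a) (s : S) :
    StronglyMeasurable[m] fun ω => ∑ a, π ω s a * f ω s a :=
  Finset.stronglyMeasurable_fun_sum _ fun a _ =>
    (stronglyMeasurable_policy_apply hπ s a).mul (hf s a)

lemma stronglyMeasurable_visitExp (hπ : StronglyMeasurable[m] π)
    (hπm : ∀ ω, π ω ∈ policySimplex S A) {f : Ω → S × A → ℝ}
    (hf : ∀ x, StronglyMeasurable[m] fun ω => f ω x) :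
    StronglyMeasurable[m] fun ω => G.visitExp (π ω) (f ω) :=
  Finset.stronglyMeasurable_fun_sum _ fun s _ => (stronglyMeasurable_visit G hπ hπm s).mul
    (stronglyMeasurable_policy_avg hπ (f := fun ω s a => f ω (s, a)) (fun s a => hf (s, a)) s)

lemma stronglyMeasurable_stepExp (hπ : StronglyMeasurable[m] π) {f : Ω → S × A → ℝ}
    (hf : ∀ x, StronglyMeasurable[m] fun ω => f ω x) (x : S × A) :
    StronglyMeasurable[m] fun ω => G.stepExp (π ω) x (f ω) :=
  Finset.stronglyMeasurable_fun_sum _ fun s _ =>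
    (stronglyMeasurable_policy_avg hπ (f := fun ω s a => f ω (s, a)) (fun s a => hf (s, a)) s).const_mul _

lemma stronglyMeasurable_valueFn (hπ : StronglyMeasurable[m] π)
    (hπm : ∀ ω, π ω ∈ policySimplex S A) {r : Ω → S → A → ℝ}
    (hr : ∀ s a, StronglyMeasurable[m] fun ω => r ω s a) (s : S) :
    StronglyMeasurable[m] fun ω => G.valueFn (π ω) (r ω) s :=
  Finset.stronglyMeasurable_fun_sum _ fun j _ => (stronglyMeasurable_discResolvent G hπ hπm s j).mul
    (stronglyMeasurable_policy_avg hπ hr j)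

lemma stronglyMeasurable_qFn (hπ : StronglyMeasurable[m] π)
    (hπm : ∀ ω, π ω ∈ policySimplex S A) {r : Ω → S → A → ℝ}
    (hr : ∀ s a, StronglyMeasurable[m] fun ω => r ω s a) (s : S) (a : A) :
    StronglyMeasurable[m] fun ω => G.qFn (π ω) (r ω) s a :=
  (hr s a).add ((Finset.stronglyMeasurable_fun_sum _ fun s' _ =>
    (stronglyMeasurable_valueFn G hπ hπm hr s').const_mul _).const_mul _)

end Measurability

/-! ### Second moments of weakly correlated sums. -/

section Moments

variable {Ω : Type*} {mΩ : MeasurableSpace Ω} {Pr : Measure Ω} [IsProbabilityMeasure Pr]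

/-- By `|Y| ≤ Y² / (2d) + d / 2` for every `d > c`; the passage to `d > c` covers `c = 0`. -/
lemma integral_abs_le_of_integral_sq_le {Y : Ω → ℝ} (hY : Integrable Y Pr)
    (hY2 : Integrable (fun ω => Y ω ^ 2) Pr) {c : ℝ} (hc : 0 ≤ c) (h : ∫ ω, Y ω ^ 2 ∂Pr ≤ c ^ 2) :
    ∫ ω, |Y ω| ∂Pr ≤ c := by
  refine le_of_forall_gt_imp_ge_of_dense fun d hd => ?_
  have hd0 : 0 < d := hc.trans_lt hd
  have h1 : ∀ ω, |Y ω| ≤ 1 / (2 * d) * Y ω ^ 2 + d / 2 := fun ω => by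
    have := sq_nonneg (|Y ω| - d)
    rw [sub_sq, sq_abs] at this
    rw [← sub_nonneg]
    have e : 1 / (2 * d) * Y ω ^ 2 + d / 2 - |Y ω| = (Y ω ^ 2 - 2 * |Y ω| * d + d ^ 2) / (2 * d) := by
      field_simp; ring
    rw [e]; positivity
  calc ∫ ω, |Y ω| ∂Pr ≤ ∫ ω, (1 / (2 * d) * Y ω ^ 2 + d / 2) ∂Pr :=
        integral_mono hY.abs ((hY2.const_mul _).add (integrable_const _)) h1
    _ = 1 / (2 * d) * ∫ ω, Y ω ^ 2 ∂Pr + d / 2 := by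
        rw [integral_add (hY2.const_mul _) (integrable_const _), integral_const_mul]
        simp
    _ ≤ 1 / (2 * d) * d ^ 2 + d / 2 := by
        have : ∫ ω, Y ω ^ 2 ∂Pr ≤ d ^ 2 := h.trans (by gcongr)
        gcongr
    _ = d := by field_simp; ring

lemma integrable_of_abs_le {Y : Ω → ℝ} (hY : StronglyMeasurable Y) {H : ℝ} (hH : ∀ ω, |Y ω| ≤ H) :
    Integrable Y Pr :=
  Integrable.of_bound hY.aestronglyMeasurable H (Filter.Eventually.of_forall hH)

-- Adding the last term contributes its own square and twice its correlations with the earlier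
-- terms, and these sum to at most `c / (1 - ρ)`.
omit [IsProbabilityMeasure Pr] in
lemma integral_sq_sum_le {f : ℕ → Ω → ℝ} {B : ℕ} {c H ρ : ℝ} (hc : 0 ≤ c) (hρ₀ : 0 ≤ ρ)
    (hρ₁ : ρ < 1) (hi : ∀ i < B, ∀ j < B, Integrable (fun ω => f i ω * f j ω) Pr)
    (hd : ∀ i < B, ∫ ω, f i ω * f i ω ∂Pr ≤ H)
    (ho : ∀ j < B, ∀ i < j, ∫ ω, f i ω * f j ω ∂Pr ≤ c * ρ ^ (j - 1 - i)) :
    ∀ n ≤ B, ∫ ω, (∑ i ∈ range n, f i ω) ^ 2 ∂Pr ≤ n * (H + 2 * c / (1 - ρ)) := by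
  intro n hn
  induction n with
  | zero => simp
  | succ n ih =>
    have hn' : n < B := hn
    have hsq : Integrable (fun ω => (∑ i ∈ range n, f i ω) ^ 2) Pr := by
      simp only [sq, sum_mul_sum]
      exact integrable_finsetSum _ fun i hi' => integrable_finsetSum _ fun j hj =>
        hi i ((mem_range.1 hi').trans hn') j ((mem_range.1 hj).trans hn')
    have hcross : Integrable (fun ω => 2 * ∑ i ∈ range n, f i ω * f n ω) Pr :=
      (integrable_finsetSum _ fun i hi' => hi i ((mem_range.1 hi').trans hn') n hn').const_mul 2
    have hexp : ∀ ω, (∑ i ∈ range (n + 1), f i ω) ^ 2 = (∑ i ∈ range n, f i ω) ^ 2 +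
        2 * (∑ i ∈ range n, f i ω * f n ω) + f n ω * f n ω := fun ω => by
      rw [sum_range_succ, ← sum_mul]; ring
    have hsc : Integrable (fun ω => (∑ i ∈ range n, f i ω) ^ 2 +
        2 * ∑ i ∈ range n, f i ω * f n ω) Pr := hsq.add hcross
    simp only [hexp]
    rw [integral_add hsc (hi n hn' n hn'), integral_add hsq hcross,
      integral_const_mul, integral_finsetSum _ fun i hi' => hi i ((mem_range.1 hi').trans hn') n hn']
    have h1 : ∑ i ∈ range n, ∫ ω, f i ω * f n ω ∂Pr ≤ c / (1 - ρ) := by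
      calc _ ≤ ∑ i ∈ range n, c * ρ ^ (n - 1 - i) :=
            sum_le_sum fun i hi' => ho n hn' i (mem_range.1 hi')
        _ = c * ∑ i ∈ range n, ρ ^ i := by rw [← mul_sum, sum_range_reflect (fun i => ρ ^ i)]
        _ ≤ c * (1 - ρ)⁻¹ := by
            gcongr
            rw [← tsum_geometric_of_lt_one hρ₀ hρ₁]
            exact (summable_geometric_of_lt_one hρ₀ hρ₁).sum_le_tsum _ fun i _ => pow_nonneg hρ₀ i
        _ = c / (1 - ρ) := by rw [div_eq_mul_inv]
    have h2 := ih hn'.le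
    have h3 := hd n hn'
    have e : 2 * c / (1 - ρ) = 2 * (c / (1 - ρ)) := by ring
    push_cast
    rw [add_mul, one_mul]
    rw [e] at h2 ⊢
    linarith

end Moments

/-! ### Batches of Markovian samples. -/

section Batch

variable {S A : Type*} [Fintype S] [Fintype A] [DecidableEq S] {q : ℕ}

/-- A batch of `B` consecutive samples `x 0, …, x (B - 1)` of the chain of `P̃` and a random policy
`π` that is known before the batch is drawn. -/
structure SampleBatch (G : GAILProblem S A q) {Ω : Type*} [mΩ : MeasurableSpace Ω] (Pr : Measure Ω)
    (B : ℕ) (bef aft : ℕ → MeasurableSpace Ω) (π : Ω → S → A → ℝ) (x : ℕ → Ω → S × A) : Prop where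
  bef_le : ∀ i, bef i ≤ aft i
  aft_le : ∀ i, aft i ≤ bef (i + 1)
  le : ∀ i, aft i ≤ mΩ
  meas_π : StronglyMeasurable[bef 0] π
  π_mem : ∀ ω, π ω ∈ policySimplex S A
  meas_x : ∀ i < B, ∀ p, MeasurableSet[aft i] (x i ⁻¹' {p})
  law : ∀ i, i + 1 < B → ∀ f : S × A → ℝ,
    condExp (bef (i + 1)) Pr (fun ω => f (x (i + 1) ω)) =ᵐ[Pr]
      fun ω => G.stepExp (π ω) (x i ω) f

namespace SampleBatch

variable {G : GAILProblem S A q} {Ω : Type*} [mΩ : MeasurableSpace Ω] {Pr : Measure Ω}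
  [IsProbabilityMeasure Pr] {B : ℕ} {bef aft : ℕ → MeasurableSpace Ω} {π : Ω → S → A → ℝ}
  {x : ℕ → Ω → S × A} (h : SampleBatch G Pr B bef aft π x)

include h

omit [DecidableEq S] [IsProbabilityMeasure Pr] in
lemma bef_mono {i j : ℕ} (hij : i ≤ j) : bef i ≤ bef j :=
  monotone_nat_of_le_succ (fun i => (h.bef_le i).trans (h.aft_le i)) hij

lemma aft_le_bef {i j : ℕ} (hij : i < j) : aft i ≤ bef j :=
  (h.aft_le i).trans (h.bef_mono hij)

omit [IsProbabilityMeasure Pr] in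
lemma abs_stepExp_le (ω : Ω) {f : S × A → ℝ} {H : ℝ} (hf : ∀ p, |f p| ≤ H) (p : S × A) :
    |G.stepExp (π ω) p f| ≤ H :=
  abs_avg_le (G.Ptilde_nonneg _ _) (G.sum_Ptilde _ _)
    (GAILProblem.abs_policy_avg_le (h.π_mem ω) fun s a => hf (s, a))

/-- The sampling law concerns a fixed function, whereas `W` depends on the past. There are finitely
many pairs, so `W` is a combination of indicators of pairs with coefficients known before the draw,
and these can be pulled out of the conditional expectation. -/
lemma integral_step {i : ℕ} (hi : i + 1 < B) {W : Ω → S × A → ℝ} {H : ℝ}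
    (hW : ∀ p, StronglyMeasurable[bef (i + 1)] fun ω => W ω p) (hH : ∀ ω p, |W ω p| ≤ H) :
    ∫ ω, W ω (x (i + 1) ω) ∂Pr = ∫ ω, G.stepExp (π ω) (x i ω) (W ω) ∂Pr := by
  classical
  obtain ⟨e, he⟩ : ∃ e : S × A → S × A → ℝ, ∀ p y, e p y = if y = p then 1 else 0 :=
    ⟨_, fun _ _ => rfl⟩
  have hle : bef (i + 1) ≤ mΩ := (h.bef_le _).trans (h.le _)
  have hind : ∀ p, StronglyMeasurable[mΩ] fun ω => e p (x (i + 1) ω) :=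
    fun p => stronglyMeasurable_eval (h := fun _ y => e p y)
      (fun y => h.le _ _ (h.meas_x _ hi y)) fun y => stronglyMeasurable_const
  have habs : ∀ p y : S × A, |e p y| ≤ 1 := fun p y => by
    rw [he]; split_ifs <;> simp
  have hint : ∀ p, Integrable (fun ω => W ω p * e p (x (i + 1) ω)) Pr :=
    fun p => integrable_of_abs_le (((hW p).mono hle).mul (hind p)) (H := H) fun ω => by
      rw [abs_mul]
      exact (mul_le_of_le_one_right (abs_nonneg _) (habs p _)).trans (hH ω p)
  have hstep : ∀ p, StronglyMeasurable[mΩ] fun ω =>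
      G.stepExp (π ω) (x i ω) (e p) := fun p =>
    stronglyMeasurable_eval (h := fun ω y => G.stepExp (π ω) y (e p))
      (fun y => h.le _ _ (h.meas_x i (Nat.lt_of_succ_lt hi) y)) fun y =>
      stronglyMeasurable_stepExp G (f := fun _ => e p) (h.meas_π.mono ((h.bef_le 0).trans (h.le 0)))
        (fun _ => stronglyMeasurable_const) y
  have hint' : ∀ p, Integrable (fun ω => W ω p *
      G.stepExp (π ω) (x i ω) (e p)) Pr :=
    fun p => integrable_of_abs_le (((hW p).mono hle).mul (hstep p)) (H := H) fun ω => by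
      rw [abs_mul]
      exact (mul_le_of_le_one_right (abs_nonneg _) (h.abs_stepExp_le ω (habs p) _)).trans (hH ω p)
  have h1 : ∀ ω, W ω (x (i + 1) ω) =
      ∑ p, W ω p * e p (x (i + 1) ω) := fun ω => by
    simp [he]
  have h2 : ∀ ω, G.stepExp (π ω) (x i ω) (W ω) = ∑ p, W ω p *
      G.stepExp (π ω) (x i ω) (e p) := fun ω => by
    simp only [GAILProblem.stepExp, mul_sum]
    conv_rhs => rw [sum_comm]
    refine sum_congr rfl fun s _ => ?_
    conv_rhs => rw [sum_comm]
    refine sum_congr rfl fun a _ => ?_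
    rw [sum_eq_single (s, a)]
    · rw [he, if_pos rfl]; ring
    · intro p _ hp; rw [he, if_neg (Ne.symm hp)]; ring
    · simp
  simp only [h1, h2]
  rw [integral_finsetSum _ fun p _ => hint p, integral_finsetSum _ fun p _ => hint' p]
  refine sum_congr rfl fun p _ => ?_
  rw [← integral_condExp hle]
  refine integral_congr_ae ?_
  have h3 := condExp_mul_of_stronglyMeasurable_left (μ := Pr) (hW p) (hint p)
    (integrable_of_abs_le (hind p) fun ω => habs p _)
  refine h3.trans ?_
  filter_upwards [h.law i hi (e p)] with ω hω
  rw [Pi.mul_apply, hω]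

/-- The last draw is integrated out, which replaces `f` by its image under `stepOp`. This image is
again known before the batch, so the induction runs over all such `f`. -/
lemma integral_mul_iterate {i k : ℕ} (hik : i + k < B) {f : Ω → S × A → ℝ} {H : ℝ}
    (hf : ∀ p, StronglyMeasurable[bef 0] fun ω => f ω p) (hH : ∀ ω p, |f ω p| ≤ H)
    {Z : Ω → ℝ} {H' : ℝ} (hZ : StronglyMeasurable[aft i] Z) (hZ' : ∀ ω, |Z ω| ≤ H') :
    ∫ ω, Z ω * f ω (x (i + k) ω) ∂Pr = ∫ ω, Z ω * (G.stepOp (π ω))^[k] (f ω) (x i ω) ∂Pr := by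
  induction k generalizing f with
  | zero => simp
  | succ k ih =>
    have h1 : ∫ ω, Z ω * f ω (x (i + (k + 1)) ω) ∂Pr =
        ∫ ω, G.stepExp (π ω) (x (i + k) ω) (fun p => Z ω * f ω p) ∂Pr :=
      h.integral_step (i := i + k) hik (W := fun ω p => Z ω * f ω p) (H := H' * H)
        (fun p => (hZ.mono (h.aft_le_bef (by omega))).mul ((hf p).mono (h.bef_mono (Nat.zero_le _))))
        fun ω p => by
          rw [abs_mul]
          exact mul_le_mul (hZ' ω) (hH ω p) (abs_nonneg _) ((abs_nonneg _).trans (hZ' ω))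
    have h2 : ∀ ω, G.stepExp (π ω) (x (i + k) ω) (fun p => Z ω * f ω p) =
        Z ω * G.stepOp (π ω) (f ω) (x (i + k) ω) := fun ω => by
      simp only [GAILProblem.stepExp, GAILProblem.stepOp, mul_sum]
      exact sum_congr rfl fun s _ => sum_congr rfl fun a _ => by ring
    rw [h1]
    simp only [h2, Function.iterate_succ_apply]
    exact ih (by omega) (stronglyMeasurable_stepExp G h.meas_π hf)
      fun ω p => h.abs_stepExp_le ω (hH ω) p

/-- A correlation at lag `k + 1` becomes the integral of `f` times the `(k + 1)`-th iterate of
`stepOp`, which decays like `ρ ^ k` from every pair. Neither a stationary start nor a burn-in is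
needed. -/
lemma integral_sq_sum_le {CM ρ : ℝ} (hCM : 0 < CM) (hρ₀ : 0 < ρ) (hρ₁ : ρ < 1)
    (hmix : ∀ ω, G.Mixes CM ρ (π ω)) {f : Ω → S × A → ℝ} {H : ℝ}
    (hf : ∀ p, StronglyMeasurable[bef 0] fun ω => f ω p) (hH0 : 0 ≤ H) (hH : ∀ ω p, |f ω p| ≤ H)
    (hc : ∀ ω, G.visitExp (π ω) (f ω) = 0) :
    ∫ ω, (∑ i ∈ range B, f ω (x i ω)) ^ 2 ∂Pr ≤ B * (2 * mixConst CM ρ * H ^ 2) := by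
  have hle : bef 0 ≤ mΩ := (h.bef_le _).trans (h.le _)
  have hsm : ∀ i < B, StronglyMeasurable[aft i] fun ω => f ω (x i ω) := fun i hi =>
    stronglyMeasurable_eval (h.meas_x i hi) fun p => (hf p).mono
      ((h.bef_mono (Nat.zero_le i)).trans (h.bef_le i))
  have hprod : ∀ ω p p', |f ω p * f ω p'| ≤ H * H := fun ω p p' => by
    rw [abs_mul]; exact mul_le_mul (hH ω p) (hH ω p') (abs_nonneg _) hH0
  have hint : ∀ i < B, ∀ j < B, Integrable (fun ω => f ω (x i ω) * f ω (x j ω)) Pr :=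
    fun i hi j hj => integrable_of_abs_le (((hsm i hi).mono (h.le i)).mul ((hsm j hj).mono (h.le j)))
      fun ω => hprod ω _ _
  have hle' : ∀ (Y : Ω → ℝ) (K : ℝ), (∀ ω, |Y ω| ≤ K) → ∫ ω, Y ω ∂Pr ≤ K := fun Y K hK => by
    have := norm_integral_le_of_norm_le_const (μ := Pr) (f := Y) (C := K)
      (Filter.Eventually.of_forall hK)
    rw [probReal_univ, mul_one] at this
    exact (le_abs_self _).trans this
  refine (_root_.integral_sq_sum_le (f := fun i ω => f ω (x i ω)) (c := 4 * CM * H * H)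
    (H := H * H) (by positivity) hρ₀.le hρ₁ hint (fun i hi => hle' _ _ fun ω => hprod ω _ _)
    (fun j hj i hij => ?_) B le_rfl).trans ?_
  · obtain ⟨k, rfl⟩ : ∃ k, j = i + (k + 1) := ⟨j - i - 1, by omega⟩
    rw [h.integral_mul_iterate hj hf hH (hsm i (by omega)) fun ω => hH ω _]
    refine hle' _ _ fun ω => ?_
    rw [abs_mul, show i + (k + 1) - 1 - i = k by omega]
    calc _ ≤ H * (4 * CM * ρ ^ k * H) := mul_le_mul (hH ω _)
          (GAILProblem.abs_stepOp_iterate_le (hmix ω) (h.π_mem ω) hH0 (hH ω) (hc ω) k _)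
          (abs_nonneg _) hH0
      _ = _ := by ring
  · refine mul_le_mul_of_nonneg_left (le_of_sub_nonneg ?_) (Nat.cast_nonneg _)
    rw [mixConst]
    have : 2 * (1 + 4 * CM / (1 - ρ)) * H ^ 2 - (H * H + 2 * (4 * CM * H * H) / (1 - ρ)) = H ^ 2 := by
      ring
    rw [this]; positivity

/-- The average of a function of the samples is `O(B ^ (-1/2))` close in mean to the expectation
under the visitation distribution. -/
lemma integral_abs_avg_sub_le {CM ρ : ℝ} (hCM : 0 < CM) (hρ₀ : 0 < ρ) (hρ₁ : ρ < 1)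
    (hB : 1 ≤ B) (hmix : ∀ ω, G.Mixes CM ρ (π ω)) {f : Ω → S × A → ℝ} {H : ℝ}
    (hf : ∀ p, StronglyMeasurable[bef 0] fun ω => f ω p) (hH0 : 0 ≤ H) (hH : ∀ ω p, |f ω p| ≤ H) :
    Integrable (fun ω => 1 / (B : ℝ) * ∑ i ∈ range B, f ω (x i ω) - G.visitExp (π ω) (f ω)) Pr ∧
    ∫ ω, |1 / (B : ℝ) * ∑ i ∈ range B, f ω (x i ω) - G.visitExp (π ω) (f ω)| ∂Pr ≤
      4 * mixConst CM ρ * H / Real.sqrt B := by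
  have hle : bef 0 ≤ mΩ := (h.bef_le _).trans (h.le _)
  have hB0 : (0 : ℝ) < B := by exact_mod_cast hB
  have hvm := stronglyMeasurable_visitExp G h.meas_π h.π_mem hf
  have hvb : ∀ ω, |G.visitExp (π ω) (f ω)| ≤ H := fun ω =>
    GAILProblem.abs_visitExp_le (h.π_mem ω) (hH ω)
  set f' : Ω → S × A → ℝ := fun ω p => f ω p - G.visitExp (π ω) (f ω) with hf'
  have hm' : ∀ p, StronglyMeasurable[bef 0] fun ω => f' ω p := fun p => (hf p).sub hvm
  have hb' : ∀ ω p, |f' ω p| ≤ 2 * H := fun ω p => by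
    have := abs_sub (f ω p) (G.visitExp (π ω) (f ω))
    linarith [hH ω p, hvb ω]
  have heq : ∀ ω, 1 / (B : ℝ) * ∑ i ∈ range B, f ω (x i ω) - G.visitExp (π ω) (f ω) =
      1 / (B : ℝ) * ∑ i ∈ range B, f' ω (x i ω) := fun ω => by
    simp only [hf', sum_sub_distrib, sum_const, card_range, nsmul_eq_mul]
    field_simp
  simp only [heq]
  have hmS : StronglyMeasurable[mΩ] fun ω => 1 / (B : ℝ) * ∑ i ∈ range B, f' ω (x i ω) := by
    refine (Finset.stronglyMeasurable_fun_sum _ fun i hi => ?_).const_mul _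
    exact stronglyMeasurable_eval (fun p => h.le i _ (h.meas_x i (mem_range.1 hi) p))
      fun p => (hm' p).mono hle
  have hbS : ∀ ω, |1 / (B : ℝ) * ∑ i ∈ range B, f' ω (x i ω)| ≤ 2 * H := fun ω => by
    rw [abs_mul, abs_of_pos (one_div_pos.2 hB0)]
    calc _ ≤ 1 / (B : ℝ) * ∑ i ∈ range B, (2 * H) :=
          mul_le_mul_of_nonneg_left ((abs_sum_le_sum_abs _ _).trans (sum_le_sum fun i _ => hb' ω _))
            (one_div_pos.2 hB0).le
      _ = 2 * H := by rw [sum_const, card_range, nsmul_eq_mul]; field_simp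
  have hI := integrable_of_abs_le (Pr := Pr) hmS hbS
  refine ⟨hI, ?_⟩
  have hI2 : Integrable (fun ω => (1 / (B : ℝ) * ∑ i ∈ range B, f' ω (x i ω)) ^ 2) Pr :=
    integrable_of_abs_le (hmS.pow 2) (H := (2 * H) ^ 2) fun ω => by
      rw [abs_pow]; exact pow_le_pow_left₀ (abs_nonneg _) (hbS ω) 2
  have hK := one_le_mixConst hCM hρ₁
  refine integral_abs_le_of_integral_sq_le hI hI2 (by positivity) ?_
  simp only [mul_pow]
  rw [integral_const_mul]
  have h5 := h.integral_sq_sum_le hCM hρ₀ hρ₁ hmix hm' (by positivity) hb' fun ω => by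
    rw [hf', GAILProblem.visitExp_sub_const (h.π_mem ω), sub_self]
  calc _ ≤ (1 / (B : ℝ)) ^ 2 * (B * (2 * mixConst CM ρ * (2 * H) ^ 2)) :=
        mul_le_mul_of_nonneg_left h5 (by positivity)
    _ = mixConst CM ρ * (8 * H ^ 2) / B := by field_simp; ring
    -- Rounding up to a perfect square, whose root is the claimed constant.
    _ ≤ mixConst CM ρ * mixConst CM ρ * (16 * H ^ 2) / B := by
        gcongr
        · exact le_mul_of_one_le_left (by linarith) hK
        · norm_num
    _ = _ := by rw [div_pow, Real.sq_sqrt hB0.le]; ring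

end SampleBatch

end Batch

/-! ### The estimator EstQ: boundedness and unbiasedness. -/

namespace GAILProblem

variable {S A : Type*} [Fintype S] [Fintype A] {q : ℕ} (G : GAILProblem S A q)

/-- One step of the chain of `P` and `π` on functions of state-action pairs. -/
def transOp (π : S → A → ℝ) (f : S → A → ℝ) (s : S) (a : A) : ℝ :=
  ∑ s', G.P s a s' * ∑ a', π s' a' * f s' a'

variable {G} {π : S → A → ℝ} {rew : S → A → ℝ}

lemma abs_transOp_iterate_le (hπ : π ∈ policySimplex S A) {R : ℝ} (hr : ∀ s a, |rew s a| ≤ R)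
    (n : ℕ) (s : S) (a : A) : |(G.transOp π)^[n] rew s a| ≤ R := by
  induction n generalizing s a with
  | zero => exact hr s a
  | succ n ih =>
    rw [Function.iterate_succ_apply']
    exact abs_avg_le (G.P_nonneg s a) (G.P_sum s a) fun s' => abs_avg_le (hπ.1 s') (hπ.2 s') (ih s')

lemma rolloutExp_id (hπ : π ∈ policySimplex S A) (n j : ℕ) (acc : ℝ) (s : S) (a : A) :
    G.rolloutExp rew π id n j acc s a =
      acc + Real.sqrt G.γ ^ j *
        ∑ i ∈ range (n + 1), Real.sqrt G.γ ^ i * (G.transOp π)^[i] rew s a := by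
  induction n generalizing j acc s a with
  | zero => simp [rolloutExp]
  | succ n ih =>
    rw [rolloutExp, sum_range_succ']
    simp only [ih, mul_add, sum_add_distrib, ← sum_mul, hπ.2, G.P_sum, one_mul, pow_zero,
      Function.iterate_zero, id_eq, Function.iterate_succ_apply']
    have h : ∑ s', G.P s a s' * ∑ a', π s' a' * (Real.sqrt G.γ ^ (j + 1) *
        ∑ i ∈ range (n + 1), Real.sqrt G.γ ^ i * (G.transOp π)^[i] rew s' a') =
        Real.sqrt G.γ ^ j * ∑ i ∈ range (n + 1), Real.sqrt G.γ ^ (i + 1) *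
          G.transOp π ((G.transOp π)^[i] rew) s a := by
      conv_rhs => simp only [transOp]
      simp only [mul_sum]
      conv_rhs => rw [sum_comm]
      refine sum_congr rfl fun s' _ => ?_
      conv_rhs => rw [sum_comm]
      exact sum_congr rfl fun a' _ => sum_congr rfl fun i _ => by ring
    rw [h]
    ring

/-- A rollout evaluates `h` only at numbers below a geometric sum, so the values of `h` elsewhere
are irrelevant. This lets truncations replace the identity, and shows that large outputs have
probability zero. -/
lemma rolloutExp_congr {R M : ℝ} (hr : ∀ s a, |rew s a| ≤ R) {h h' : ℝ → ℝ}
    (hh : ∀ y, |y| ≤ M → h y = h' y) (n j : ℕ) {acc : ℝ}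
    (hacc : |acc| + Real.sqrt G.γ ^ j * (R / (1 - Real.sqrt G.γ)) ≤ M) (s : S) (a : A) :
    G.rolloutExp rew π h n j acc s a = G.rolloutExp rew π h' n j acc s a := by
  have hq0 : 0 ≤ Real.sqrt G.γ := Real.sqrt_nonneg _
  have hq1 : 0 < 1 - Real.sqrt G.γ := by
    rw [sub_pos, Real.sqrt_lt' one_pos, one_pow]; exact G.γ_lt_one
  have hR : 0 ≤ R := (abs_nonneg _).trans (hr s a)
  have hstep : ∀ j : ℕ, Real.sqrt G.γ ^ j * (R / (1 - Real.sqrt G.γ)) = Real.sqrt G.γ ^ j * R +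
      Real.sqrt G.γ ^ (j + 1) * (R / (1 - Real.sqrt G.γ)) := fun j => by field_simp; ring
  have habs : ∀ (j : ℕ) (acc : ℝ) (s : S) (a : A), |acc + Real.sqrt G.γ ^ j * rew s a| ≤
      |acc| + Real.sqrt G.γ ^ j * R := fun j acc s a => by
    refine (abs_add_le _ _).trans ?_
    rw [abs_mul, abs_of_nonneg (pow_nonneg hq0 j)]
    gcongr
    exact hr s a
  induction n generalizing j acc s a with
  | zero =>
    refine hh _ ?_
    have h1 : 0 ≤ Real.sqrt G.γ ^ (j + 1) * (R / (1 - Real.sqrt G.γ)) := by positivity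
    linarith [habs j acc s a, hstep j]
  | succ n ih =>
    simp only [rolloutExp]
    refine sum_congr rfl fun s' _ => ?_
    congr 1
    refine sum_congr rfl fun a' _ => ?_
    congr 1
    exact ih (j + 1) (by linarith [habs j acc s a, hstep j]) s' a'

lemma rolloutExp_zero (n j : ℕ) (acc : ℝ) (s : S) (a : A) :
    G.rolloutExp rew π (fun _ => 0) n j acc s a = 0 := by
  induction n generalizing j acc s a with
  | zero => rfl
  | succ n ih => simp [rolloutExp, ih]

/-- An almost sure bound on the output of EstQ for rewards bounded by `R`. -/
def estQBound (G : GAILProblem S A q) (R : ℝ) : ℝ := 2 * R / (1 - G.γ)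

/-- Since `1 - γ = (1 - √γ)(1 + √γ) ≤ 2 (1 - √γ)`. -/
lemma le_estQBound {R : ℝ} (hR : 0 ≤ R) :
    |(0 : ℝ)| + Real.sqrt G.γ ^ 0 * (R / (1 - Real.sqrt G.γ)) ≤ G.estQBound R := by
  have hq1 : Real.sqrt G.γ < 1 := by
    rw [Real.sqrt_lt' one_pos, one_pow]; exact G.γ_lt_one
  have hsq : Real.sqrt G.γ * Real.sqrt G.γ = G.γ := Real.mul_self_sqrt G.γ_pos.le
  have hγ : 0 < 1 - G.γ := by linarith [G.γ_lt_one]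
  rw [abs_zero, zero_add, pow_zero, one_mul, estQBound, div_le_div_iff₀ (by linarith) hγ]
  have : 0 ≤ R * (1 - Real.sqrt G.γ) ^ 2 := by positivity
  nlinarith

lemma estQExp_congr {R : ℝ} (hR : 0 ≤ R) (hr : ∀ s a, |rew s a| ≤ R) {h h' : ℝ → ℝ}
    (hh : ∀ y, |y| ≤ G.estQBound R → h y = h' y) (s : S) (a : A) :
    G.estQExp rew π s a h = G.estQExp rew π s a h' := by
  unfold estQExp
  refine tsum_congr fun n => ?_
  rw [rolloutExp_congr hr hh n 0 (le_estQBound hR)]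

variable [DecidableEq S]

lemma transOp_iterate (n : ℕ) (s : S) (a : A) :
    (G.transOp π)^[n + 1] rew s a = ∑ s', G.P s a s' *
      ((chainMatrix G.P π ^ n) *ᵥ fun s => ∑ a, π s a * rew s a) s' := by
  induction n generalizing s a with
  | zero => simp [transOp]
  | succ n ih =>
    rw [Function.iterate_succ_apply', transOp]
    refine sum_congr rfl fun s' _ => ?_
    congr 1
    simp only [ih]
    rw [pow_succ', ← mulVec_mulVec]
    conv_rhs => rw [mulVec, dotProduct]
    simp only [chainMatrix, sum_mul, mul_sum]
    rw [sum_comm]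
    exact sum_congr rfl fun k _ => sum_congr rfl fun k _ => by ring

lemma hasSum_qFn (hπ : π ∈ policySimplex S A) (s : S) (a : A) :
    HasSum (fun n : ℕ => G.γ ^ n * (G.transOp π)^[n] rew s a) (G.qFn π rew s a) := by
  rw [← hasSum_nat_add_iff' 1]
  have h : HasSum (fun n : ℕ => G.γ * ∑ s', G.P s a s' * (G.γ ^ n *
      ((chainMatrix G.P π ^ n) *ᵥ fun s => ∑ a, π s a * rew s a) s'))
      (G.γ * ∑ s', G.P s a s' * G.valueFn π rew s') :=
    (hasSum_sum fun s' _ => (hasSum_discResolvent_mulVec G.γ_pos.le G.γ_lt_one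
      (G.chain_mem hπ) _ s').mul_left (G.P s a s')).mul_left G.γ
  have h1 : (fun n : ℕ => G.γ ^ (n + 1) * (G.transOp π)^[n + 1] rew s a) = fun n =>
      G.γ * ∑ s', G.P s a s' * (G.γ ^ n *
        ((chainMatrix G.P π ^ n) *ᵥ fun s => ∑ a, π s a * rew s a) s') := funext fun n => by
    rw [transOp_iterate, mul_sum, mul_sum]
    exact sum_congr rfl fun s' _ => by ring
  have h2 : G.qFn π rew s a - ∑ i ∈ range 1, G.γ ^ i * (G.transOp π)^[i] rew s a =
      G.γ * ∑ s', G.P s a s' * G.valueFn π rew s' := by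
    simp [qFn]
  rw [h1, h2]
  exact h

/-- EstQ is an unbiased estimator of the state-action value. -/
lemma estQExp_id (hπ : π ∈ policySimplex S A) {R : ℝ} (hr : ∀ s a, |rew s a| ≤ R)
    (s : S) (a : A) : G.estQExp rew π s a id = G.qFn π rew s a := by
  set z := Real.sqrt G.γ with hz
  have hq0 : 0 ≤ z := Real.sqrt_nonneg _
  have hq1 : z < 1 := by
    rw [hz, Real.sqrt_lt' one_pos, one_pow]; exact G.γ_lt_one
  have hsq : z * z = G.γ := Real.mul_self_sqrt G.γ_pos.le
  have hf : Summable fun n : ℕ => ‖G.γ ^ n * (G.transOp π)^[n] rew s a‖ := by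
    refine Summable.of_nonneg_of_le (fun _ => norm_nonneg _) (fun n => ?_)
      ((summable_geometric_of_lt_one G.γ_pos.le G.γ_lt_one).mul_right R)
    rw [norm_mul, norm_pow, Real.norm_of_nonneg G.γ_pos.le]
    exact mul_le_mul_of_nonneg_left (abs_transOp_iterate_le hπ hr n s a)
      (pow_nonneg G.γ_pos.le n)
  have hg : Summable fun n : ℕ => ‖z ^ n‖ := by
    simpa [abs_of_nonneg hq0] using summable_geometric_of_lt_one hq0 hq1
  -- The expectation over the geometric horizon is a Cauchy product: with `z = √γ`, the terms `γ^k
  -- z^(n-k)` equal `z^n z^k`. The second factor sums to `1 / (1 - z)` and cancels the normalization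
  -- of the horizon.
  have h := tsum_mul_tsum_eq_tsum_sum_range_of_summable_norm hf hg
  rw [(hasSum_qFn hπ s a).tsum_eq, tsum_geometric_of_lt_one hq0 hq1] at h
  have h2 : ∀ n : ℕ, ∑ k ∈ range (n + 1), G.γ ^ k * (G.transOp π)^[k] rew s a * z ^ (n - k) =
      z ^ n * ∑ k ∈ range (n + 1), z ^ k * (G.transOp π)^[k] rew s a := fun n => by
    rw [mul_sum]
    refine sum_congr rfl fun k hk => ?_
    have hkn : n = (n - k) + k := by have := mem_range.1 hk; omega
    conv_rhs => rw [hkn, pow_add]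
    rw [← hsq, mul_pow]
    ring
  simp only [h2] at h
  unfold estQExp
  simp only [rolloutExp_id hπ, pow_zero, one_mul, zero_add, ← hz, mul_assoc]
  rw [tsum_mul_left, ← h]
  have : (1 - z) ≠ 0 := by linarith
  field_simp

end GAILProblem

/-! ### Error of the policy gradient estimator. -/

namespace SampleBatch

variable {S A : Type*} [Fintype S] [Fintype A] [DecidableEq S] {q : ℕ}
  {G : GAILProblem S A q} {Ω : Type*} [mΩ : MeasurableSpace Ω] {Pr : Measure Ω}
  [IsProbabilityMeasure Pr] {b : ℕ} {bef aft : ℕ → MeasurableSpace Ω} {π : Ω → S → A → ℝ}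
  {x : ℕ → Ω → S × A} (h : SampleBatch G Pr b bef aft π x)
  {rew : Ω → S → A → ℝ} {R : ℝ} {Q : ℕ → Ω → ℝ} {s : S} {a : A}

include h

/-- The error splits into the fluctuation of EstQ around its conditional mean, on the event that `s`
is visited, plus the true value times the error of the state frequency. The first part is a sum of
orthogonal terms; the second is a batch average. -/
lemma integral_abs_estQ_sub_le {CM ρ : ℝ} (hCM : 0 < CM) (hρ₀ : 0 < ρ) (hρ₁ : ρ < 1)
    (hb : 1 ≤ b) (hmix : ∀ ω, G.Mixes CM ρ (π ω)) (hR : 0 ≤ R)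
    (hrm : ∀ s a, StronglyMeasurable[bef 0] fun ω => rew ω s a) (hrb : ∀ ω s a, |rew ω s a| ≤ R)
    (hQm : ∀ i < b, StronglyMeasurable[bef (i + 1)] (Q i))
    (hQ : ∀ i < b, ∀ φ : ℝ → ℝ, Measurable φ → (∃ M, ∀ y, |φ y| ≤ M) →
      condExp (aft i) Pr (fun ω => φ (Q i ω)) =ᵐ[Pr]
        fun ω => G.estQExp (rew ω) (π ω) s a φ) :
    Integrable (fun ω => 1 / (b : ℝ) * ∑ i ∈ range b, (if (x i ω).1 = s then Q i ω else 0) -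
      G.visit (π ω) s * G.qFn (π ω) (rew ω) s a) Pr ∧
    ∫ ω, |1 / (b : ℝ) * ∑ i ∈ range b, (if (x i ω).1 = s then Q i ω else 0) -
      G.visit (π ω) s * G.qFn (π ω) (rew ω) s a| ∂Pr ≤
      8 * mixConst CM ρ * R / (1 - G.γ) / Real.sqrt b := by
  have hb0 : (0 : ℝ) < b := by exact_mod_cast hb
  have hγ : 0 < 1 - G.γ := by linarith [G.γ_lt_one]
  have hle : bef 0 ≤ mΩ := (h.bef_le _).trans (h.le _)
  set M := G.estQBound R with hM
  have hM0 : 0 ≤ M := by rw [hM, GAILProblem.estQBound]; positivity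
  -- The conditional law is available for bounded test functions only, so the identity is clipped at
  -- the almost sure bound `M`.
  set φ : ℝ → ℝ := fun y => max (-M) (min y M) with hφ
  have hφm : Measurable φ := by fun_prop
  have hφb : ∀ y, |φ y| ≤ M := fun y => by
    rw [abs_le]
    exact ⟨le_max_left _ _, max_le (by linarith) (min_le_right _ _)⟩
  have hφid : ∀ y, |y| ≤ M → φ y = y := fun y hy => by
    rw [abs_le] at hy
    simp only [hφ]
    rw [min_eq_left hy.2, max_eq_right hy.1]
  -- the outputs are almost surely bounded
  have hbd : ∀ i < b, ∀ᵐ ω ∂Pr, |Q i ω| ≤ M := fun i hi => by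
    have hset : MeasurableSet {y : ℝ | M < |y|} := measurableSet_lt measurable_const measurable_abs
    have h1 := hQ i hi (Set.indicator {y : ℝ | M < |y|} fun _ => 1)
      (measurable_const.indicator hset) ⟨1, fun y => by
        by_cases hy : y ∈ {y : ℝ | M < |y|} <;> simp [hy]⟩
    have h2 : ∀ ω, G.estQExp (rew ω) (π ω) s a (Set.indicator {y : ℝ | M < |y|} fun _ => 1) = 0 :=
      fun ω => by
        rw [GAILProblem.estQExp_congr (h' := fun _ => 0) hR (hrb ω) fun y hy =>
          Set.indicator_of_notMem (by simpa using hy) _]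
        simp [GAILProblem.estQExp, GAILProblem.rolloutExp_zero]
    simp only [h2] at h1
    have hmeas : StronglyMeasurable[mΩ] fun ω =>
        Set.indicator {y : ℝ | M < |y|} (fun _ => (1 : ℝ)) (Q i ω) :=
      ((measurable_const.indicator hset).comp
        (((hQm i hi).mono ((h.bef_le _).trans (h.le _))).measurable)).stronglyMeasurable
    have h01 : ∀ y : ℝ, 0 ≤ Set.indicator {y : ℝ | M < |y|} (fun _ => (1 : ℝ)) y := fun y =>
      Set.indicator_nonneg (fun _ _ => zero_le_one) y
    have hint : Integrable (fun ω => Set.indicator {y : ℝ | M < |y|} (fun _ => (1 : ℝ)) (Q i ω)) Pr :=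
      integrable_of_abs_le hmeas (H := 1) fun ω => by
        by_cases hy : Q i ω ∈ {y : ℝ | M < |y|} <;> simp [hy]
    have h3 : ∫ ω, Set.indicator {y : ℝ | M < |y|} (fun _ => (1 : ℝ)) (Q i ω) ∂Pr = 0 := by
      rw [← integral_condExp (h.le i), integral_congr_ae h1, integral_zero]
    have h4 := (integral_eq_zero_iff_of_nonneg (fun ω => h01 (Q i ω)) hint).1 h3
    filter_upwards [h4] with ω hω
    by_contra hc
    have : Q i ω ∈ {y : ℝ | M < |y|} := not_le.1 hc
    simp [Set.indicator_of_mem this] at hω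
  -- the centered outputs
  have hqm := stronglyMeasurable_qFn G h.meas_π h.π_mem hrm s a
  have hqb : ∀ ω, |G.qFn (π ω) (rew ω) s a| ≤ R / (1 - G.γ) := fun ω =>
    (GAILProblem.abs_qFn_le (h.π_mem ω) (hrb ω) s a).trans (le_of_eq (by ring))
  have hRM : R / (1 - G.γ) ≤ M := by
    rw [hM, GAILProblem.estQBound]; gcongr; linarith
  set e : ℕ → Ω → ℝ := fun i ω => if (x i ω).1 = s then 1 else 0 with he
  have hem : ∀ i < b, StronglyMeasurable[aft i] (e i) := fun i hi =>
    stronglyMeasurable_eval (h := fun _ p => if p.1 = s then (1 : ℝ) else 0) (h.meas_x i hi)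
      fun p => stronglyMeasurable_const
  have heb : ∀ i ω, |e i ω| ≤ 1 := fun i ω => by simp only [he]; split_ifs <;> simp
  set D : ℕ → Ω → ℝ := fun i ω => φ (Q i ω) - G.qFn (π ω) (rew ω) s a with hD
  have hDm : ∀ i < b, StronglyMeasurable[bef (i + 1)] (D i) := fun i hi =>
    ((hφm.comp (hQm i hi).measurable).stronglyMeasurable).sub
      (hqm.mono (h.bef_mono (Nat.zero_le _)))
  have hDb : ∀ i ω, |D i ω| ≤ 2 * M := fun i ω => by
    have := abs_sub (φ (Q i ω)) (G.qFn (π ω) (rew ω) s a)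
    linarith [hφb (Q i ω), hqb ω]
  -- `W` may depend on the `j`-th sample itself, since the rollout is fresh given `aft j`. This is
  -- used with an earlier term times the indicator that sample `j` lies in `s`.
  have hort : ∀ j < b, ∀ W : Ω → ℝ, StronglyMeasurable[aft j] W → (∀ ω, |W ω| ≤ 2 * M) →
      ∫ ω, W ω * D j ω ∂Pr = 0 := fun j hj W hW hWb => by
    have hφsm : StronglyMeasurable[mΩ] fun ω => φ (Q j ω) :=
      (hφm.comp ((hQm j hj).mono ((h.bef_le _).trans (h.le _))).measurable).stronglyMeasurable
    have hI1 : Integrable (fun ω => W ω * φ (Q j ω)) Pr :=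
      integrable_of_abs_le ((hW.mono (h.le j)).mul hφsm) (H := 2 * M * M) fun ω => by
        rw [abs_mul]
        exact mul_le_mul (hWb ω) (hφb _) (abs_nonneg _) (by positivity)
    have hI2 : Integrable (fun ω => W ω * G.qFn (π ω) (rew ω) s a) Pr :=
      integrable_of_abs_le ((hW.mono (h.le j)).mul (hqm.mono hle)) (H := 2 * M * M) fun ω => by
        rw [abs_mul]
        exact mul_le_mul (hWb ω) ((hqb ω).trans hRM) (abs_nonneg _) (by positivity)
    simp only [hD, mul_sub]
    rw [integral_sub hI1 hI2, sub_eq_zero, ← integral_condExp (h.le j)]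
    refine integral_congr_ae ?_
    refine (condExp_mul_of_stronglyMeasurable_left hW hI1
      (integrable_of_abs_le hφsm fun ω => hφb _)).trans ?_
    filter_upwards [hQ j hj φ hφm ⟨M, hφb⟩] with ω hω
    rw [Pi.mul_apply, hω, GAILProblem.estQExp_congr (h' := id) hR (hrb ω) hφid,
      GAILProblem.estQExp_id (h.π_mem ω) (hrb ω)]
  set Y : ℕ → Ω → ℝ := fun i ω => e i ω * D i ω with hY
  have hYm : ∀ i < b, StronglyMeasurable[bef (i + 1)] (Y i) := fun i hi =>
    ((hem i hi).mono (h.aft_le i)).mul (hDm i hi)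
  have hYb : ∀ i ω, |Y i ω| ≤ 2 * M := fun i ω => by
    rw [hY, abs_mul]
    exact (mul_le_of_le_one_left (abs_nonneg _) (heb i ω)).trans (hDb i ω)
  have hYm' : ∀ i < b, StronglyMeasurable[mΩ] (Y i) := fun i hi =>
    (hYm i hi).mono ((h.bef_le _).trans (h.le _))
  have hYYb : ∀ i j ω, |Y i ω * Y j ω| ≤ 2 * M * (2 * M) := fun i j ω => by
    rw [abs_mul]; exact mul_le_mul (hYb i ω) (hYb j ω) (abs_nonneg _) (by positivity)
  -- Orthogonality is the case of zero correlations, `c = 0` and `ρ = 0`.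
  have hYsq : ∫ ω, (∑ i ∈ range b, Y i ω) ^ 2 ∂Pr ≤ b * (2 * M * (2 * M) + 2 * 0 / (1 - 0)) := by
    refine _root_.integral_sq_sum_le (f := Y) (c := 0) (ρ := 0) le_rfl le_rfl one_pos
      (fun i hi j hj => integrable_of_abs_le ((hYm' i hi).mul (hYm' j hj)) (hYYb i j))
      (fun i hi => ?_) (fun j hj i hij => ?_) b le_rfl
    · have := norm_integral_le_of_norm_le_const (μ := Pr) (f := fun ω => Y i ω * Y i ω)
        (C := 2 * M * (2 * M)) (Filter.Eventually.of_forall (hYYb i i))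
      rw [probReal_univ, mul_one] at this
      exact (le_abs_self _).trans this
    · have h1 := hort j hj (fun ω => Y i ω * e j ω) (((hYm i (hij.trans hj)).mono
        ((h.bef_mono hij).trans (h.bef_le j))).mul (hem j hj)) fun ω => by
          rw [abs_mul]
          exact (mul_le_of_le_one_right (abs_nonneg _) (heb j ω)).trans (hYb i ω)
      have h2 : ∀ ω, Y i ω * Y j ω = Y i ω * e j ω * D j ω := fun ω => by simp only [hY]; ring
      simp only [h2]
      rw [h1, zero_mul]
  have hSm : StronglyMeasurable[mΩ] fun ω => 1 / (b : ℝ) * ∑ i ∈ range b, Y i ω :=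
    (Finset.stronglyMeasurable_fun_sum _ fun i hi => hYm' i (mem_range.1 hi)).const_mul _
  have hSb : ∀ ω, |1 / (b : ℝ) * ∑ i ∈ range b, Y i ω| ≤ 2 * M := fun ω => by
    rw [abs_mul, abs_of_pos (one_div_pos.2 hb0)]
    calc _ ≤ 1 / (b : ℝ) * ∑ i ∈ range b, (2 * M) :=
          mul_le_mul_of_nonneg_left ((abs_sum_le_sum_abs _ _).trans (sum_le_sum fun i _ => hYb i ω))
            (one_div_pos.2 hb0).le
      _ = 2 * M := by rw [sum_const, card_range, nsmul_eq_mul]; field_simp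
  have hSI := integrable_of_abs_le (Pr := Pr) hSm hSb
  have hS : ∫ ω, |1 / (b : ℝ) * ∑ i ∈ range b, Y i ω| ∂Pr ≤ 2 * M / Real.sqrt b := by
    refine integral_abs_le_of_integral_sq_le hSI (integrable_of_abs_le (hSm.pow 2)
      (H := (2 * M) ^ 2) fun ω => by
        rw [abs_pow]; exact pow_le_pow_left₀ (abs_nonneg _) (hSb ω) 2) (by positivity) ?_
    simp only [mul_pow]
    rw [integral_const_mul]
    calc _ ≤ (1 / (b : ℝ)) ^ 2 * (b * (2 * M * (2 * M) + 2 * 0 / (1 - 0))) :=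
          mul_le_mul_of_nonneg_left hYsq (by positivity)
      _ = _ := by rw [div_pow (2 * M), Real.sq_sqrt hb0.le]; field_simp; ring
  -- the state frequencies
  obtain ⟨hFI, hF⟩ := h.integral_abs_avg_sub_le hCM hρ₀ hρ₁ hb hmix
    (f := fun _ p => if p.1 = s then (1 : ℝ) else 0) (H := 1)
    (fun p => stronglyMeasurable_const) zero_le_one
    (fun ω p => by split_ifs <;> simp)
  have hvis : ∀ ω, G.visitExp (π ω) (fun p => if p.1 = s then (1 : ℝ) else 0) = G.visit (π ω) s :=
    fun ω => by simp [GAILProblem.visitExp, (h.π_mem ω).2]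
  simp only [hvis] at hFI hF
  set Fr : Ω → ℝ := fun ω => 1 / (b : ℝ) * ∑ i ∈ range b, (if (x i ω).1 = s then (1 : ℝ) else 0) -
    G.visit (π ω) s with hFr
  have hqFI : Integrable (fun ω => Fr ω * G.qFn (π ω) (rew ω) s a) Pr :=
    hFI.mul_bdd (c := R / (1 - G.γ)) (hqm.mono hle).aestronglyMeasurable
      (Filter.Eventually.of_forall hqb)
  -- decomposition
  have hae : (fun ω => 1 / (b : ℝ) * ∑ i ∈ range b, (if (x i ω).1 = s then Q i ω else 0) -
      G.visit (π ω) s * G.qFn (π ω) (rew ω) s a) =ᵐ[Pr] fun ω =>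
      1 / (b : ℝ) * ∑ i ∈ range b, Y i ω + Fr ω * G.qFn (π ω) (rew ω) s a := by
    have hall : ∀ᵐ ω ∂Pr, ∀ i ∈ range b, |Q i ω| ≤ M :=
      (Finset.eventually_all _).2 fun i hi => hbd i (mem_range.1 hi)
    filter_upwards [hall] with ω hω
    have h1 : ∑ i ∈ range b, Y i ω = ∑ i ∈ range b, (if (x i ω).1 = s then Q i ω else 0) -
        (∑ i ∈ range b, (if (x i ω).1 = s then (1 : ℝ) else 0)) * G.qFn (π ω) (rew ω) s a := by
      rw [sum_mul, ← sum_sub_distrib]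
      refine sum_congr rfl fun i hi => ?_
      simp only [hY, he, hD, hφid _ (hω i hi)]
      split_ifs <;> ring
    rw [h1, hFr]
    ring
  have hTI : Integrable (fun ω => 1 / (b : ℝ) * ∑ i ∈ range b, Y i ω +
      Fr ω * G.qFn (π ω) (rew ω) s a) Pr := hSI.add hqFI
  refine ⟨hTI.congr hae.symm, ?_⟩
  have hK := one_le_mixConst hCM hρ₁
  calc _ = ∫ ω, |1 / (b : ℝ) * ∑ i ∈ range b, Y i ω + Fr ω * G.qFn (π ω) (rew ω) s a| ∂Pr :=
        integral_congr_ae (hae.mono fun ω hω => by simp only [hω])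
    _ ≤ ∫ ω, (|1 / (b : ℝ) * ∑ i ∈ range b, Y i ω| + |Fr ω| * (R / (1 - G.γ))) ∂Pr := by
        refine integral_mono hTI.abs (hSI.abs.add (hFI.abs.mul_const _)) fun ω => ?_
        refine (abs_add_le _ _).trans ?_
        rw [abs_mul (Fr ω)]
        gcongr
        exact hqb ω
    _ = ∫ ω, |1 / (b : ℝ) * ∑ i ∈ range b, Y i ω| ∂Pr + (∫ ω, |Fr ω| ∂Pr) * (R / (1 - G.γ)) := by
        rw [integral_add hSI.abs (hFI.abs.mul_const _), integral_mul_const]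
    _ ≤ 2 * M / Real.sqrt b + 4 * mixConst CM ρ * 1 / Real.sqrt b * (R / (1 - G.γ)) := by
        gcongr
    _ = (4 + 4 * mixConst CM ρ) * R / (1 - G.γ) / Real.sqrt b := by
        rw [hM, GAILProblem.estQBound]; ring
    _ ≤ _ := by
        gcongr
        linarith

end SampleBatch

/-! ### Gradient dominance and the inexact Frank–Wolfe step. -/

namespace GAILProblem

variable {S A : Type*} [Fintype S] [Fintype A]

omit [Fintype S] in
lemma policySimplex_convex : Convex ℝ (policySimplex S A) := by
  intro x hx y hy a b ha hb hab
  refine ⟨fun s c => add_nonneg (mul_nonneg ha (hx.1 s c)) (mul_nonneg hb (hy.1 s c)), fun s => ?_⟩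
  simp only [Pi.add_apply, Pi.smul_apply, smul_eq_mul, sum_add_distrib, ← mul_sum, hx.2, hy.2]
  linarith

omit [Fintype S] in
lemma policySimplex_le_one {π : S → A → ℝ} (hπ : π ∈ policySimplex S A) (s : S) (a : A) :
    π s a ≤ 1 := by
  rw [← hπ.2 s]
  exact single_le_sum (fun a _ => hπ.1 s a) (mem_univ a)

lemma policyDist_le {π π' : S → A → ℝ} (hπ : π ∈ policySimplex S A)
    (hπ' : π' ∈ policySimplex S A) : policyDist π π' ≤ 2 * Fintype.card S := by
  calc policyDist π π' ≤ ∑ _s : S, (2 : ℝ) := by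
        refine sum_le_sum fun s _ => ?_
        calc ∑ a, |π' s a - π s a| ≤ ∑ a, (π' s a + π s a) := sum_le_sum fun a _ => by
              rw [abs_le]; constructor <;> linarith [hπ.1 s a, hπ'.1 s a]
          _ = 2 := by rw [sum_add_distrib, hπ.2, hπ'.2]; norm_num
    _ = 2 * Fintype.card S := by simp [mul_comm]

lemma policyDist_step {π v : S → A → ℝ} {η : ℝ} (hη : 0 ≤ η) :
    policyDist π (π + η • (v - π)) = η * policyDist π v := by
  simp only [policyDist, mul_sum, Pi.add_apply, Pi.smul_apply, Pi.sub_apply, smul_eq_mul,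
    add_sub_cancel_left, abs_mul, abs_of_nonneg hη]

omit [Fintype S] in
/-- A deterministic policy maximizing `Q s ·` in every state `s`. -/
lemma exists_greedy [Nonempty A] (Q : S → A → ℝ) :
    ∃ π ∈ policySimplex S A, ∀ π' ∈ policySimplex S A, ∀ s,
      ∑ a, π' s a * Q s a ≤ ∑ a, π s a * Q s a := by
  classical
  choose m hm using fun s => Finite.exists_max (Q s)
  refine ⟨fun s a => if a = m s then 1 else 0, ⟨fun s a => by positivity, fun s => by simp⟩,
    fun π' hπ' s => ?_⟩
  simp only [ite_mul, one_mul, zero_mul, sum_ite_eq', mem_univ, if_true]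
  calc ∑ a, π' s a * Q s a ≤ ∑ a, π' s a * Q s (m s) :=
        sum_le_sum fun a _ => mul_le_mul_of_nonneg_left (hm s a) (hπ'.1 s a)
    _ = Q s (m s) := by rw [← sum_mul, hπ'.2, one_mul]

variable [DecidableEq S] {q : ℕ} {G : GAILProblem S A q}
  {μ Lψ CM ρ Cr Lr Cα Rmax ζmin : ℝ}

namespace Assumptions

variable (hG : G.Assumptions μ Lψ CM ρ Cr Lr Cα Rmax ζmin) {θ θs v : S → A → ℝ}
  {α : EuclideanSpace ℝ (Fin q)}
include hG

/-- Gradient dominance: the value gap is controlled by the linear improvement of a greedy policy. -/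
lemma exists_policy_improvement (hζ : 0 < ζmin) (hρ₀ : 0 < ρ) (hρ₁ : ρ < 1) (hCM : 0 < CM)
    (hθ : θ ∈ policySimplex S A) (hθs : θs ∈ policySimplex S A) (hα : α ∈ G.Λ) :
    ∃ π ∈ policySimplex S A,
      (1 - G.γ) ^ 2 * ζmin * (G.g θ - G.g θs) -
        2 * Fintype.card S * mixConst CM ρ * Cr * ζmin * ‖α - G.bestReward θ‖ ≤
      ∑ s, G.visit θ s * ∑ a, (π s a - θ s a) * G.qFn θ (G.r α) s a := by
  have := G.nonempty_action
  have hγ : 0 < 1 - G.γ := by linarith [G.γ_lt_one]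
  have hK := one_le_mixConst hCM hρ₁
  have hCr := hG.Cr_nonneg
  obtain ⟨π, hπ, hmax⟩ := exists_greedy (G.qFn θ (G.r α))
  refine ⟨π, hπ, ?_⟩
  have hm : ∀ π' ∈ policySimplex S A, ∀ s, ∑ a, (π' s a - θ s a) * G.qFn θ (G.r α) s a ≤
      ∑ a, (π s a - θ s a) * G.qFn θ (G.r α) s a := fun π' hπ' s => by
    simp only [sub_mul, sum_sub_distrib]
    linarith [hmax π' hπ' s]
  have hm0 : ∀ s, 0 ≤ ∑ a, (π s a - θ s a) * G.qFn θ (G.r α) s a := fun s => by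
    simpa using hm θ hθ s
  -- The change of weights is legitimate state by state because the greedy advantages are
  -- nonnegative: the weight of `θs` is at most `1`, that of `θ` at least `(1 - γ) * ζmin`.
  have h1 : (1 - G.γ) * ζmin * ∑ s, G.visit θs s * ∑ a, (θs s a - θ s a) * G.qFn θ (G.r α) s a ≤
      ∑ s, G.visit θ s * ∑ a, (π s a - θ s a) * G.qFn θ (G.r α) s a := by
    rw [mul_sum]
    refine sum_le_sum fun s _ => ?_
    have h2 : G.visit θs s * ∑ a, (θs s a - θ s a) * G.qFn θ (G.r α) s a ≤
        ∑ a, (π s a - θ s a) * G.qFn θ (G.r α) s a :=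
      (mul_le_mul_of_nonneg_left (hm θs hθs s) (G.visit_nonneg hθs s)).trans
        (mul_le_of_le_one_left (hm0 s) (G.visit_le_one hθs s))
    have h3 : (1 - G.γ) * ζmin ≤ G.visit θ s :=
      (mul_le_mul_of_nonneg_left (hG.ζ_lower s) hγ.le).trans (G.le_visit hθ s)
    exact (mul_le_mul_of_nonneg_left h2 (by positivity)).trans
      (mul_le_mul_of_nonneg_right h3 (hm0 s))
  have h2 : ∑ s, G.visit θs s * ∑ a, (θs s a - θ s a) * G.qFn θ (G.r α) s a =
      (1 - G.γ) * (G.V θs (G.r α) - G.V θ (G.r α)) := by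
    rw [V_sub_V G hθ hθs]; field_simp
  rw [h2] at h1
  refine le_trans ?_ h1
  have h3 := hG.g_sub_g_le hθ hθs
  have hαs := (hG.bestReward_spec hθ).1
  have h4 := abs_V_sub_V_le (hG.mixes hθ) hθ hθs hρ₀ hρ₁
    (mul_nonneg hCr (norm_nonneg (α - G.bestReward θ))) (hG.abs_reward_sub_le hαs hα)
  rw [V_sub hθ, V_sub hθs] at h4
  have h5 := (abs_le.1 h4).1
  have h6 : 1 / (1 - G.γ) * (policyDist θ θs * (mixConst CM ρ * (Cr * ‖α - G.bestReward θ‖))) ≤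
      1 / (1 - G.γ) * (2 * Fintype.card S * (mixConst CM ρ * (Cr * ‖α - G.bestReward θ‖))) := by
    gcongr
    exact policyDist_le hθ hθs
  have h7 : (G.g θ - G.g θs) - 1 / (1 - G.γ) *
      (2 * Fintype.card S * (mixConst CM ρ * (Cr * ‖α - G.bestReward θ‖))) ≤
      G.V θs (G.r α) - G.V θ (G.r α) := by linarith
  have h8 := mul_le_mul_of_nonneg_left h7 (show 0 ≤ (1 - G.γ) * ζmin * (1 - G.γ) by positivity)
  have h9 : (1 - G.γ) * ζmin * (1 - G.γ) * (1 / (1 - G.γ) *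
      (2 * Fintype.card S * (mixConst CM ρ * (Cr * ‖α - G.bestReward θ‖)))) =
      (1 - G.γ) * (2 * Fintype.card S * mixConst CM ρ * Cr * ζmin * ‖α - G.bestReward θ‖) := by
    field_simp
  have h10 : (1 - G.γ) * (2 * Fintype.card S * mixConst CM ρ * Cr * ζmin * ‖α - G.bestReward θ‖) ≤
      2 * Fintype.card S * mixConst CM ρ * Cr * ζmin * ‖α - G.bestReward θ‖ :=
    mul_le_of_le_one_left (by positivity) (by linarith [G.γ_pos])
  rw [mul_sub _ (G.g θ - G.g θs), h9] at h8
  linarith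

/-- One Frank–Wolfe step with an inexact reward parameter `α` and an inexact gradient `J`. -/
lemma frankWolfe_step (hμ : 0 < μ) (hζ : 0 < ζmin) (hρ₀ : 0 < ρ) (hρ₁ : ρ < 1) (hCM : 0 < CM)
    (hθ : θ ∈ policySimplex S A) (hθs : θs ∈ policySimplex S A) (hα : α ∈ G.Λ)
    (hv : v ∈ policySimplex S A) {J : S → A → ℝ}
    (hmax : ∀ π ∈ policySimplex S A, ∑ s, ∑ a, π s a * J s a ≤ ∑ s, ∑ a, v s a * J s a)
    {η : ℝ} (hη₀ : 0 < η) (hη₁ : η ≤ 1) :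
    (1 - G.γ) ^ 2 * ζmin * (G.g θ - G.g θs) ≤
      (1 - G.γ) / η * (G.g θ - G.g (θ + η • (v - θ))) +
      (∑ s, ∑ a, |J s a - G.visit θ s * G.qFn θ (G.r α) s a|) +
      (2 * mixConst CM ρ * Cr * (1 + Fintype.card S * ζmin)) * ‖α - G.bestReward θ‖ +
      4 * Fintype.card S * mixConst CM ρ ^ 2 * (Cr ^ 2 / μ + Rmax) * (η / (1 - G.γ)) := by
  have := G.nonempty_state
  have hγ : 0 < 1 - G.γ := by linarith [G.γ_lt_one]
  have hK := one_le_mixConst hCM hρ₁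
  have hCr := hG.Cr_nonneg
  have hR := hG.Rmax_nonneg
  set θ' := θ + η • (v - θ) with hθ'def
  have hθ' : θ' ∈ policySimplex S A := policySimplex_convex.add_smul_sub_mem hθ hv ⟨hη₀.le, hη₁⟩
  set α' := G.bestReward θ' with hα'def
  have hα' : α' ∈ G.Λ := (hG.bestReward_spec hθ').1
  have hdist : policyDist θ θ' ≤ η * (2 * Fintype.card S) := by
    rw [hθ'def, policyDist_step hη₀.le]
    exact mul_le_mul_of_nonneg_left (policyDist_le hθ hv) hη₀.le
  -- descent
  have h1 : (1 - G.γ) / η * (G.g θ' - G.g θ) ≤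
      -∑ s, G.visit θ' s * ∑ a, (v s a - θ s a) * G.qFn θ (G.r α') s a := by
    -- The maximizer at the new policy is what bounds the increase of `g` from above. The price is
    -- the later passage from `α'` to `α`.
    have h2 := hG.g_sub_g_le hθ' hθ
    have h3 := V_sub_V G hθ hθ' (G.r α')
    have h4 : ∑ s, G.visit θ' s * ∑ a, (θ' s a - θ s a) * G.qFn θ (G.r α') s a =
        η * ∑ s, G.visit θ' s * ∑ a, (v s a - θ s a) * G.qFn θ (G.r α') s a := by
      simp only [mul_sum]
      refine sum_congr rfl fun s _ => sum_congr rfl fun a _ => ?_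
      simp only [hθ'def, Pi.add_apply, Pi.smul_apply, Pi.sub_apply, smul_eq_mul]
      ring
    rw [h4] at h3
    have h5 : G.g θ' - G.g θ ≤ -(1 / (1 - G.γ) *
      (η * ∑ s, G.visit θ' s * ∑ a, (v s a - θ s a) * G.qFn θ (G.r α') s a)) := by linarith
    refine (mul_le_mul_of_nonneg_left h5 (by positivity)).trans (le_of_eq ?_)
    field_simp
  -- change of the visitation distribution
  have h2 : |∑ s, (G.visit θ' s - G.visit θ s) * ∑ a, (v s a - θ s a) * G.qFn θ (G.r α') s a| ≤
      4 * Fintype.card S * mixConst CM ρ ^ 2 * Rmax * (η / (1 - G.γ)) := by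
    obtain ⟨c, hc⟩ := (hG.mixes hθ).qFn_osc hθ hρ₀ hρ₁ hR (hG.r_bounded α' hα')
    refine (abs_sum_visit_sub_le (hG.mixes hθ) hθ hθ' hρ₀ hρ₁ (H := 2 * (mixConst CM ρ * Rmax))
      (by positivity) (abs_sum_policy_sub_le hθ hv hc)).trans ?_
    have hηγ : η ≤ η / (1 - G.γ) := le_div_self hη₀.le hγ (by linarith [G.γ_pos])
    calc _ ≤ η * (2 * Fintype.card S) * (mixConst CM ρ * (2 * (mixConst CM ρ * Rmax))) := by gcongr
      _ = 4 * Fintype.card S * mixConst CM ρ ^ 2 * Rmax * η := by ring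
      _ ≤ _ := by gcongr
  -- change of the reward
  have h3 : |∑ s, G.visit θ s * ∑ a, (v s a - θ s a) * G.qFn θ (G.r α') s a -
      ∑ s, G.visit θ s * ∑ a, (v s a - θ s a) * G.qFn θ (G.r α) s a| ≤
      2 * mixConst CM ρ * Cr * ‖α - G.bestReward θ‖ +
      4 * Fintype.card S * mixConst CM ρ ^ 2 * (Cr ^ 2 / μ) * (η / (1 - G.γ)) := by
    have hr := hG.abs_reward_sub_le hα hα'
    obtain ⟨c, hc⟩ := (hG.mixes hθ).qFn_osc hθ hρ₀ hρ₁
      (mul_nonneg hCr (norm_nonneg (α' - α))) hr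
    have h4 : ∑ s, G.visit θ s * ∑ a, (v s a - θ s a) * G.qFn θ (G.r α') s a -
        ∑ s, G.visit θ s * ∑ a, (v s a - θ s a) * G.qFn θ (G.r α) s a =
        ∑ s, G.visit θ s * ∑ a, (v s a - θ s a) *
          G.qFn θ (fun s a => G.r α' s a - G.r α s a) s a := by
      simp only [qFn_sub, mul_sub, sum_sub_distrib]
    rw [h4]
    refine (abs_avg_le (G.visit_nonneg hθ) (G.visit_sum hθ)
      (abs_sum_policy_sub_le hθ hv hc)).trans ?_
    -- Through the best reward of the old policy: one part is the Lipschitz bound, of order `η / (1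
    -- - γ)`, the other is the error of the inner loop.
    have h5 : ‖α' - α‖ ≤ ‖α' - G.bestReward θ‖ + ‖α - G.bestReward θ‖ := by
      rw [norm_sub_rev α]
      exact norm_sub_le_norm_sub_add_norm_sub _ _ _
    have h6 := hG.norm_bestReward_sub_le hμ hCM hρ₀ hρ₁ hθ hθ'
    have h7 : mixConst CM ρ * Cr / μ * (1 / (1 - G.γ)) * policyDist θ θ' ≤
        mixConst CM ρ * Cr / μ * (1 / (1 - G.γ)) * (η * (2 * Fintype.card S)) := by
      gcongr
    calc 2 * (mixConst CM ρ * (Cr * ‖α' - α‖)) ≤ 2 * (mixConst CM ρ * (Cr *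
          (mixConst CM ρ * Cr / μ * (1 / (1 - G.γ)) * (η * (2 * Fintype.card S)) +
            ‖α - G.bestReward θ‖))) := by
          gcongr
          linarith
      _ = _ := by field_simp; ring
  -- inexact direction
  obtain ⟨π, hπ, h4⟩ := hG.exists_policy_improvement hζ hρ₀ hρ₁ hCM hθ hθs hα
  have h5 : ∑ s, G.visit θ s * ∑ a, (π s a - θ s a) * G.qFn θ (G.r α) s a -
      (∑ s, ∑ a, |J s a - G.visit θ s * G.qFn θ (G.r α) s a|) ≤
      ∑ s, G.visit θ s * ∑ a, (v s a - θ s a) * G.qFn θ (G.r α) s a := by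
    -- Entries of policies lie in `[0, 1]`, so their differences are at most `1` in absolute value
    -- and the direction error is at most the `ℓ¹` error of `J`.
    have h6 : ∑ s, ∑ a, (π s a - v s a) * (G.visit θ s * G.qFn θ (G.r α) s a - J s a) ≤
        ∑ s, ∑ a, |J s a - G.visit θ s * G.qFn θ (G.r α) s a| := by
      refine sum_le_sum fun s _ => sum_le_sum fun a _ => ?_
      refine (le_abs_self _).trans ?_
      rw [abs_mul, abs_sub_comm (J s a)]
      refine mul_le_of_le_one_left (abs_nonneg _) (abs_le.2 ?_)
      constructor <;> linarith [hπ.1 s a, hv.1 s a, policySimplex_le_one hπ s a,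
        policySimplex_le_one hv s a]
    have h7 := hmax π hπ
    have h8 : ∑ s, ∑ a, (π s a - v s a) * (G.visit θ s * G.qFn θ (G.r α) s a - J s a) =
        ∑ s, G.visit θ s * ∑ a, (π s a - θ s a) * G.qFn θ (G.r α) s a -
        ∑ s, G.visit θ s * ∑ a, (v s a - θ s a) * G.qFn θ (G.r α) s a -
        (∑ s, ∑ a, π s a * J s a - ∑ s, ∑ a, v s a * J s a) := by
      simp only [mul_sum, ← sum_sub_distrib]
      exact sum_congr rfl fun s _ => sum_congr rfl fun a _ => by ring
    linarith
  have h6 : ∑ s, (G.visit θ' s - G.visit θ s) * ∑ a, (v s a - θ s a) * G.qFn θ (G.r α') s a =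
      ∑ s, G.visit θ' s * ∑ a, (v s a - θ s a) * G.qFn θ (G.r α') s a -
      ∑ s, G.visit θ s * ∑ a, (v s a - θ s a) * G.qFn θ (G.r α') s a := by
    simp only [sub_mul, sum_sub_distrib]
  rw [h6] at h2
  have h7 := (abs_le.1 h2).1
  have h8 := (abs_le.1 h3).1
  linarith

end Assumptions

end GAILProblem

lemma EuclideanSpace.norm_le_sum_abs {q : ℕ} (v : EuclideanSpace ℝ (Fin q)) :
    ‖v‖ ≤ ∑ i, |v i| := by
  rw [EuclideanSpace.norm_eq]
  refine Real.sqrt_le_iff.2 ⟨sum_nonneg fun i _ => abs_nonneg _, ?_⟩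
  simp only [Real.norm_eq_abs]
  exact sum_sq_le_sq_sum_of_nonneg fun i _ => abs_nonneg _

/-! ### Continuity on the simplex and on `Λ`, for measurability along a run. -/

section Continuity

variable {S A : Type*} [Fintype S] [Fintype A]

lemma continuousOn_of_norm_sub_le_policyDist {F : Type*} [NormedAddCommGroup F]
    {f : (S → A → ℝ) → F} {s : Set (S → A → ℝ)} {C : ℝ}
    (h : ∀ θ ∈ s, ∀ θ' ∈ s, ‖f θ' - f θ‖ ≤ C * policyDist θ θ') : ContinuousOn f s := by
  intro θ hθ
  rw [ContinuousWithinAt, tendsto_iff_norm_sub_tendsto_zero]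
  have hc : Continuous fun θ' : S → A → ℝ => C * policyDist θ θ' := by
    unfold policyDist; fun_prop
  have h0 : Filter.Tendsto (fun θ' : S → A → ℝ => C * policyDist θ θ') (nhdsWithin θ s) (nhds 0) := by
    have := (hc.tendsto θ).mono_left (nhdsWithin_le_nhds (s := s))
    simpa [policyDist] using this
  refine squeeze_zero' (Filter.Eventually.of_forall fun _ => norm_nonneg _) ?_ h0
  filter_upwards [self_mem_nhdsWithin] with θ' hθ'
  exact h θ hθ θ' hθ'

namespace GAILProblem.Assumptions

variable [DecidableEq S] {q : ℕ} {G : GAILProblem S A q}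
  {μ Lψ CM ρ Cr Lr Cα Rmax ζmin : ℝ} (hG : G.Assumptions μ Lψ CM ρ Cr Lr Cα Rmax ζmin)
include hG

lemma continuousOn_g (hρ₀ : 0 < ρ) (hρ₁ : ρ < 1) : ContinuousOn G.g (policySimplex S A) :=
  continuousOn_of_norm_sub_le_policyDist (C := 1 / (1 - G.γ) * (mixConst CM ρ * Rmax))
    fun θ hθ θ' hθ' => (hG.abs_g_sub_g_le hρ₀ hρ₁ hθ hθ').trans (le_of_eq (by ring))

lemma continuousOn_bestReward (hμ : 0 < μ) (hCM : 0 < CM) (hρ₀ : 0 < ρ) (hρ₁ : ρ < 1) :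
    ContinuousOn G.bestReward (policySimplex S A) :=
  continuousOn_of_norm_sub_le_policyDist
    fun _ hθ _ hθ' => hG.norm_bestReward_sub_le hμ hCM hρ₀ hρ₁ hθ hθ'

lemma continuousOn_reward (s : S) (a : A) : ContinuousOn (fun α => G.r α s a) G.Λ :=
  fun α hα => (hG.r_diff α hα s a).continuousAt.continuousWithinAt

lemma continuousOn_gradReward (s : S) (a : A) :
    ContinuousOn (fun α => G.gradReward α s a) G.Λ :=
  (LipschitzOnWith.of_dist_le_mul (K := Lr.toNNReal) fun x hx y hy => by
    rw [dist_eq_norm, dist_eq_norm]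
    exact (hG.r_grad_lip s a x hx y hy).trans
      (mul_le_mul_of_nonneg_right (Real.le_coe_toNNReal Lr) (norm_nonneg _))).continuousOn

lemma continuousOn_gradReward_apply (s : S) (a : A) (i : Fin q) :
    ContinuousOn (fun α => G.gradReward α s a i) G.Λ :=
  (EuclideanSpace.proj (𝕜 := ℝ) i).continuous.comp_continuousOn (hG.continuousOn_gradReward s a)

end GAILProblem.Assumptions

end Continuity

/-! ### A run of the algorithm: sampling errors and the inner loop. -/

namespace FWPGRun

variable {S A : Type*} [Fintype S] [Fintype A] [DecidableEq S] {q : ℕ}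
  {G : GAILProblem S A q} {η β : ℝ} {T K B b : ℕ} {Ω : Type*} [mΩ : MeasurableSpace Ω]
  {Pr : Measure Ω} (R : FWPGRun G η β T K B b Pr)

lemma before_mono {i j : ℕ} (hij : i ≤ j) : R.before i ≤ R.before j :=
  monotone_nat_of_le_succ (fun n => (R.before_le_after n).trans (R.after_le_before n)) hij

lemma before_le (i : ℕ) : R.before i ≤ mΩ := (R.before_le_after i).trans (R.after_le i)

lemma θ_mem (hη₀ : 0 ≤ η) (hη₁ : η ≤ 1) {t : ℕ} (ht : t ≤ T) (ω : Ω) :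
    R.θ t ω ∈ policySimplex S A := by
  induction t with
  | zero => exact R.θ_init ω
  | succ t ih =>
    rw [R.θ_step t ht ω]
    exact GAILProblem.policySimplex_convex.add_smul_sub_mem (ih (by omega)) (R.v_mem t ht ω) ⟨hη₀, hη₁⟩

lemma α_mem {t : ℕ} (ht : t < T) {k : ℕ} (hk : k ≤ K) (ω : Ω) : R.α t k ω ∈ G.Λ := by
  rcases k with _ | k
  · exact R.α_init t ht ω
  · exact (R.α_step t ht k hk ω).1

/-- Any window of learner samples inside one outer iteration is a batch for the frozen policy `θ t`.
The law of its first pair is left free, so earlier policies do not matter. -/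
lemma sampleBatch (hη₀ : 0 ≤ η) (hη₁ : η ≤ 1) {t o L : ℕ} (ht : t < T)
    (ho : t * (K * B + b) ≤ o) (hoL : o + L ≤ t * (K * B + b) + (K * B + b)) :
    SampleBatch G Pr L (fun i => R.before (o + i)) (fun i => R.after (o + i)) (R.θ t)
      (fun i => R.x (o + i)) := by
  have hT : t * (K * B + b) + (K * B + b) ≤ T * (K * B + b) := by
    rw [← Nat.succ_mul]; exact Nat.mul_le_mul_right _ ht
  refine ⟨fun _ => R.before_le_after _, fun _ => R.after_le_before _, fun _ => R.after_le _,
    (R.θ_meas t ht).mono (R.before_mono ho), R.θ_mem hη₀ hη₁ ht.le,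
    fun i hi p => R.x_meas _ (by omega) p, fun i hi f => ?_⟩
  have h := R.x_law (o + i) (by omega) f
  -- All indices of the window belong to outer iteration `t`, hence the policy in `x_law` is `θ t`.
  have hdiv : (o + i + 1) / (K * B + b) = t := by
    rw [Nat.div_eq_iff (by omega)]
    constructor
    · omega
    · omega
  rw [hdiv] at h
  exact h

lemma sampleBatch_expert {t k : ℕ} (ht : t < T) (hk : k < K) :
    SampleBatch G Pr B (fun i => R.before (t * (K * B + b) + k * B + i))
      (fun i => R.after (t * (K * B + b) + k * B + i)) (fun _ => G.πE)
      (fun i => R.xE ((t * K + k) * B + i)) :=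
  ⟨fun _ => R.before_le_after _, fun _ => R.after_le_before _, fun _ => R.after_le _,
    stronglyMeasurable_const, fun _ => G.πE_mem, fun i hi p => R.xE_meas t ht k hk i hi p,
    fun i hi f => R.xE_law t ht k hk (i + 1) hi ((t * K + k) * B + i) rfl f⟩

/-- Error of the expert batch average of the `j`-th component of the reward gradient. -/
def expertErr (t k : ℕ) (j : Fin q) (ω : Ω) : ℝ :=
  1 / (B : ℝ) * ∑ i ∈ range B, G.gradReward (R.α t k ω) (R.xE ((t * K + k) * B + i) ω).1
    (R.xE ((t * K + k) * B + i) ω).2 j -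
    G.visitExp G.πE fun p => G.gradReward (R.α t k ω) p.1 p.2 j

/-- Error of the learner batch average of the `j`-th component of the reward gradient. -/
def learnerErr (t k : ℕ) (j : Fin q) (ω : Ω) : ℝ :=
  1 / (B : ℝ) * ∑ i ∈ range B, G.gradReward (R.α t k ω)
    (R.x (t * (K * B + b) + k * B + i) ω).1 (R.x (t * (K * B + b) + k * B + i) ω).2 j -
    G.visitExp (R.θ t ω) fun p => G.gradReward (R.α t k ω) p.1 p.2 j

/-- A bound for the error of the stochastic gradient in the reward parameter. -/
def rewardErr (t k : ℕ) (ω : Ω) : ℝ :=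
  1 / (1 - G.γ) * ∑ j, (|R.expertErr t k j ω| + |R.learnerErr t k j ω|)

/-- The stochastic gradient used in the reward update. -/
def rewardGrad (t k : ℕ) (ω : Ω) : EuclideanSpace ℝ (Fin q) :=
  G.gradAlphaEst B (fun i => R.xE ((t * K + k) * B + i) ω)
    (fun i => R.x (t * (K * B + b) + k * B + i) ω) (R.α t k ω)

/-- The `ψ` terms cancel. The Euclidean norm is bounded by the `ℓ¹` norm so that the scalar batch
estimate applies to each coordinate. -/
lemma norm_rewardGrad_sub_le (t k : ℕ) (ω : Ω) :
    ‖R.rewardGrad t k ω - G.gradF (R.θ t ω) (R.α t k ω)‖ ≤ R.rewardErr t k ω := by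
  have hγ : 0 < 1 / (1 - G.γ) := one_div_pos.2 (by linarith [G.γ_lt_one])
  refine (EuclideanSpace.norm_le_sum_abs _).trans ?_
  rw [rewardErr, mul_sum]
  refine sum_le_sum fun j _ => ?_
  have h : (R.rewardGrad t k ω - G.gradF (R.θ t ω) (R.α t k ω)) j =
      1 / (1 - G.γ) * (R.expertErr t k j ω - R.learnerErr t k j ω) := by
    simp only [rewardGrad, GAILProblem.gradAlphaEst, GAILProblem.gradF, PiLp.sub_apply,
      PiLp.smul_apply, smul_eq_mul, GAILProblem.visitGrad_apply, expertErr, learnerErr,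
      WithLp.ofLp_sum, Finset.sum_apply, sum_sub_distrib]
    rw [mul_comm (1 - G.γ) (B : ℝ), ← one_div_mul_one_div_rev]
    ring
  rw [h, abs_mul, abs_of_pos hγ]
  exact mul_le_mul_of_nonneg_left (abs_sub _ _) hγ.le

/-- Distance of the reward iterate to the best response. -/
def rewardDist (t k : ℕ) (ω : Ω) : ℝ := ‖R.α t k ω - G.bestReward (R.θ t ω)‖

/-- A bound for the error of the stochastic gradient in the policy. -/
def policyErr (t : ℕ) (ω : Ω) : ℝ :=
  ∑ s, ∑ a, |1 / (b : ℝ) * ∑ i ∈ range b,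
    (if (R.x (t * (K * B + b) + K * B + i) ω).1 = s then R.Qhat t i s a ω else 0) -
    G.visit (R.θ t ω) s * G.qFn (R.θ t ω) (G.r (R.α t K ω)) s a|

section

variable [IsProbabilityMeasure Pr] {μ Lψ CM ρ Cr Lr Cα Rmax ζmin : ℝ}
  (hG : G.Assumptions μ Lψ CM ρ Cr Lr Cα Rmax ζmin)
  (hμ : 0 < μ) (hCM : 0 < CM) (hρ₀ : 0 < ρ) (hρ₁ : ρ < 1) (hη₀ : 0 ≤ η) (hη₁ : η ≤ 1)
include hG hη₀ hη₁

omit [IsProbabilityMeasure Pr] in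
lemma rewardDist_le {t k : ℕ} (ht : t < T) (hk : k ≤ K) (ω : Ω) : R.rewardDist t k ω ≤ Cα :=
  hG.Λ_bounded _ (R.α_mem ht hk ω) _ (hG.bestReward_spec (R.θ_mem hη₀ hη₁ ht.le ω)).1

include hCM hρ₀ hρ₁

lemma integral_rewardErr_le (hB : 1 ≤ B) {t k : ℕ} (ht : t < T) (hk : k < K) :
    Integrable (R.rewardErr t k) Pr ∧ ∫ ω, R.rewardErr t k ω ∂Pr ≤
      8 * q * mixConst CM ρ * Cr / (1 - G.γ) / Real.sqrt B := by
  have hγ : 0 < 1 - G.γ := by linarith [G.γ_lt_one]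
  have hkB : k * B + B ≤ K * B := by rw [← Nat.succ_mul]; exact Nat.mul_le_mul_right _ hk
  have hm : ∀ (j : Fin q) (p : S × A), StronglyMeasurable[R.before (t * (K * B + b) + k * B + 0)]
      fun ω => G.gradReward (R.α t k ω) p.1 p.2 j := fun j p =>
    StronglyMeasurable.comp_continuousOn (R.α_meas t ht k hk.le) (R.α_mem ht hk.le)
      (hG.continuousOn_gradReward_apply p.1 p.2 j)
  have hE := fun j => (R.sampleBatch_expert ht hk).integral_abs_avg_sub_le hCM hρ₀ hρ₁ hB
    (fun _ => hG.mixes G.πE_mem) (hm j) hG.Cr_nonneg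
    fun ω p => hG.abs_gradReward_apply_le (R.α_mem ht hk.le ω) p.1 p.2 j
  have hL := fun j => (R.sampleBatch hη₀ hη₁ (o := t * (K * B + b) + k * B) (L := B) ht
    (by omega) (by omega)).integral_abs_avg_sub_le hCM hρ₀ hρ₁ hB
    (fun ω => hG.mixes (R.θ_mem hη₀ hη₁ ht.le ω)) (hm j) hG.Cr_nonneg
    fun ω p => hG.abs_gradReward_apply_le (R.α_mem ht hk.le ω) p.1 p.2 j
  have hEI : ∀ j, Integrable (R.expertErr t k j) Pr := fun j => (hE j).1
  have hLI : ∀ j, Integrable (R.learnerErr t k j) Pr := fun j => (hL j).1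
  have hI : ∀ j ∈ univ, Integrable (fun ω => |R.expertErr t k j ω| + |R.learnerErr t k j ω|) Pr :=
    fun j _ => (hEI j).abs.add (hLI j).abs
  refine ⟨(integrable_finsetSum _ hI).const_mul _, ?_⟩
  simp only [rewardErr]
  rw [integral_const_mul, integral_finsetSum _ hI]
  calc _ ≤ 1 / (1 - G.γ) * ∑ _j : Fin q, (4 * mixConst CM ρ * Cr / Real.sqrt B +
          4 * mixConst CM ρ * Cr / Real.sqrt B) := by
        gcongr with j
        rw [integral_add (hEI j).abs (hLI j).abs]
        exact add_le_add (hE j).2 (hL j).2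
    _ = _ := by
        rw [sum_const, card_univ, Fintype.card_fin, nsmul_eq_mul]
        ring

lemma integral_policyErr_le (hb : 1 ≤ b) {t : ℕ} (ht : t < T) :
    Integrable (R.policyErr t) Pr ∧ ∫ ω, R.policyErr t ω ∂Pr ≤
      Fintype.card S * Fintype.card A * (8 * mixConst CM ρ * Rmax / (1 - G.γ) / Real.sqrt b) := by
  have hQ := fun s a => (R.sampleBatch hη₀ hη₁ (o := t * (K * B + b) + K * B) (L := b) ht
    (by omega) (by omega)).integral_abs_estQ_sub_le (rew := fun ω => G.r (R.α t K ω))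
    (Q := fun i => R.Qhat t i s a) (s := s) (a := a) hCM hρ₀ hρ₁ hb
    (fun ω => hG.mixes (R.θ_mem hη₀ hη₁ ht.le ω)) hG.Rmax_nonneg
    (fun s a => StronglyMeasurable.comp_continuousOn (R.α_meas t ht K le_rfl) (R.α_mem ht le_rfl)
      (hG.continuousOn_reward s a))
    (fun ω s a => hG.r_bounded _ (R.α_mem ht le_rfl ω) s a)
    (fun i hi => R.Qhat_meas t ht i hi s a) (fun i hi φ hφ hφb => R.Qhat_law t ht i hi s a φ hφ hφb)
  have hI := fun s a => (hQ s a).1.abs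
  refine ⟨integrable_finsetSum _ fun s _ => integrable_finsetSum _ fun a _ => hI s a, ?_⟩
  simp only [policyErr]
  rw [integral_finsetSum _ fun s _ => integrable_finsetSum _ fun a _ => hI s a]
  calc _ ≤ ∑ _s : S, ∑ _a : A, 8 * mixConst CM ρ * Rmax / (1 - G.γ) / Real.sqrt b := by
        refine sum_le_sum fun s _ => ?_
        rw [integral_finsetSum _ fun a _ => hI s a]
        exact sum_le_sum fun a _ => (hQ s a).2
    _ = _ := by
        simp only [sum_const, card_univ, nsmul_eq_mul]
        ring

include hμ

lemma integrable_rewardDist {t k : ℕ} (ht : t < T) (hk : k ≤ K) :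
    Integrable (R.rewardDist t k) Pr := by
  have h1 : StronglyMeasurable[mΩ] fun ω => G.bestReward (R.θ t ω) :=
    StronglyMeasurable.comp_continuousOn ((R.θ_meas t ht).mono (R.before_le _))
      (R.θ_mem hη₀ hη₁ ht.le) (hG.continuousOn_bestReward hμ hCM hρ₀ hρ₁)
  refine integrable_of_abs_le ((((R.α_meas t ht k hk).mono (R.before_le _)).sub h1).norm)
    (H := Cα) fun ω => ?_
  rw [abs_of_nonneg (show 0 ≤ R.rewardDist t k ω from norm_nonneg _)]
  exact R.rewardDist_le hG hη₀ hη₁ ht hk ω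

-- Nonexpansiveness compares the update with the exact fixed point of the projected ascent map,
-- where `β` times the gradient is normal to `Λ`. The exact part contracts, and the noise enters
-- with weight `β`.
omit hCM hρ₀ hρ₁ in
omit [IsProbabilityMeasure Pr] in
lemma rewardDist_succ_le (hβ : β = μ / (4 * L22 q G.γ Lr Lψ ^ 2)) {t k : ℕ} (ht : t < T)
    (hk : k < K) (ω : Ω) :
    R.rewardDist t (k + 1) ω ≤ (1 - 7 / 32 * (μ ^ 2 / L22 q G.γ Lr Lψ ^ 2)) * R.rewardDist t k ω +
      β * R.rewardErr t k ω := by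
  have hβ0 : 0 ≤ β := by rw [hβ]; positivity
  have hθ := R.θ_mem hη₀ hη₁ ht.le ω
  have hα := R.α_mem ht hk.le ω
  have hs := (hG.bestReward_spec hθ).1
  have h1 := (R.α_step t ht k hk ω).norm_sub_le hG.convex hs
    (w := β • G.gradF (R.θ t ω) (G.bestReward (R.θ t ω))) fun z hz => by
      rw [real_inner_smul_left]
      exact mul_nonpos_of_nonneg_of_nonpos hβ0 (hG.inner_gradF_bestReward_le hθ hz)
  have h2 : ‖R.α t k ω - G.bestReward (R.θ t ω) + β • (G.gradF (R.θ t ω) (R.α t k ω) -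
      G.gradF (R.θ t ω) (G.bestReward (R.θ t ω)))‖ ≤
      (1 - 7 / 32 * (μ ^ 2 / L22 q G.γ Lr Lψ ^ 2)) * R.rewardDist t k ω := by
    -- The comparison with `L22` requires two distinct points.
    rcases eq_or_ne (R.α t k ω) (G.bestReward (R.θ t ω)) with h | h
    · simp [rewardDist, h]
    · have h3 := norm_add_smul_le_of_inner_le hμ (hG.inner_gradF_sub_le hθ hα hs)
        ((hG.norm_gradF_sub_le hθ hα hs).trans
          (mul_le_mul_of_nonneg_right (hG.le_L22_of_ne hα hs h) (norm_nonneg _)))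
      rw [← hβ] at h3
      exact h3
  refine h1.trans ?_
  have h3 : R.α t k ω + β • R.rewardGrad t k ω - G.bestReward (R.θ t ω) -
      β • G.gradF (R.θ t ω) (G.bestReward (R.θ t ω)) =
      (R.α t k ω - G.bestReward (R.θ t ω) + β • (G.gradF (R.θ t ω) (R.α t k ω) -
      G.gradF (R.θ t ω) (G.bestReward (R.θ t ω)))) +
      β • (R.rewardGrad t k ω - G.gradF (R.θ t ω) (R.α t k ω)) := by
    simp only [smul_sub]; abel
  change ‖R.α t k ω + β • R.rewardGrad t k ω - G.bestReward (R.θ t ω) -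
      β • G.gradF (R.θ t ω) (G.bestReward (R.θ t ω))‖ ≤ _
  rw [h3]
  refine (norm_add_le _ _).trans (add_le_add h2 ?_)
  rw [norm_smul, Real.norm_of_nonneg hβ0]
  exact mul_le_mul_of_nonneg_left (R.norm_rewardGrad_sub_le t k ω) hβ0

lemma integral_rewardDist_le (hβ : β = μ / (4 * L22 q G.γ Lr Lψ ^ 2)) (hB : 1 ≤ B) {t : ℕ}
    (ht : t < T) :
    ∫ ω, R.rewardDist t K ω ∂Pr ≤
      Cα * Real.exp (-(7 / 32 * (μ / (2 * Real.sqrt q * |Lr| + |Lψ| + 1)) ^ 2) *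
        (1 - G.γ) ^ 2 * K) +
      10 * q * mixConst CM ρ * Cr / μ * (1 / ((1 - G.γ) * Real.sqrt B)) := by
  have hγ : 0 < 1 - G.γ := by linarith [G.γ_lt_one]
  have hKm := one_le_mixConst hCM hρ₁
  have hCr := hG.Cr_nonneg
  have hCα := hG.Cα_nonneg
  -- If `Λ` is a single point the distance is zero, and nothing is known about `L22`.
  by_cases hsub : ∃ x ∈ G.Λ, ∃ y ∈ G.Λ, x ≠ y
  swap
  · push Not at hsub
    have h0 : ∀ ω, R.rewardDist t K ω = 0 := fun ω => by
      rw [rewardDist, hsub _ (R.α_mem ht le_rfl ω) _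
        (hG.bestReward_spec (R.θ_mem hη₀ hη₁ ht.le ω)).1, sub_self, norm_zero]
    simp only [h0, integral_zero]
    positivity
  obtain ⟨x, hx, y, hy, hxy⟩ := hsub
  set L := L22 q G.γ Lr Lψ with hL
  have hμL : μ ≤ L := by
    have hn : 0 < ‖x - y‖ := norm_pos_iff.2 (sub_ne_zero.2 hxy)
    have h1 := hG.inner_gradF_sub_le G.πE_mem hx hy
    have h2 := abs_real_inner_le_norm (G.gradF G.πE x - G.gradF G.πE y) (x - y)
    have h3 := (abs_le.1 h2).1
    have h4 := (hG.norm_gradF_sub_le G.πE_mem hx hy).trans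
      (mul_le_mul_of_nonneg_right (hG.le_L22_of_ne hx hy hxy) hn.le)
    have h5 : μ * ‖x - y‖ ^ 2 ≤ L * ‖x - y‖ ^ 2 := by nlinarith
    exact le_of_mul_le_mul_right h5 (by positivity)
  have hL0 : 0 < L := hμ.trans_le hμL
  have hx0 : 0 < μ ^ 2 / L ^ 2 := by positivity
  have hx1 : μ ^ 2 / L ^ 2 ≤ 1 := (div_le_one (by positivity)).2 (by gcongr)
  set κ := 1 - 7 / 32 * (μ ^ 2 / L ^ 2) with hκ
  have hκ0 : 0 ≤ κ := by rw [hκ]; linarith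
  have hβ0 : 0 ≤ β := by rw [hβ]; positivity
  set ε := 8 * q * mixConst CM ρ * Cr / (1 - G.γ) / Real.sqrt B with hε
  have hε0 : 0 ≤ ε := by positivity
  -- The recursion `E (k+1) ≤ κ * E k + β * ε` has fixed point `β * ε / (1 - κ)`, and `β / (1 - κ) =
  -- 8 / (7 μ)`: the powers of `L22` cancel.
  have hrec : ∀ k ≤ K, ∫ ω, R.rewardDist t k ω ∂Pr ≤ κ ^ k * Cα + 8 / (7 * μ) * ε := by
    intro k hk
    induction k with
    | zero =>
      have h1 : ∫ ω, R.rewardDist t 0 ω ∂Pr ≤ ∫ _ω, Cα ∂Pr :=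
        integral_mono (R.integrable_rewardDist hG hμ hCM hρ₀ hρ₁ hη₀ hη₁ ht hk)
          (integrable_const _) fun ω => R.rewardDist_le hG hη₀ hη₁ ht hk ω
      rw [integral_const, probReal_univ, one_smul] at h1
      rw [pow_zero, one_mul]
      have : 0 ≤ 8 / (7 * μ) * ε := by positivity
      linarith
    | succ k ih =>
      have hI := R.integrable_rewardDist (k := k) hG hμ hCM hρ₀ hρ₁ hη₀ hη₁ ht (by omega)
      obtain ⟨hEI, hE⟩ := R.integral_rewardErr_le hG hCM hρ₀ hρ₁ hη₀ hη₁ hB ht hk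
      have h1 : ∫ ω, R.rewardDist t (k + 1) ω ∂Pr ≤
          ∫ ω, (κ * R.rewardDist t k ω + β * R.rewardErr t k ω) ∂Pr :=
        integral_mono (R.integrable_rewardDist hG hμ hCM hρ₀ hρ₁ hη₀ hη₁ ht hk)
          ((hI.const_mul _).add (hEI.const_mul _))
          fun ω => R.rewardDist_succ_le hG hμ hη₀ hη₁ hβ ht hk ω
      rw [integral_add (hI.const_mul _) (hEI.const_mul _), integral_const_mul,
        integral_const_mul] at h1
      have h2 := mul_le_mul_of_nonneg_left (ih (by omega)) hκ0
      have h3 := mul_le_mul_of_nonneg_left hE hβ0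
      have h4 : κ * (κ ^ k * Cα + 8 / (7 * μ) * ε) + β * ε =
          κ ^ (k + 1) * Cα + 8 / (7 * μ) * ε := by
        have hβκ : β = 8 / (7 * μ) * (1 - κ) := by rw [hβ, hκ]; field_simp; ring
        rw [hβκ, pow_succ]; ring
      linarith
  refine (hrec K le_rfl).trans (add_le_add ?_ ?_)
  · rw [mul_comm]
    refine mul_le_mul_of_nonneg_left ?_ hCα
    have h1 : κ ≤ Real.exp (-(7 / 32 * (μ ^ 2 / L ^ 2))) := by
      have := Real.add_one_le_exp (-(7 / 32 * (μ ^ 2 / L ^ 2)))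
      rw [hκ]; linarith
    refine (pow_le_pow_left₀ hκ0 h1 K).trans ?_
    rw [← Real.exp_nat_mul, Real.exp_le_exp]
    -- A constant free of `γ` with `L22 ≤ L0 / (1 - γ)`. Absolute values are taken because no signs
    -- are assumed, and `+ 1` keeps it positive.
    set L0 := 2 * Real.sqrt q * |Lr| + |Lψ| + 1 with hL0def
    have hL0pos : 0 < L0 := by positivity
    have h2 : L ≤ L0 / (1 - G.γ) := by
      rw [hL, L22, le_div_iff₀ hγ, add_mul, div_mul_cancel₀ _ hγ.ne', hL0def]
      have e1 : 2 * Real.sqrt q * Lr ≤ 2 * Real.sqrt q * |Lr| := by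
        gcongr; exact le_abs_self _
      have e2 : Lψ * (1 - G.γ) ≤ |Lψ| * 1 := by
        gcongr
        · exact le_abs_self _
        · linarith [G.γ_pos]
      linarith
    have h3 : (μ / L0) ^ 2 * (1 - G.γ) ^ 2 ≤ μ ^ 2 / L ^ 2 := by
      have : (μ / L0) ^ 2 * (1 - G.γ) ^ 2 = μ ^ 2 / (L0 / (1 - G.γ)) ^ 2 := by
        field_simp
      rw [this]
      gcongr
    have h4 : (0 : ℝ) ≤ K := Nat.cast_nonneg K
    nlinarith
  · rw [hε]
    have : 8 / (7 * μ) * (8 * q * mixConst CM ρ * Cr / (1 - G.γ) / Real.sqrt B) =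
        64 / 7 * q * mixConst CM ρ * Cr / μ * (1 / ((1 - G.γ) * Real.sqrt B)) := by
      field_simp; ring
    rw [this]
    gcongr
    norm_num

end

end FWPGRun

/-! ### Summation over the outer iterations. -/

namespace FWPGRun

variable {S A : Type*} [Fintype S] [Fintype A] [DecidableEq S] {q : ℕ}
  {G : GAILProblem S A q} {η β : ℝ} {T K B b : ℕ} {Ω : Type*} [mΩ : MeasurableSpace Ω]
  {Pr : Measure Ω} [IsProbabilityMeasure Pr] (R : FWPGRun G η β T K B b Pr)
  {μ Lψ CM ρ Cr Lr Cα Rmax ζmin : ℝ} (hG : G.Assumptions μ Lψ CM ρ Cr Lr Cα Rmax ζmin)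
include hG

lemma integrable_g (hρ₀ : 0 < ρ) (hρ₁ : ρ < 1) (hη₀ : 0 ≤ η) (hη₁ : η ≤ 1) {t : ℕ} (ht : t < T) :
    Integrable (fun ω => G.g (R.θ t ω)) Pr := by
  have hm : StronglyMeasurable[mΩ] fun ω => G.g (R.θ t ω) :=
    StronglyMeasurable.comp_continuousOn ((R.θ_meas t ht).mono (R.before_le _))
      (R.θ_mem hη₀ hη₁ ht.le) (hG.continuousOn_g hρ₀ hρ₁)
  refine integrable_of_abs_le hm (H := |G.g G.πE| + 2 * Rmax / (1 - G.γ)) fun ω => ?_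
  have h1 := hG.g_sub_g_le_const (R.θ_mem hη₀ hη₁ ht.le ω) G.πE_mem
  have h2 := hG.g_sub_g_le_const G.πE_mem (R.θ_mem hη₀ hη₁ ht.le ω)
  have h3 := le_abs_self (G.g G.πE)
  have h4 := neg_abs_le (G.g G.πE)
  rw [abs_le]
  constructor <;> linarith

-- The algorithm's direction maximizes against `J / (1 - γ)`, where `J` estimates visitation times
-- `qFn`. The positive factor does not affect the maximizers, so the Frank–Wolfe step applies with
-- `J`.
omit [IsProbabilityMeasure Pr] in
lemma g_step_le (hμ : 0 < μ) (hζ : 0 < ζmin) (hCM : 0 < CM) (hρ₀ : 0 < ρ) (hρ₁ : ρ < 1)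
    (hη₀ : 0 < η) (hη₁ : η ≤ 1) (hb : 1 ≤ b) {θs : S → A → ℝ}
    (hθs : θs ∈ policySimplex S A) {t : ℕ} (ht : t < T) (ω : Ω) :
    (1 - G.γ) ^ 2 * ζmin * (G.g (R.θ t ω) - G.g θs) ≤
      (1 - G.γ) / η * (G.g (R.θ t ω) - G.g (R.θ (t + 1) ω)) + R.policyErr t ω +
      (2 * mixConst CM ρ * Cr * (1 + Fintype.card S * ζmin)) * R.rewardDist t K ω +
      4 * Fintype.card S * mixConst CM ρ ^ 2 * (Cr ^ 2 / μ + Rmax) * (η / (1 - G.γ)) := by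
  have hγ : 0 < 1 - G.γ := by linarith [G.γ_lt_one]
  have hb0 : (0 : ℝ) < b := by exact_mod_cast hb
  rw [R.θ_step t ht ω]
  refine hG.frankWolfe_step hμ hζ hρ₀ hρ₁ hCM (R.θ_mem hη₀.le hη₁ ht.le ω) hθs
    (R.α_mem ht le_rfl ω) (R.v_mem t ht ω) (J := fun s a => 1 / (b : ℝ) * ∑ i ∈ range b,
    (if (R.x (t * (K * B + b) + K * B + i) ω).1 = s then R.Qhat t i s a ω else 0))
    (fun π hπ => ?_) hη₀ hη₁
  have h := R.v_max t ht ω hπ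
  have heq : ∀ π : S → A → ℝ, ∑ s, ∑ a, π s a * (1 / (b : ℝ) * ∑ i ∈ range b,
      (if (R.x (t * (K * B + b) + K * B + i) ω).1 = s then R.Qhat t i s a ω else 0)) =
      (1 - G.γ) * ∑ s, ∑ a, π s a *
      (-(G.gradThetaEst b (fun i => R.x (t * (K * B + b) + K * B + i) ω)
        (fun i s a => R.Qhat t i s a ω) s a)) := fun π => by
    simp only [mul_sum (a := 1 - G.γ), GAILProblem.gradThetaEst]
    refine sum_congr rfl fun s _ => sum_congr rfl fun a _ => ?_
    field_simp
  rw [heq, heq]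
  exact mul_le_mul_of_nonneg_left h hγ.le

/-- The convergence bound with explicit constants, before normalization. -/
lemma avgValue_sub_le (hμ : 0 < μ) (hζ : 0 < ζmin) (hCM : 0 < CM) (hρ₀ : 0 < ρ) (hρ₁ : ρ < 1)
    (hT : 1 ≤ T) (hB : 1 ≤ B) (hb : 1 ≤ b)
    (hη : η = (1 - G.γ) / Real.sqrt T) (hβ : β = μ / (4 * L22 q G.γ Lr Lψ ^ 2))
    {θs : S → A → ℝ} (hθs : θs ∈ policySimplex S A) :
    (1 - G.γ) ^ 2 * ζmin * (R.avgValue - G.g θs) ≤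
      2 * Rmax * (1 / ((1 - G.γ) * Real.sqrt T)) +
      Fintype.card S * Fintype.card A * 8 * mixConst CM ρ * Rmax * (1 / ((1 - G.γ) * Real.sqrt b)) +
      (2 * mixConst CM ρ * Cr * (1 + Fintype.card S * ζmin)) *
        (Cα * Real.exp (-(7 / 32 * (μ / (2 * Real.sqrt q * |Lr| + |Lψ| + 1)) ^ 2) *
          (1 - G.γ) ^ 2 * K) +
        10 * q * mixConst CM ρ * Cr / μ * (1 / ((1 - G.γ) * Real.sqrt B))) +
      4 * Fintype.card S * mixConst CM ρ ^ 2 * (Cr ^ 2 / μ + Rmax) * (1 / Real.sqrt T) := by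
  have hγ : 0 < 1 - G.γ := by linarith [G.γ_lt_one]
  have hT0 : (0 : ℝ) < T := by exact_mod_cast hT
  have hsT : 0 < Real.sqrt T := Real.sqrt_pos.2 hT0
  have hsT1 : 1 ≤ Real.sqrt T := by
    rw [Real.one_le_sqrt]; exact_mod_cast hT
  have hη₀ : 0 < η := by rw [hη]; positivity
  have hη₁ : η ≤ 1 := by
    rw [hη, div_le_one hsT]; linarith [G.γ_pos]
  have hK := one_le_mixConst hCM hρ₁
  have hCr := hG.Cr_nonneg
  have e1 : (1 - G.γ) / η = Real.sqrt T := by rw [hη]; field_simp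
  have e2 : η / (1 - G.γ) = 1 / Real.sqrt T := by rw [hη]; field_simp
  set C₁ := 2 * mixConst CM ρ * Cr * (1 + Fintype.card S * ζmin) with hC₁
  have hC₁0 : 0 ≤ C₁ := by positivity
  set C₂ := 4 * Fintype.card S * mixConst CM ρ ^ 2 * (Cr ^ 2 / μ + Rmax) with hC₂
  set D := Cα * Real.exp (-(7 / 32 * (μ / (2 * Real.sqrt q * |Lr| + |Lψ| + 1)) ^ 2) *
          (1 - G.γ) ^ 2 * K) +
        10 * q * mixConst CM ρ * Cr / μ * (1 / ((1 - G.γ) * Real.sqrt B)) with hD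
  have hgI := fun t (ht : t ∈ range T) =>
    R.integrable_g hG hρ₀ hρ₁ hη₀.le hη₁ (mem_range.1 ht)
  have hP := fun t (ht : t ∈ range T) =>
    R.integral_policyErr_le hG hCM hρ₀ hρ₁ hη₀.le hη₁ hb (mem_range.1 ht)
  have hDI := fun t (ht : t ∈ range T) =>
    R.integrable_rewardDist hG hμ hCM hρ₀ hρ₁ hη₀.le hη₁ (mem_range.1 ht) (le_refl K)
  have hDE := fun t (ht : t ∈ range T) =>
    R.integral_rewardDist_le hG hμ hCM hρ₀ hρ₁ hη₀.le hη₁ hβ hB (mem_range.1 ht)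
  -- summation along the run
  have hpath : ∀ ω, (1 - G.γ) ^ 2 * ζmin * (∑ t ∈ range T, G.g (R.θ t ω) - T * G.g θs) ≤
      Real.sqrt T * (2 * Rmax / (1 - G.γ)) + ∑ t ∈ range T, (R.policyErr t ω +
        C₁ * R.rewardDist t K ω) + T * (C₂ * (1 / Real.sqrt T)) := fun ω => by
    have h1 := sum_le_sum fun t (ht : t ∈ range T) =>
      R.g_step_le hG hμ hζ hCM hρ₀ hρ₁ hη₀ hη₁ hb hθs (mem_range.1 ht) ω
    simp only [e1, e2, ← hC₁, ← hC₂] at h1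
    simp only [sum_add_distrib, ← mul_sum, sum_sub_distrib, sum_const, card_range,
      nsmul_eq_mul] at h1 ⊢
    rw [← sum_sub_distrib, sum_range_sub' (fun t => G.g (R.θ t ω))] at h1
    -- The telescoped difference is bounded pathwise, before integration, so no measurability of the
    -- final iterate `θ T` is required.
    have h2 := mul_le_mul_of_nonneg_left (hG.g_sub_g_le_const (R.θ_mem hη₀.le hη₁ (Nat.zero_le T) ω)
      (R.θ_mem hη₀.le hη₁ le_rfl ω)) hsT.le
    linarith
  have hI1 : Integrable (fun ω => ∑ t ∈ range T, G.g (R.θ t ω)) Pr := integrable_finsetSum _ hgI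
  have hI4 : ∀ t ∈ range T, Integrable (fun ω => R.policyErr t ω + C₁ * R.rewardDist t K ω) Pr :=
    fun t ht => (hP t ht).1.add ((hDI t ht).const_mul _)
  have hI2 : Integrable (fun ω => ∑ t ∈ range T, (R.policyErr t ω + C₁ * R.rewardDist t K ω)) Pr :=
    integrable_finsetSum _ hI4
  have hint := integral_mono (μ := Pr) ((hI1.sub (integrable_const (T * G.g θs))).const_mul
    ((1 - G.γ) ^ 2 * ζmin)) (((integrable_const (Real.sqrt T * (2 * Rmax / (1 - G.γ)))).add hI2).add
    (integrable_const (T * (C₂ * (1 / Real.sqrt T))))) hpath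
  have hl : ∫ ω, (1 - G.γ) ^ 2 * ζmin * (∑ t ∈ range T, G.g (R.θ t ω) - T * G.g θs) ∂Pr =
      (1 - G.γ) ^ 2 * ζmin * (T * (R.avgValue - G.g θs)) := by
    rw [integral_const_mul, integral_sub hI1 (integrable_const _), integral_finsetSum _ hgI,
      integral_const, probReal_univ, one_smul, avgValue]
    field_simp
  have hr : ∫ ω, (Real.sqrt T * (2 * Rmax / (1 - G.γ)) + ∑ t ∈ range T, (R.policyErr t ω +
        C₁ * R.rewardDist t K ω) + T * (C₂ * (1 / Real.sqrt T))) ∂Pr ≤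
      Real.sqrt T * (2 * Rmax / (1 - G.γ)) + T * (Fintype.card S * Fintype.card A *
        (8 * mixConst CM ρ * Rmax / (1 - G.γ) / Real.sqrt b) + C₁ * D) +
        T * (C₂ * (1 / Real.sqrt T)) := by
    have hI3 : Integrable (fun ω => Real.sqrt T * (2 * Rmax / (1 - G.γ)) +
        ∑ t ∈ range T, (R.policyErr t ω + C₁ * R.rewardDist t K ω)) Pr :=
      (integrable_const _).add hI2
    rw [integral_add hI3 (integrable_const _), integral_add (integrable_const _) hI2,
      integral_finsetSum _ hI4]
    simp only [integral_const, probReal_univ, one_smul]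
    gcongr
    calc _ ≤ ∑ _t ∈ range T, (Fintype.card S * Fintype.card A *
          (8 * mixConst CM ρ * Rmax / (1 - G.γ) / Real.sqrt b) + C₁ * D) := by
          refine sum_le_sum fun t ht => ?_
          rw [integral_add (hP t ht).1 ((hDI t ht).const_mul _), integral_const_mul]
          exact add_le_add (hP t ht).2 (mul_le_mul_of_nonneg_left (hDE t ht) hC₁0)
      _ = _ := by rw [sum_const, card_range, nsmul_eq_mul]
  have hfin := hl.symm.le.trans (hint.trans hr)
  have e3 : Real.sqrt T * (2 * Rmax / (1 - G.γ)) =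
      T * (2 * Rmax * (1 / ((1 - G.γ) * Real.sqrt T))) := by
    have h1 : (T : ℝ) * (2 * Rmax * (1 / ((1 - G.γ) * Real.sqrt T))) =
        T / Real.sqrt T * (2 * Rmax / (1 - G.γ)) := by
      field_simp
    rw [h1, Real.div_sqrt]
  have e4 : (Fintype.card S * Fintype.card A *
      (8 * mixConst CM ρ * Rmax / (1 - G.γ) / Real.sqrt b)) = Fintype.card S * Fintype.card A * 8 *
      mixConst CM ρ * Rmax * (1 / ((1 - G.γ) * Real.sqrt b)) := by
    field_simp
  rw [e3, e4] at hfin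
  refine le_of_mul_le_mul_left ?_ hT0
  refine le_trans (le_of_eq ?_) (hfin.trans (le_of_eq ?_)) <;> ring

end FWPGRun

/-! ### Normalization of constants and choice of parameters. -/

lemma le_of_scaled_le {X y ζ R Cα C₁ C₂ C₃ C₄ E p r s : ℝ} (hy : 0 < y) (hy1 : y ≤ 1)
    (hζ : 0 < ζ) (hR : 0 ≤ R) (hCα : 0 ≤ Cα) (hC₁ : 0 ≤ C₁) (hC₂ : 0 ≤ C₂) (hC₃ : 0 ≤ C₃)
    (hC₄ : 0 ≤ C₄) (hE : 0 ≤ E) (hp : 0 < p) (hr : 0 < r) (hs : 0 < s)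
    (h : y ^ 2 * ζ * X ≤ 2 * R * (1 / (y * p)) + C₃ * (1 / (y * s)) +
      C₁ * (Cα * E + C₄ * (1 / (y * r))) + C₂ * (1 / p)) :
    X ≤ ((2 * R + C₂ + C₃ + C₁ * Cα + C₁ * C₄) / ζ + 1) *
      (1 / (y ^ 3 * p) + 1 / y ^ 2 * E + 1 / (y ^ 3 * r) + 1 / (y ^ 3 * s)) := by
  refine le_of_mul_le_mul_left (h.trans ?_) (show 0 < y ^ 2 * ζ by positivity)
  have hp1 : 1 / p ≤ 1 / (y * p) :=
    one_div_le_one_div_of_le (by positivity) (mul_le_of_le_one_left hp.le hy1)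
  -- The summand `+ 1` in the constant only serves to make it positive; after scaling it becomes the
  -- slack `ζ` times the sum of the four error terms.
  have e : y ^ 2 * ζ * (((2 * R + C₂ + C₃ + C₁ * Cα + C₁ * C₄) / ζ + 1) *
      (1 / (y ^ 3 * p) + 1 / y ^ 2 * E + 1 / (y ^ 3 * r) + 1 / (y ^ 3 * s))) =
      (2 * R + C₂ + C₃ + C₁ * Cα + C₁ * C₄ + ζ) * (1 / (y * p) + E + 1 / (y * r) + 1 / (y * s)) := by
    field_simp
  have h₁ : 0 ≤ 1 / (y * p) := by positivity
  have h₂ : 0 ≤ 1 / (y * r) := by positivity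
  have h₃ : 0 ≤ 1 / (y * s) := by positivity
  rw [e]
  set a₁ := 1 / (y * p)
  set a₂ := 1 / (y * r)
  set a₃ := 1 / (y * s)
  obtain ⟨z, hz⟩ : ∃ z, z = a₁ + E + a₂ + a₃ := ⟨_, rfl⟩
  rw [← hz]
  have m₁ : 2 * R * a₁ ≤ 2 * R * z := by gcongr; linarith
  have m₂ : C₂ * (1 / p) ≤ C₂ * z := by gcongr; linarith
  have m₃ : C₃ * a₃ ≤ C₃ * z := by gcongr; linarith
  have m₄ : C₁ * Cα * E ≤ C₁ * Cα * z := by gcongr; linarith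
  have m₅ : C₁ * C₄ * a₂ ≤ C₁ * C₄ * z := by gcongr; linarith
  have m₆ : 0 ≤ ζ * z := by rw [hz]; positivity
  linarith

/-- The convergence theorem of FWPG-GAIL, with constants that are uniform over all problems. -/
theorem fwpg_convergence {S : Type u} {A : Type v} [Fintype S] [Fintype A] [DecidableEq S] (q : ℕ)
    (μ Lψ CM ρ Cr Lr Cα Rmax ζmin : ℝ)
    (hμ : 0 < μ) (hCM : 0 < CM) (hρ₀ : 0 < ρ) (hρ₁ : ρ < 1) (hζ : 0 < ζmin) :
    ∃ C c : ℝ, 0 < C ∧ 0 < c ∧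
      ∀ G : GAILProblem S A q, G.Assumptions μ Lψ CM ρ Cr Lr Cα Rmax ζmin →
      ∀ T K B b : ℕ, 1 ≤ T → 1 ≤ K → 1 ≤ B → 1 ≤ b →
      ∀ (Ω : Type w) [MeasurableSpace Ω] (Pr : Measure Ω) [IsProbabilityMeasure Pr]
        (R : FWPGRun G ((1 - G.γ) / Real.sqrt T) (μ / (4 * L22 q G.γ Lr Lψ ^ 2)) T K B b Pr),
      (∀ t < T, Integrable (fun ω => G.g (R.θ t ω)) Pr) ∧
      ∀ θs ∈ policySimplex S A, IsMinOn G.g (policySimplex S A) θs →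
        R.avgValue - G.g θs ≤
          C * (1 / ((1 - G.γ) ^ 3 * Real.sqrt T)
            + 1 / (1 - G.γ) ^ 2 * Real.exp (-c * (1 - G.γ) ^ 2 * K)
            + 1 / ((1 - G.γ) ^ 3 * Real.sqrt B)
            + 1 / ((1 - G.γ) ^ 3 * Real.sqrt b)) := by
  -- The constants must be fixed before the problem, yet their positivity uses that `Cr`, `Cα` and
  -- `Rmax` are nonnegative. Any one admissible problem shows this; if there is none, the claim is
  -- vacuous.
  by_cases hex : ∃ G : GAILProblem S A q, G.Assumptions μ Lψ CM ρ Cr Lr Cα Rmax ζmin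
  swap
  · push Not at hex
    exact ⟨1, 1, one_pos, one_pos, fun G hG => absurd hG (hex G)⟩
  obtain ⟨G₀, hG₀⟩ := hex
  have hK := one_le_mixConst hCM hρ₁
  have hCr := hG₀.Cr_nonneg
  have hCα := hG₀.Cα_nonneg
  have hRmax := hG₀.Rmax_nonneg
  obtain ⟨C₁, hC₁⟩ : ∃ x, x = 2 * mixConst CM ρ * Cr * (1 + Fintype.card S * ζmin) := ⟨_, rfl⟩
  obtain ⟨C₂, hC₂⟩ : ∃ x, x = 4 * Fintype.card S * mixConst CM ρ ^ 2 * (Cr ^ 2 / μ + Rmax) :=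
    ⟨_, rfl⟩
  obtain ⟨C₃, hC₃⟩ : ∃ x, x = Fintype.card S * Fintype.card A * 8 * mixConst CM ρ * Rmax :=
    ⟨_, rfl⟩
  obtain ⟨C₄, hC₄⟩ : ∃ x, x = 10 * q * mixConst CM ρ * Cr / μ := ⟨_, rfl⟩
  have hC₁0 : 0 ≤ C₁ := by rw [hC₁]; positivity
  have hC₂0 : 0 ≤ C₂ := by rw [hC₂]; positivity
  have hC₃0 : 0 ≤ C₃ := by rw [hC₃]; positivity
  have hC₄0 : 0 ≤ C₄ := by rw [hC₄]; positivity
  refine ⟨(2 * Rmax + C₂ + C₃ + C₁ * Cα + C₁ * C₄) / ζmin + 1,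
    7 / 32 * (μ / (2 * Real.sqrt q * |Lr| + |Lψ| + 1)) ^ 2, by positivity, by positivity, ?_⟩
  intro G hG T K B b hT _ hB hb Ω _ Pr _ R
  have hγ : 0 < 1 - G.γ := by linarith [G.γ_lt_one]
  have hT0 : (0 : ℝ) < T := by exact_mod_cast hT
  have hsT : 0 < Real.sqrt T := Real.sqrt_pos.2 hT0
  have hsB : 0 < Real.sqrt B := Real.sqrt_pos.2 (by exact_mod_cast hB)
  have hsb : 0 < Real.sqrt b := Real.sqrt_pos.2 (by exact_mod_cast hb)
  have hη₀ : 0 ≤ (1 - G.γ) / Real.sqrt T := by positivity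
  have hη₁ : (1 - G.γ) / Real.sqrt T ≤ 1 := by
    have : 1 ≤ Real.sqrt T := by rw [Real.one_le_sqrt]; exact_mod_cast hT
    rw [div_le_one hsT]; linarith [G.γ_pos]
  refine ⟨fun t ht => R.integrable_g hG hρ₀ hρ₁ hη₀ hη₁ ht, fun θs hθs _ => ?_⟩
  have h := R.avgValue_sub_le hG hμ hζ hCM hρ₀ hρ₁ hT hB hb rfl rfl hθs
  rw [← hC₁, ← hC₂, ← hC₃, ← hC₄] at h
  exact le_of_scaled_le hγ (by linarith [G.γ_pos]) hζ hRmax hCα hC₁0 hC₂0 hC₃0 hC₄0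
    (Real.exp_pos _).le hsT hsB hsb h

/-- Choice of the parameters of FWPG-GAIL for accuracy `ε`. -/
theorem exists_parameters {C c y : ℝ} (hC : 0 < C) (hc : 0 < c) (hy : 0 < y) :
    ∃ D : ℝ, 0 < D ∧ ∀ ε : ℝ, 0 < ε → ε < 1 →
      ∃ N K : ℕ, 1 ≤ N ∧ 1 ≤ K ∧ (N : ℝ) ≤ D / ε ^ 2 ∧ (K : ℝ) ≤ D * (1 + Real.log (1 / ε)) ∧
        (N : ℝ) * (K * N + N) ≤ D / ε ^ 4 * (1 + Real.log (1 / ε)) ∧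
        C * (1 / (y ^ 3 * Real.sqrt N) + 1 / y ^ 2 * Real.exp (-c * y ^ 2 * K) +
          1 / (y ^ 3 * Real.sqrt N) + 1 / (y ^ 3 * Real.sqrt N)) ≤ ε := by
  obtain ⟨a, ha⟩ : ∃ x, x = 4 * C / y ^ 3 := ⟨_, rfl⟩
  obtain ⟨l, hl⟩ : ∃ x, x = |Real.log (4 * C / y ^ 2)| := ⟨_, rfl⟩
  obtain ⟨d, hd⟩ : ∃ x, x = (l + 1) / (c * y ^ 2) + 2 := ⟨_, rfl⟩
  have ha0 : 0 < a := by rw [ha]; positivity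
  have hl0 : 0 ≤ l := by rw [hl]; positivity
  have hd1 : 1 ≤ d := by
    have : 0 ≤ (l + 1) / (c * y ^ 2) := by positivity
    rw [hd]; linarith
  have ha1 : 1 ≤ a ^ 2 + 1 := by nlinarith
  refine ⟨(a ^ 2 + 1) ^ 2 * (d + 1), by positivity, fun ε hε₀ hε₁ => ?_⟩
  have hlog : 0 ≤ Real.log (1 / ε) := Real.log_nonneg (by rw [le_div_iff₀ hε₀]; linarith)
  obtain ⟨L, hL⟩ : ∃ x, x = Real.log (1 / ε) := ⟨_, rfl⟩
  rw [← hL] at hlog ⊢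
  -- With `√N ≥ a / ε`, each of the three sampling and step size terms is at most `ε / 4`. The
  -- choice of `K` below does the same for the exponential term.
  obtain ⟨N, hN⟩ : ∃ x, x = ⌈a ^ 2 / ε ^ 2⌉₊ := ⟨_, rfl⟩
  obtain ⟨K, hK⟩ : ∃ x, x = ⌈(l + L) / (c * y ^ 2)⌉₊ + 1 := ⟨_, rfl⟩
  have hN1 : 1 ≤ N := by rw [hN]; exact Nat.one_le_ceil_iff.2 (by positivity)
  have hN0 : (0 : ℝ) < N := by exact_mod_cast hN1
  have hNl : a ^ 2 / ε ^ 2 ≤ N := by rw [hN]; exact Nat.le_ceil _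
  have hNu : (N : ℝ) ≤ (a ^ 2 + 1) / ε ^ 2 := by
    have h1 : (N : ℝ) < a ^ 2 / ε ^ 2 + 1 := by rw [hN]; exact Nat.ceil_lt_add_one (by positivity)
    have h2 : 1 ≤ 1 / ε ^ 2 := by
      rw [le_div_iff₀ (by positivity), one_mul]; exact pow_le_one₀ hε₀.le hε₁.le
    rw [add_div]; linarith
  have hKl : (l + L) / (c * y ^ 2) ≤ K := by
    rw [hK]; push_cast
    linarith [Nat.le_ceil ((l + L) / (c * y ^ 2))]
  have hKu : (K : ℝ) ≤ d * (1 + L) := by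
    have h1 : (⌈(l + L) / (c * y ^ 2)⌉₊ : ℝ) < (l + L) / (c * y ^ 2) + 1 :=
      Nat.ceil_lt_add_one (by positivity)
    have h2 : (l + L) / (c * y ^ 2) ≤ (l + 1) / (c * y ^ 2) * (1 + L) := by
      rw [div_mul_eq_mul_div]
      gcongr
      nlinarith
    rw [hK, hd]; push_cast
    nlinarith
  have hsN : a / ε ≤ Real.sqrt N := by
    refine Real.le_sqrt_of_sq_le ?_
    rw [div_pow]; exact hNl
  have hbig : ∀ {z : ℝ}, 0 ≤ z → z ≤ (a ^ 2 + 1) ^ 2 * z := fun hz =>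
    le_mul_of_one_le_left hz (one_le_pow₀ ha1)
  refine ⟨N, K, hN1, by omega, hNu.trans ?_, hKu.trans ?_, ?_, ?_⟩
  · gcongr
    nlinarith
  · rw [mul_assoc]
    exact (mul_le_mul_of_nonneg_right (by linarith) (by positivity)).trans (hbig (by positivity))
  · calc (N : ℝ) * (K * N + N) ≤ (a ^ 2 + 1) / ε ^ 2 * ((d * (1 + L) + 1 * (1 + L)) *
          ((a ^ 2 + 1) / ε ^ 2)) := by
          have h1 : (N : ℝ) ≤ 1 * (1 + L) * ((a ^ 2 + 1) / ε ^ 2) := by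
            refine hNu.trans (le_mul_of_one_le_left (by positivity) (by linarith))
          rw [add_mul]
          gcongr
      _ = _ := by field_simp
  · have h1 : C * (1 / (y ^ 3 * Real.sqrt N)) ≤ ε / 4 := by
      have h2 : 1 / (y ^ 3 * Real.sqrt N) ≤ 1 / (y ^ 3 * (a / ε)) := by gcongr
      refine (mul_le_mul_of_nonneg_left h2 hC.le).trans (le_of_eq ?_)
      rw [ha]; field_simp
    have h2 : C * (1 / y ^ 2 * Real.exp (-c * y ^ 2 * K)) ≤ ε / 4 := by
      have h3 : -c * y ^ 2 * K ≤ -Real.log (4 * C / y ^ 2) - Real.log (1 / ε) := by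
        rw [div_le_iff₀ (by positivity)] at hKl
        have := le_abs_self (Real.log (4 * C / y ^ 2))
        rw [← hl] at this
        linarith
      have h4 : Real.exp (-c * y ^ 2 * K) ≤ y ^ 2 / (4 * C) * ε := by
        refine (Real.exp_le_exp.2 h3).trans (le_of_eq ?_)
        rw [sub_eq_add_neg, Real.exp_add, Real.exp_neg, Real.exp_neg, Real.exp_log (by positivity),
          Real.exp_log (by positivity), inv_div, inv_div, div_one]
      calc _ ≤ C * (1 / y ^ 2 * (y ^ 2 / (4 * C) * ε)) := by gcongr
        _ = _ := by field_simp
    linarith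

end

theorem theorem2 {S : Type u} {A : Type v} [Fintype S] [Fintype A] [DecidableEq S] (q : ℕ)
    (μ Lψ CM ρ Cr Lr Cα Rmax ζmin : ℝ)
    (hμ : 0 < μ) (hCM : 0 < CM) (hρ₀ : 0 < ρ) (hρ₁ : ρ < 1) (hζ : 0 < ζmin) :
    -- the convergence bound, with constants that do not depend on `γ`, `T`, `K`, `B`, `b`
    (∃ C c : ℝ, 0 < C ∧ 0 < c ∧
      ∀ G : GAILProblem S A q, G.Assumptions μ Lψ CM ρ Cr Lr Cα Rmax ζmin →
      ∀ T K B b : ℕ, 1 ≤ T → 1 ≤ K → 1 ≤ B → 1 ≤ b →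
      ∀ (Ω : Type w) [MeasurableSpace Ω] (Pr : Measure Ω) [IsProbabilityMeasure Pr]
        (R : FWPGRun G ((1 - G.γ) / Real.sqrt T) (μ / (4 * L22 q G.γ Lr Lψ ^ 2)) T K B b Pr),
      (∀ t < T, Integrable (fun ω => G.g (R.θ t ω)) Pr) ∧
      ∀ θs ∈ policySimplex S A, IsMinOn G.g (policySimplex S A) θs →
        R.avgValue - G.g θs ≤
          C * (1 / ((1 - G.γ) ^ 3 * Real.sqrt T)
            + 1 / (1 - G.γ) ^ 2 * Real.exp (-c * (1 - G.γ) ^ 2 * K)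
            + 1 / ((1 - G.γ) ^ 3 * Real.sqrt B)
            + 1 / ((1 - G.γ) ^ 3 * Real.sqrt b))) ∧
    -- the sample complexity
    (∀ γ : ℝ, 0 < γ → γ < 1 → ∃ C : ℝ, 0 < C ∧ ∀ ε : ℝ, 0 < ε → ε < 1 →
      ∃ T K B b : ℕ, 1 ≤ T ∧ 1 ≤ K ∧ 1 ≤ B ∧ 1 ≤ b ∧
        (T : ℝ) ≤ C / ε ^ 2 ∧ (K : ℝ) ≤ C * (1 + Real.log (1 / ε)) ∧
        (B : ℝ) ≤ C / ε ^ 2 ∧ (b : ℝ) ≤ C / ε ^ 2 ∧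
        (T : ℝ) * (K * B + b) ≤ C / ε ^ 4 * (1 + Real.log (1 / ε)) ∧
        ∀ G : GAILProblem S A q, G.γ = γ → G.Assumptions μ Lψ CM ρ Cr Lr Cα Rmax ζmin →
        ∀ (Ω : Type w) [MeasurableSpace Ω] (Pr : Measure Ω) [IsProbabilityMeasure Pr]
          (R : FWPGRun G ((1 - G.γ) / Real.sqrt T) (μ / (4 * L22 q G.γ Lr Lψ ^ 2)) T K B b Pr),
        ∀ θs ∈ policySimplex S A, IsMinOn G.g (policySimplex S A) θs →
          R.avgValue - G.g θs ≤ ε) := by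
  have hconv := fwpg_convergence.{u, v, w} (S := S) (A := A) q μ Lψ CM ρ Cr Lr Cα Rmax ζmin
    hμ hCM hρ₀ hρ₁ hζ
  refine ⟨hconv, fun γ _ hγ₁ => ?_⟩
  obtain ⟨C, c, hC, hc, h⟩ := hconv
  obtain ⟨D, hD, hpar⟩ := exists_parameters hC hc (sub_pos.2 hγ₁)
  refine ⟨D, hD, fun ε hε₀ hε₁ => ?_⟩
  obtain ⟨N, K, hN, hK, hND, hKD, hNK, hb⟩ := hpar ε hε₀ hε₁
  -- `T`, `B` and `b` are all of order `ε⁻²`, so a common value `N` serves.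
  refine ⟨N, K, N, N, hN, hK, hN, hN, hND, hKD, hND, hND, hNK, ?_⟩
  rintro G rfl hG Ω _ Pr _ R θs hθs hmin
  exact ((h G hG N K N N hN hK hN hN Ω Pr R).2 θs hθs hmin).trans hb
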